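/- Fix a dimension $p\ge 1$ (the interesting case being $p\ge 2$) and a unit vector $\theta_0\in\mathbb R^p$. A \emph{shape matrix} is a symmetric positive definite $p\times p$ matrix with trace $p$. Let $(V_{0n})$ be an arbitrary sequence of null shape matrices: for every $n$, $V_{0n}$ is a shape matrix with a spectral decomposition $$V_{0n}=\lambda_{n1}\theta_0\theta_0'+\sum_{j=2}^p\lambda_{nj}\theta_{nj}\theta_{nj}',\qquad \lambda_{n1}>\lambda_{n2}\ge\dots\ge\lambda_{np},$$ where $\theta_0,\theta_{n2},\dots,\theta_{np}$ is an orthonormal basis of $\mathbb R^p$. The spectrum is otherwise arbitrary (several spikes are allowed), and $\lambda_{n1}/\lambda_{n2}$ may converge to $1$ at any rate. Let ${\rm P}^{(n)}_{V}$ be the law of a random sample $U_{n1},\dots,U_{nn}$ from the angular Gaussian distribution with shape matrix $V$, that is, the distribution on the unit sphere $\mathcal S^{p-1}$ with density $u\mapsto \frac{\Gamma(p/2)}{2\pi^{p/2}(\det V)^{1/2}}(u'V^{-1}u)^{-p/2}$ with respect to the surface area measure. Put $$S_n(V)=\frac1n\sum_{i=1}^n\frac{V^{-1/2}U_{ni}U_{ni}'V^{-1/2}}{\|V^{-1/2}U_{ni}\|^2},\qquad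 T_n(V)=n\,p(p+2)\,\big\|(I_p-\theta_0\theta_0')S_n(V)\theta_0\big\|^2 .$$ Let $\hat V_n$ be Tyler's M-estimator, i.e. the shape matrix satisfying $S_n(\hat V_n)=\frac1p I_p$ (by convention $\hat V_n=I_p$ for samples for which no such matrix exists, and some fixed choice of a solution if there are several), and let $\hat V_n=\sum_{j=1}^p\hat\lambda_{nj}\hat\theta_{nj}\hat\theta_{nj}'$ be any spectral decomposition of it, with $\hat\lambda_{n1}\ge\dots\ge\hat\lambda_{np}$ and orthonormal $\hat\theta_{nj}$. Let $\tilde\theta_{n2},\dots,\tilde\theta_{np}$ result from the Gram--Schmidt orthonormalization of $\theta_0,\hat\theta_{n2},\dots,\hat\theta_{np}$, i.e. recursively $$\tilde\theta_{nj}=\frac{\big(I_p-\theta_0\theta_0'-\sum_{k=2}^{j-1}\tilde\theta_{nk}\tilde\theta_{nk}'\big)\hat\theta_{nj}}{\big\|\big(I_p-\theta_0\theta_0'-\sum_{k=2}^{j-1}\tilde\theta_{nk}\tilde\theta_{nk}'\big)\hat\theta_{nj}\big\|},\qquad j=2,\dots,p$$ (with value $0$ if the denominator vanishes), and let $\tilde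 V_{0n}=\hat\lambda_{n1}\theta_0\theta_0'+\sum_{j=2}^p\hat\lambda_{nj}\tilde\theta_{nj}\tilde\theta_{nj}'$. (Should $\tilde V_{0n}$ be singular, $\tilde V_{0n}^{-1/2}$ is the Moore--Penrose inverse of its square root, and summands with zero denominator in $S_n$ are $0$.) Then $T_n(\tilde V_{0n})=T_n(V_{0n})+o_{\rm P}(1)$ as $n\to\infty$ under ${\rm P}^{(n)}_{V_{0n}}$: for every $\varepsilon>0$, $${\rm P}^{(n)}_{V_{0n}}\big[\,|T_n(\tilde V_{0n})-T_n(V_{0n})|\ge\varepsilon\,\big]\to 0 .$$ -/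

import Mathlib

open MeasureTheory Filter Topology

noncomputable section

namespace SignPCA

/-- The unit sphere of `ℝᵖ`. -/
abbrev Sph (p : ℕ) : Type := Metric.sphere (0 : EuclideanSpace ℝ (Fin p)) 1

/-- The matrix-vector product `A x`, as an element of Euclidean space (so that `‖·‖` is the
Euclidean norm). -/
def mulE {p : ℕ} (A : Matrix (Fin p) (Fin p) ℝ) (x : EuclideanSpace ℝ (Fin p)) :
    EuclideanSpace ℝ (Fin p) :=
  WithLp.toLp 2 (A.mulVec x.ofLp)

/-- The rank-one matrix `x x'`. -/
def outer {p : ℕ} (x : EuclideanSpace ℝ (Fin p)) : Matrix (Fin p) (Fin p) ℝ :=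
  Matrix.vecMulVec x.ofLp x.ofLp

/-- Shape matrices: symmetric positive definite matrices with trace `p`. -/
structure IsShape {p : ℕ} (V : Matrix (Fin p) (Fin p) ℝ) : Prop where
  posDef : V.PosDef
  trace_eq : V.trace = p

/-- The matrix `∑ⱼ lⱼ tⱼ tⱼ'`. -/
def spectralSum {p : ℕ} (l : Fin p → ℝ) (t : Fin p → EuclideanSpace ℝ (Fin p)) :
    Matrix (Fin p) (Fin p) ℝ :=
  ∑ j, l j • outer (t j)

/-- `V = ∑ⱼ lⱼ tⱼ tⱼ'` is a spectral decomposition of `V`: the `tⱼ` are orthonormal and the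
eigenvalues are ordered, `l₀ ≥ l₁ ≥ …` (indices start at `0`). -/
structure IsSpectralDecomp {p : ℕ} (V : Matrix (Fin p) (Fin p) ℝ) (l : Fin p → ℝ)
    (t : Fin p → EuclideanSpace ℝ (Fin p)) : Prop where
  orthonormal : Orthonormal ℝ t
  antitone : Antitone l
  eq_sum : V = spectralSum l t

/-- Null shape matrices: shape matrices whose largest eigenvalue is simple, with leading
eigenvector `θ₀`. The remaining eigenvalues and eigenvectors are arbitrary. -/
def IsNullShape {p : ℕ} [NeZero p] (θ₀ : EuclideanSpace ℝ (Fin p))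
    (V : Matrix (Fin p) (Fin p) ℝ) : Prop :=
  IsShape V ∧ ∃ (l : Fin p → ℝ) (t : Fin p → EuclideanSpace ℝ (Fin p)),
    IsSpectralDecomp V l t ∧ t 0 = θ₀ ∧ ∀ j, j ≠ 0 → l j < l 0

/-- The angular Gaussian distribution with shape matrix `V`, through its density with respect to
the (unnormalised) surface area measure on the unit sphere. -/
def angularGaussian {p : ℕ} (V : Matrix (Fin p) (Fin p) ℝ) : Measure (Sph p) :=
  (volume : Measure (EuclideanSpace ℝ (Fin p))).toSphere.withDensity fun u =>
    ENNReal.ofReal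
      (Real.Gamma ((p : ℝ) / 2) / (2 * Real.pi ^ ((p : ℝ) / 2) * V.det ^ ((1 : ℝ) / 2)) *
        (u.1.ofLp ⬝ᵥ V⁻¹.mulVec u.1.ofLp) ^ (-(p : ℝ) / 2))

/-- The distribution of a random sample of size `n` from the angular Gaussian distribution. -/
def sampleLaw {p : ℕ} (n : ℕ) (V : Matrix (Fin p) (Fin p) ℝ) : Measure (Fin n → Sph p) :=
  Measure.pi fun _ => angularGaussian V

/-- `V^{-1/2}`, the symmetric inverse square root, by functional calculus. -/
def invSqrt {p : ℕ} (V : Matrix (Fin p) (Fin p) ℝ) : Matrix (Fin p) (Fin p) ℝ :=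
  cfc (fun x : ℝ => (√x)⁻¹) V

/-- `Sₙ(V) = n⁻¹ ∑ᵢ V^{-1/2} Uᵢ Uᵢ' V^{-1/2} / ‖V^{-1/2} Uᵢ‖²`. -/
def signCov {p n : ℕ} (U : Fin n → Sph p) (V : Matrix (Fin p) (Fin p) ℝ) :
    Matrix (Fin p) (Fin p) ℝ :=
  (n : ℝ)⁻¹ • ∑ i, (‖mulE (invSqrt V) (U i)‖ ^ 2)⁻¹ •
    (invSqrt V * outer (U i).1 * invSqrt V)

/-- `Tₙ(V) = n p (p + 2) ‖(I - θ₀ θ₀') Sₙ(V) θ₀‖²`. -/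
def testStat {p n : ℕ} (θ₀ : EuclideanSpace ℝ (Fin p)) (U : Fin n → Sph p)
    (V : Matrix (Fin p) (Fin p) ℝ) : ℝ :=
  n * p * (p + 2) * ‖mulE ((1 - outer θ₀) * signCov U V) θ₀‖ ^ 2

/-- `V` solves the equation of Tyler's M-estimator: it is a shape matrix with
`Sₙ(V) = (1/p) I`. -/
def IsTyler {p n : ℕ} (U : Fin n → Sph p) (V : Matrix (Fin p) (Fin p) ℝ) : Prop :=
  IsShape V ∧ signCov U V = (p : ℝ)⁻¹ • (1 : Matrix (Fin p) (Fin p) ℝ)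

open Classical in
/-- Tyler's M-estimator of shape. If the defining equation has no solution (for instance if
`n < p`), the value is, by convention, the identity matrix. -/
def tyler {p n : ℕ} (U : Fin n → Sph p) : Matrix (Fin p) (Fin p) ℝ :=
  if h : ∃ V, IsTyler U V then h.choose else 1

/-- The Gram–Schmidt orthonormalisation of `θ₀, t₁, …, t_{p-1}` (the family `t` with `t₀`
replaced by `θ₀`). -/
def correctedVecs {p : ℕ} [NeZero p] (θ₀ : EuclideanSpace ℝ (Fin p))
    (t : Fin p → EuclideanSpace ℝ (Fin p)) : Fin p → EuclideanSpace ℝ (Fin p) :=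
  InnerProductSpace.gramSchmidtNormed ℝ (Function.update t 0 θ₀)

/-- The estimator `l₀ θ₀ θ₀' + ∑_{j ≥ 1} lⱼ t̃ⱼ t̃ⱼ'` of the null shape matrix, where the `t̃ⱼ`
are the corrected eigenvectors. -/
def correctedShape {p : ℕ} [NeZero p] (θ₀ : EuclideanSpace ℝ (Fin p)) (l : Fin p → ℝ)
    (t : Fin p → EuclideanSpace ℝ (Fin p)) : Matrix (Fin p) (Fin p) ℝ :=
  l 0 • outer θ₀ + ∑ j ∈ Finset.univ.erase 0, l j • outer (correctedVecs θ₀ t j)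

end SignPCA

end

/-! Write `V₀ = L * L` with `L` symmetric, and let `W` be the sample of directions of `L⁻¹ Uᵢ`,
which is uniform on the sphere. The argument is deterministic on the event that the fourth empirical
moments of `W` are within `δ`, of order `n^{-1/2}`, of their uniform values (`IsBalanced`), apart
from one anti-concentration estimate. Errors are measured relative to `L`, so the bounds are uniform
over all null shapes and all spectral gaps.

On the balanced event Tyler's estimator exists and is a multiple of `L * H * L` with `‖H - 1‖ =
O(δ)` (`exists_solvesTyler`, `norm_sub_one_le_of_solvesTyler`). The corrected matrix is again a
relative `O(δ)` perturbation of `L * L`, as long as the leading eigenvector `t 0` is not nearly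
orthogonal to `θ₀`. Indeed, the correction of `t j` changes squared coordinates by an amount
proportional to `⟪θ₀, t j⟫`, this change enters the quadratic form with the weight `l 0 - l j`, and
the product of the two is `O(δ √(l 0 * l j))` whatever the gap (`IsPerturbation.eigenvector_bounds`,
`abs_correctedForm_sub_le`). Since `θ₀` is an eigenvector of the corrected matrix, inserting that
matrix in the statistic amounts to perturbing the identity by some `F = O(δ)` with `F θ₀ = 0`. The
first-order effect of `F` is, up to `O(δ²)`, a multiple of `θ₀` and is projected away. Hence a
vector of size `O(δ)` moves by `O(δ²)`, and the statistic by `O(n δ³) = O(n^{-1/2})`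
(`abs_inner_expansion_sub_le`).

If the gap closes quickly, `t 0` is not consistent, and near-orthogonality to `θ₀` has to be
excluded in probability. If `|⟪θ₀, t 0⟫| ≤ s²`, the linearised quadratic form is nearly maximal at
some unit `v ⟂ θ₀` (`IsPerturbation.isNearMax`). Near-stationarity at `v` in the direction `θ₀` then
bounds `∑ ⟪W i, θ₀⟫ * ⟪W i, mulE L v⟫` by a multiple of `s √n ‖mulE L θ₀‖`, up to terms negligible
for large `n` (`IsNearMax.bounds`). Reversing signs of the `θ₀`-components of the `W i` preserves
the law of the sample and the form on `θ₀^⊥`, so one `v` serves all sign patterns. The sum is then a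
Rademacher sum with nondegenerate variance, and a small-ball inequality (`card_abs_sum_le`) gives
probability `O(s)`. -/

namespace SignPCA

/-! ### Matrices acting on Euclidean space, and the Frobenius norm -/

section MatrixCalculus

open Matrix RealInnerProductSpace

attribute [local instance] Matrix.frobeniusNormedRing Matrix.frobeniusNormedSpace

variable {p : ℕ}

lemma inner_eq_dotProduct (x y : EuclideanSpace ℝ (Fin p)) : ⟪x, y⟫ = x.ofLp ⬝ᵥ y.ofLp := by
  simp [PiLp.inner_apply, dotProduct, mul_comm]

lemma mulE_add (A : Matrix (Fin p) (Fin p) ℝ) (x y : EuclideanSpace ℝ (Fin p)) :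
    mulE A (x + y) = mulE A x + mulE A y := by
  simp [mulE, mulVec_add]

lemma mulE_sub (A : Matrix (Fin p) (Fin p) ℝ) (x y : EuclideanSpace ℝ (Fin p)) :
    mulE A (x - y) = mulE A x - mulE A y := by
  simp [mulE, mulVec_sub]

lemma mulE_smul (A : Matrix (Fin p) (Fin p) ℝ) (c : ℝ) (x : EuclideanSpace ℝ (Fin p)) :
    mulE A (c • x) = c • mulE A x := by
  simp [mulE, mulVec_smul]

lemma mulE_zero (A : Matrix (Fin p) (Fin p) ℝ) : mulE A 0 = 0 := by
  simp [mulE]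

lemma mulE_sum {ι : Type*} (s : Finset ι) (A : Matrix (Fin p) (Fin p) ℝ)
    (x : ι → EuclideanSpace ℝ (Fin p)) : mulE A (∑ i ∈ s, x i) = ∑ i ∈ s, mulE A (x i) := by
  induction s using Finset.cons_induction with
  | empty => simp [mulE_zero]
  | cons a s ha ih => simp [mulE_add, ih]

lemma add_mulE (A B : Matrix (Fin p) (Fin p) ℝ) (x : EuclideanSpace ℝ (Fin p)) :
    mulE (A + B) x = mulE A x + mulE B x := by
  simp [mulE, add_mulVec]

lemma sub_mulE (A B : Matrix (Fin p) (Fin p) ℝ) (x : EuclideanSpace ℝ (Fin p)) :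
    mulE (A - B) x = mulE A x - mulE B x := by
  simp [mulE, sub_mulVec]

lemma smul_mulE (c : ℝ) (A : Matrix (Fin p) (Fin p) ℝ) (x : EuclideanSpace ℝ (Fin p)) :
    mulE (c • A) x = c • mulE A x := by
  simp [mulE, smul_mulVec]

lemma zero_mulE (x : EuclideanSpace ℝ (Fin p)) : mulE 0 x = 0 := by
  simp [mulE]

lemma one_mulE (x : EuclideanSpace ℝ (Fin p)) : mulE 1 x = x := by
  simp [mulE]

lemma sum_mulE {ι : Type*} (s : Finset ι) (A : ι → Matrix (Fin p) (Fin p) ℝ)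
    (x : EuclideanSpace ℝ (Fin p)) : mulE (∑ i ∈ s, A i) x = ∑ i ∈ s, mulE (A i) x := by
  induction s using Finset.cons_induction with
  | empty => simp [zero_mulE]
  | cons a s ha ih => simp [add_mulE, ih]

lemma mul_mulE (A B : Matrix (Fin p) (Fin p) ℝ) (x : EuclideanSpace ℝ (Fin p)) :
    mulE (A * B) x = mulE A (mulE B x) := by
  simp [mulE, mulVec_mulVec]

lemma inner_mulE_left (A : Matrix (Fin p) (Fin p) ℝ) (x y : EuclideanSpace ℝ (Fin p)) :
    ⟪mulE A x, y⟫ = ⟪x, mulE Aᵀ y⟫ := by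
  simp only [inner_eq_dotProduct, mulE, mulVec_transpose]
  rw [dotProduct_comm, dotProduct_mulVec, dotProduct_comm]

lemma inner_mulE_symm {A : Matrix (Fin p) (Fin p) ℝ} (hA : Aᵀ = A)
    (x y : EuclideanSpace ℝ (Fin p)) : ⟪mulE A x, y⟫ = ⟪x, mulE A y⟫ := by
  rw [inner_mulE_left, hA]

lemma outer_mulE (u x : EuclideanSpace ℝ (Fin p)) : mulE (outer u) x = ⟪u, x⟫ • u := by
  ext i
  simp [mulE, outer, vecMulVec_mulVec, inner_eq_dotProduct]

lemma transpose_outer (u : EuclideanSpace ℝ (Fin p)) : (outer u)ᵀ = outer u := by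
  ext i j; simp [outer, vecMulVec_apply, mul_comm]

lemma outer_smul (c : ℝ) (u : EuclideanSpace ℝ (Fin p)) : outer (c • u) = c ^ 2 • outer u := by
  ext i j; simp [outer, vecMulVec_apply]; ring

lemma mul_outer_mul (A : Matrix (Fin p) (Fin p) ℝ) (u : EuclideanSpace ℝ (Fin p)) :
    A * outer u * Aᵀ = outer (mulE A u) := by
  simp [outer, mulE, mul_vecMulVec, vecMulVec_mul, vecMul_transpose]

lemma mulE_ext {A B : Matrix (Fin p) (Fin p) ℝ} (h : ∀ x, mulE A x = mulE B x) : A = B := by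
  apply Matrix.toLin'.injective
  ext1 i
  ext j
  have := congrArg (fun z => z.ofLp j) (h (WithLp.toLp 2 (Pi.single i 1)))
  simpa [mulE] using this

lemma trace_mul_outer (A : Matrix (Fin p) (Fin p) ℝ) (u : EuclideanSpace ℝ (Fin p)) :
    (A * outer u).trace = ⟪u, mulE A u⟫ := by
  simp [outer, mul_vecMulVec, trace_vecMulVec, inner_eq_dotProduct, mulE, dotProduct_comm]

lemma trace_outer (u : EuclideanSpace ℝ (Fin p)) : (outer u).trace = ‖u‖ ^ 2 := by
  rw [← real_inner_self_eq_norm_sq, inner_eq_dotProduct, outer, trace_vecMulVec]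

lemma frobenius_norm_sq (A : Matrix (Fin p) (Fin p) ℝ) : ‖A‖ ^ 2 = ∑ i, ∑ j, A i j ^ 2 := by
  rw [frobenius_norm_def, ← Real.sqrt_eq_rpow, Real.sq_sqrt (by positivity)]
  simp

lemma frobenius_norm_sq_eq_trace (A : Matrix (Fin p) (Fin p) ℝ) : ‖A‖ ^ 2 = (Aᵀ * A).trace := by
  rw [frobenius_norm_sq, Finset.sum_comm]
  simp [trace, mul_apply, sq]

lemma abs_trace_mul_le (A B : Matrix (Fin p) (Fin p) ℝ) : |(A * B).trace| ≤ ‖A‖ * ‖B‖ := by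
  have h : (A * B).trace = ∑ x : Fin p × Fin p, A x.1 x.2 * B x.2 x.1 := by
    simp [trace, mul_apply, Fintype.sum_prod_type]
  apply abs_le_of_sq_le_sq _ (by positivity)
  rw [h, mul_pow, frobenius_norm_sq, frobenius_norm_sq]
  refine (Finset.sum_mul_sq_le_sq_mul_sq _ _ _).trans (le_of_eq ?_)
  congr 1
  · rw [Fintype.sum_prod_type]
  · rw [Fintype.sum_prod_type, Finset.sum_comm]

lemma norm_one_sq : ‖(1 : Matrix (Fin p) (Fin p) ℝ)‖ ^ 2 = p := by
  rw [frobenius_norm_sq_eq_trace]; simp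

lemma abs_trace_le (A : Matrix (Fin p) (Fin p) ℝ) :
    |A.trace| ≤ ‖(1 : Matrix (Fin p) (Fin p) ℝ)‖ * ‖A‖ := by
  simpa using abs_trace_mul_le 1 A

lemma norm_outer (u : EuclideanSpace ℝ (Fin p)) : ‖outer u‖ = ‖u‖ ^ 2 := by
  rw [← sq_eq_sq₀ (norm_nonneg _) (by positivity), frobenius_norm_sq_eq_trace, transpose_outer,
    trace_mul_outer, outer_mulE, inner_smul_right, real_inner_self_eq_norm_sq]
  ring

lemma norm_mulE_le (A : Matrix (Fin p) (Fin p) ℝ) (x : EuclideanSpace ℝ (Fin p)) :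
    ‖mulE A x‖ ≤ ‖A‖ * ‖x‖ := by
  refine (sq_le_sq₀ (norm_nonneg _) (by positivity)).1 ?_
  rw [mul_pow, frobenius_norm_sq, EuclideanSpace.norm_sq_eq, EuclideanSpace.norm_sq_eq,
    Finset.sum_mul]
  refine Finset.sum_le_sum fun i _ => ?_
  simpa [mulE, mulVec, dotProduct] using
    Finset.sum_mul_sq_le_sq_mul_sq Finset.univ (A i) x.ofLp

lemma abs_inner_mulE_le (A : Matrix (Fin p) (Fin p) ℝ) (x y : EuclideanSpace ℝ (Fin p)) :
    |⟪x, mulE A y⟫| ≤ ‖A‖ * ‖x‖ * ‖y‖ := by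
  refine (abs_real_inner_le_norm _ _).trans ?_
  have := mul_le_mul_of_nonneg_left (norm_mulE_le A y) (norm_nonneg x)
  linarith

lemma posDef_iff_inner {A : Matrix (Fin p) (Fin p) ℝ} :
    A.PosDef ↔ Aᵀ = A ∧ ∀ x, x ≠ 0 → 0 < ⟪x, mulE A x⟫ := by
  rw [posDef_iff_dotProduct_mulVec, IsHermitian, conjTranspose_eq_transpose_of_trivial]
  refine and_congr_right fun _ => ⟨fun h x hx => ?_, fun h x hx => ?_⟩
  · have := h (x := x.ofLp) (by simpa using hx)
    simpa [inner_eq_dotProduct, mulE] using this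
  · have := h (WithLp.toLp 2 x) (by simpa using hx)
    simpa [inner_eq_dotProduct, mulE] using this

end MatrixCalculus

end SignPCA

namespace SignPCA

/-! ### Tyler's equation for a balanced sample: rate of convergence -/

section TylerRate

open Matrix RealInnerProductSpace

attribute [local instance] Matrix.frobeniusNormedRing Matrix.frobeniusNormedSpace

variable {p n : ℕ}

/-- The weighted average `n⁻¹ ∑ᵢ cᵢ Wᵢ Wᵢ'`. -/
noncomputable def outerAvg (W : Fin n → EuclideanSpace ℝ (Fin p)) (c : Fin n → ℝ) :
    Matrix (Fin p) (Fin p) ℝ :=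
  (n : ℝ)⁻¹ • ∑ i, c i • outer (W i)

/-- The fourth empirical moment `C ↦ n⁻¹ ∑ᵢ (Wᵢ' C Wᵢ) Wᵢ Wᵢ'`. -/
noncomputable def momentMap (W : Fin n → EuclideanSpace ℝ (Fin p))
    (C : Matrix (Fin p) (Fin p) ℝ) : Matrix (Fin p) (Fin p) ℝ :=
  outerAvg W fun i => ⟪W i, mulE C (W i)⟫

/-- The points `Wᵢ` are unit vectors whose empirical fourth moments are `δ`-close to those of the
uniform distribution on the sphere. -/
structure IsBalanced (δ : ℝ) (W : Fin n → EuclideanSpace ℝ (Fin p)) : Prop where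
  norm_eq : ∀ i, ‖W i‖ = 1
  moment : ∀ C, ‖momentMap W C - ((p : ℝ) * (p + 2))⁻¹ • (C + Cᵀ + C.trace • 1)‖ ≤ δ * ‖C‖

/-- The equation of Tyler's M-estimator, for the inverse `A` of the shape matrix. -/
def SolvesTyler (W : Fin n → EuclideanSpace ℝ (Fin p)) (A : Matrix (Fin p) (Fin p) ℝ) : Prop :=
  outerAvg W (fun i => ⟪W i, mulE A (W i)⟫⁻¹) = (p : ℝ)⁻¹ • A⁻¹

lemma outerAvg_sub (W : Fin n → EuclideanSpace ℝ (Fin p)) (c d : Fin n → ℝ) :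
    outerAvg W (fun i => c i - d i) = outerAvg W c - outerAvg W d := by
  simp [outerAvg, sub_smul, smul_sub]

lemma outerAvg_add (W : Fin n → EuclideanSpace ℝ (Fin p)) (c d : Fin n → ℝ) :
    outerAvg W (fun i => c i + d i) = outerAvg W c + outerAvg W d := by
  simp [outerAvg, add_smul, smul_add, Finset.sum_add_distrib]

lemma outerAvg_smul (W : Fin n → EuclideanSpace ℝ (Fin p)) (a : ℝ) (c : Fin n → ℝ) :
    outerAvg W (fun i => a * c i) = a • outerAvg W c := by
  simp only [outerAvg, mul_smul, ← Finset.smul_sum]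
  rw [smul_comm]

lemma transpose_outerAvg (W : Fin n → EuclideanSpace ℝ (Fin p)) (c : Fin n → ℝ) :
    (outerAvg W c)ᵀ = outerAvg W c := by
  simp [outerAvg, transpose_sum, transpose_outer]

lemma trace_mul_outerAvg (W : Fin n → EuclideanSpace ℝ (Fin p)) (c : Fin n → ℝ)
    (A : Matrix (Fin p) (Fin p) ℝ) :
    (A * outerAvg W c).trace = (n : ℝ)⁻¹ * ∑ i, c i * ⟪W i, mulE A (W i)⟫ := by
  simp [outerAvg, Matrix.mul_sum, trace_sum, trace_mul_outer]

lemma outerAvg_mulE (W : Fin n → EuclideanSpace ℝ (Fin p)) (c : Fin n → ℝ)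
    (x : EuclideanSpace ℝ (Fin p)) :
    mulE (outerAvg W c) x = (n : ℝ)⁻¹ • ∑ i, (c i * ⟪W i, x⟫) • W i := by
  simp [outerAvg, smul_mulE, sum_mulE, outer_mulE, smul_smul]

lemma average_le {c : Fin n → ℝ} {b : ℝ} (hb : 0 ≤ b) (hc : ∀ i, c i ≤ b) :
    (n : ℝ)⁻¹ * ∑ i, c i ≤ b := by
  rcases Nat.eq_zero_or_pos n with rfl | hn
  · simpa
  · rw [inv_mul_le_iff₀ (by positivity)]
    simpa using Finset.sum_le_sum fun i (_ : i ∈ Finset.univ) => hc i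

lemma norm_outerAvg_le {W : Fin n → EuclideanSpace ℝ (Fin p)} (hW : ∀ i, ‖W i‖ = 1)
    {c : Fin n → ℝ} {b : ℝ} (hb : 0 ≤ b) (hc : ∀ i, |c i| ≤ b) : ‖outerAvg W c‖ ≤ b := by
  refine le_trans ?_ (average_le hb hc)
  rw [outerAvg, norm_smul, norm_inv, Real.norm_natCast]
  gcongr
  refine (norm_sum_le _ _).trans (Finset.sum_le_sum fun i _ => ?_)
  rw [norm_smul, norm_outer, hW i]
  simp

lemma abs_inner_mulE_self_le {W : Fin n → EuclideanSpace ℝ (Fin p)} (hW : ∀ i, ‖W i‖ = 1)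
    (C : Matrix (Fin p) (Fin p) ℝ) (i : Fin n) : |⟪W i, mulE C (W i)⟫| ≤ ‖C‖ := by
  simpa [hW i] using abs_inner_mulE_le C (W i) (W i)

lemma momentMap_one {W : Fin n → EuclideanSpace ℝ (Fin p)} (hW : ∀ i, ‖W i‖ = 1) :
    momentMap W 1 = outerAvg W fun _ => 1 := by
  simp [momentMap, one_mulE, hW]

lemma norm_one_le [NeZero p] : ‖(1 : Matrix (Fin p) (Fin p) ℝ)‖ ≤ p := by
  have hp : (1 : ℝ) ≤ p := by exact_mod_cast Nat.one_le_iff_ne_zero.2 (NeZero.ne p)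
  refine (sq_le_sq₀ (norm_nonneg _) (by positivity)).1 ?_
  rw [norm_one_sq]; nlinarith

lemma IsBalanced.nonneg [NeZero p] {δ : ℝ} {W : Fin n → EuclideanSpace ℝ (Fin p)}
    (h : IsBalanced δ W) : 0 ≤ δ := by
  have h1 := (norm_nonneg _).trans (h.moment 1)
  have hp : 0 < (p : ℝ) := by exact_mod_cast Nat.pos_of_ne_zero (NeZero.ne p)
  have : 0 < ‖(1 : Matrix (Fin p) (Fin p) ℝ)‖ := by
    refine (norm_nonneg _).lt_of_ne fun h0 => hp.ne' ?_
    rw [← norm_one_sq, ← h0, zero_pow two_ne_zero]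
  exact nonneg_of_mul_nonneg_left h1 this

lemma IsBalanced.norm_cov_sub_le [NeZero p] {δ : ℝ} {W : Fin n → EuclideanSpace ℝ (Fin p)}
    (h : IsBalanced δ W) : ‖(outerAvg W fun _ => 1) - (p : ℝ)⁻¹ • 1‖ ≤ p * δ := by
  have hp : 0 < (p : ℝ) := by exact_mod_cast Nat.pos_of_ne_zero (NeZero.ne p)
  have h1 := h.moment 1
  rw [momentMap_one h.norm_eq] at h1
  have e : ((p : ℝ) * (p + 2))⁻¹ • (1 + (1 : Matrix (Fin p) (Fin p) ℝ)ᵀ +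
      (1 : Matrix (Fin p) (Fin p) ℝ).trace • (1 : Matrix (Fin p) (Fin p) ℝ)) = (p : ℝ)⁻¹ • 1 := by
    rw [transpose_one, trace_one, Fintype.card_fin]
    rw [show (1 : Matrix (Fin p) (Fin p) ℝ) + 1 + (p : ℝ) • 1 = ((p : ℝ) + 2) • 1 by
      rw [add_smul, two_smul]; abel, smul_smul]
    congr 1
    field_simp
  rw [e] at h1
  refine h1.trans ?_
  rw [mul_comm]
  exact mul_le_mul_of_nonneg_right norm_one_le h.nonneg

lemma IsBalanced.norm_moment_sub_le [NeZero p] {δ : ℝ} {W : Fin n → EuclideanSpace ℝ (Fin p)}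
    (h : IsBalanced δ W) {C : Matrix (Fin p) (Fin p) ℝ} (hC : Cᵀ = C) (ht : C.trace = 0) :
    ‖momentMap W C - (2 * ((p : ℝ) * (p + 2))⁻¹) • C‖ ≤ δ * ‖C‖ := by
  have h1 := h.moment C
  rwa [hC, ht, zero_smul, add_zero, ← two_smul ℝ C, smul_smul, mul_comm _ (2 : ℝ)] at h1

/-- The bound holds for every solution, with no a priori closeness to the identity, so uniqueness is
never needed. With `A = 1 + C`, tracing Tyler's equation against `A * A` and subtracting the mean of
`1 + w i` bounds the average of `N i = ‖C W i‖² - (w i)²` by a term linear in `‖C‖` and in `δ`. By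
isotropy that average is about `‖C‖² / (p + 2)`, and dividing by `‖C‖` gives the rate. -/
lemma norm_sub_one_le_of_solvesTyler [NeZero p] (hn : 0 < n) {δ : ℝ}
    {W : Fin n → EuclideanSpace ℝ (Fin p)} (h : IsBalanced δ W)
    (hδ : δ * (p + 1) ≤ (4 * ((p : ℝ) + 2))⁻¹) {A : Matrix (Fin p) (Fin p) ℝ} (hA : A.PosDef)
    (htr : A.trace = p) (hs : SolvesTyler W A) : ‖A - 1‖ ≤ 2 * p * (p + 2) * δ := by
  have hp : 0 < (p : ℝ) := by exact_mod_cast Nat.pos_of_ne_zero (NeZero.ne p)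
  have hn' : 0 < (n : ℝ) := by exact_mod_cast hn
  have hδ0 := h.nonneg
  obtain ⟨hAs, hApos⟩ := posDef_iff_inner.1 hA
  obtain ⟨C, rfl⟩ : ∃ C, A = 1 + C := ⟨A - 1, by abel⟩
  rw [add_sub_cancel_left]
  have hC : Cᵀ = C := by simpa using hAs
  have ht : C.trace = 0 := by simpa using htr
  set γ := ‖C‖ with hγ
  have hγ0 : 0 ≤ γ := norm_nonneg _
  set S := outerAvg W fun _ => 1 with hS
  have hS1 := h.norm_cov_sub_le
  rw [← hS] at hS1
  have unit : IsUnit (1 + C).det := (Matrix.isUnit_iff_isUnit_det _).1 hA.isUnit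
  set w : Fin n → ℝ := fun i => ⟪W i, mulE C (W i)⟫ with hw
  have hwA : ∀ i, ⟪W i, mulE (1 + C) (W i)⟫ = 1 + w i := fun i => by
    simp [add_mulE, one_mulE, inner_add_right, h.norm_eq i, hw]
  have hwpos : ∀ i, 0 < 1 + w i := fun i => by
    rw [← hwA]; exact hApos _ (fun h0 => by simpa [h0] using h.norm_eq i)
  have hwle : ∀ i, |w i| ≤ γ := fun i => abs_inner_mulE_self_le h.norm_eq C i
  set N : Fin n → ℝ := fun i => ‖mulE C (W i)‖ ^ 2 - w i ^ 2 with hN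
  have hCC : ∀ i, ⟪W i, mulE (C * C) (W i)⟫ = ‖mulE C (W i)‖ ^ 2 := fun i => by
    rw [mul_mulE, ← inner_mulE_symm hC, real_inner_self_eq_norm_sq]
  have hN0 : ∀ i, 0 ≤ N i := fun i => by
    have := abs_real_inner_le_norm (W i) (mulE C (W i))
    rw [h.norm_eq i, one_mul] at this
    have := pow_le_pow_left₀ (abs_nonneg _) this 2
    rw [sq_abs] at this
    simp only [hN, hw]; linarith
  -- The trace of Tyler's equation multiplied by `(1 + C)²`; the right-hand side becomes `A.trace /
  -- p = 1`.
  have e1 : (n : ℝ)⁻¹ * ∑ i, (1 + w i)⁻¹ * (1 + 2 * w i + ‖mulE C (W i)‖ ^ 2) = 1 := by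
    have := congrArg (fun B => (((1 + C) * (1 + C)) * B).trace) hs
    simp only [trace_mul_outerAvg, Matrix.mul_smul, trace_smul,
      Matrix.mul_nonsing_inv_cancel_right _ _ unit, htr, smul_eq_mul] at this
    rw [inv_mul_cancel₀ hp.ne'] at this
    refine Eq.trans ?_ this
    congr 1
    refine Finset.sum_congr rfl fun i _ => ?_
    rw [hwA]
    congr 1
    rw [← hCC]
    simp only [mul_mulE, add_mulE, one_mulE, mulE_add, inner_add_right,
      real_inner_self_eq_norm_sq, h.norm_eq i, hw]
    ring
  have e2 : (n : ℝ)⁻¹ * ∑ i, (1 + w i) = 1 + (C * S).trace := by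
    rw [hS, trace_mul_outerAvg, Finset.sum_add_distrib, mul_add]
    simp [hn'.ne', hw]
  have e3 : |(C * S).trace| ≤ γ * (p * δ) := by
    have : (C * S).trace = (C * (S - (p : ℝ)⁻¹ • 1)).trace := by
      simp [mul_sub, ht]
    rw [this]
    exact (abs_trace_mul_le _ _).trans (mul_le_mul_of_nonneg_left hS1 hγ0)
  -- Each difference of the summands in `e1` and `e2` is exactly `N i / (1 + w i)`, and `1 + w i ≤ 1
  -- + γ`.
  have e4 : (n : ℝ)⁻¹ * ∑ i, N i ≤ (1 + γ) * (γ * (p * δ)) := by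
    have h1 : ∀ i, N i ≤ (1 + γ) * ((1 + w i)⁻¹ * (1 + 2 * w i + ‖mulE C (W i)‖ ^ 2) -
        (1 + w i)) := fun i => by
      have h2 : (1 + w i)⁻¹ * (1 + 2 * w i + ‖mulE C (W i)‖ ^ 2) - (1 + w i) =
          N i / (1 + w i) := by
        have := (hwpos i).ne'
        simp only [hN]; field_simp; ring
      rw [h2, ← mul_div_assoc, le_div_iff₀ (hwpos i), mul_comm]
      exact mul_le_mul_of_nonneg_right (by linarith [(abs_le.1 (hwle i)).2]) (hN0 i)
    have h3 : ∑ i, N i ≤ (1 + γ) * (∑ i, (1 + w i)⁻¹ * (1 + 2 * w i + ‖mulE C (W i)‖ ^ 2) -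
        ∑ i, (1 + w i)) := by
      rw [← Finset.sum_sub_distrib, Finset.mul_sum]
      exact Finset.sum_le_sum fun i _ => h1 i
    have h4 := mul_le_mul_of_nonneg_left h3 (inv_nonneg.2 hn'.le)
    rw [mul_left_comm, mul_sub, e1, e2] at h4
    refine h4.trans (mul_le_mul_of_nonneg_left ?_ (by linarith))
    linarith [(abs_le.1 e3).1]
  have e5 : γ ^ 2 * (p : ℝ)⁻¹ - γ ^ 2 * (p * δ) ≤
      (n : ℝ)⁻¹ * ∑ i, ‖mulE C (W i)‖ ^ 2 := by
    have h1 : (n : ℝ)⁻¹ * ∑ i, ‖mulE C (W i)‖ ^ 2 = ((C * C) * S).trace := by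
      rw [hS, trace_mul_outerAvg]; simp [hCC]
    have h2 : ((C * C) * S).trace =
        ((C * C) * (S - (p : ℝ)⁻¹ • 1)).trace + γ ^ 2 * (p : ℝ)⁻¹ := by
      rw [hγ, frobenius_norm_sq_eq_trace, hC]
      simp [mul_sub]; ring
    have h3 : |((C * C) * (S - (p : ℝ)⁻¹ • 1)).trace| ≤ γ ^ 2 * (p * δ) := by
      refine (abs_trace_mul_le _ _).trans (mul_le_mul ?_ hS1 (norm_nonneg _) (by positivity))
      rw [sq]; exact norm_mul_le _ _
    rw [h1, h2]
    linarith [(abs_le.1 h3).1]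
  have e6 : (n : ℝ)⁻¹ * ∑ i, w i ^ 2 ≤
      2 * ((p : ℝ) * (p + 2))⁻¹ * γ ^ 2 + δ * γ ^ 2 := by
    have h1 : (n : ℝ)⁻¹ * ∑ i, w i ^ 2 = (C * momentMap W C).trace := by
      rw [momentMap, trace_mul_outerAvg]; simp [hw, sq]
    have h2 : (C * momentMap W C).trace =
        (C * (momentMap W C - (2 * ((p : ℝ) * (p + 2))⁻¹) • C)).trace +
          2 * ((p : ℝ) * (p + 2))⁻¹ * γ ^ 2 := by
      rw [hγ, frobenius_norm_sq_eq_trace, hC]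
      simp [mul_sub]
    have h3 := (abs_trace_mul_le C (momentMap W C - (2 * ((p : ℝ) * (p + 2))⁻¹) • C)).trans
      (mul_le_mul_of_nonneg_left (h.norm_moment_sub_le hC ht) hγ0)
    rw [h1, h2]
    nlinarith [(abs_le.1 h3).2]
  have e7 : (n : ℝ)⁻¹ * ∑ i, N i =
      (n : ℝ)⁻¹ * ∑ i, ‖mulE C (W i)‖ ^ 2 - (n : ℝ)⁻¹ * ∑ i, w i ^ 2 := by
    rw [← mul_sub, ← Finset.sum_sub_distrib]
  -- Coercivity: the second-moment term `1 / p` dominates the fourth-moment term `2 / (p (p + 2))`.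
  have e8 : γ ^ 2 * (p : ℝ)⁻¹ - 2 * ((p : ℝ) * (p + 2))⁻¹ * γ ^ 2 =
      γ ^ 2 * ((p : ℝ) + 2)⁻¹ := by
    field_simp; ring
  have e9 : γ ^ 2 * ((p : ℝ) + 2)⁻¹ ≤ (1 + γ) * (γ * (p * δ)) + γ ^ 2 * (δ * (p + 1)) := by
    linarith
  rcases hγ0.eq_or_lt with h0 | h0
  · rw [← h0]; positivity
  have e10 : γ * ((p : ℝ) + 2)⁻¹ ≤ (1 + γ) * (p * δ) + γ * (δ * (p + 1)) := by
    refine le_of_mul_le_mul_left ?_ h0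
    linarith
  set q := ((p : ℝ) + 2)⁻¹ with hq
  have hq4 : (4 * ((p : ℝ) + 2))⁻¹ = q / 4 := by rw [hq, mul_inv]; ring
  rw [hq4] at hδ
  have e11 : γ * (q / 2) ≤ p * δ := by nlinarith
  have : γ = (γ * (q / 2)) * (2 * (p + 2)) := by rw [hq]; field_simp
  rw [this]
  calc (γ * (q / 2)) * (2 * ((p : ℝ) + 2)) ≤ (p * δ) * (2 * (p + 2)) :=
        mul_le_mul_of_nonneg_right e11 (by positivity)
    _ = _ := by ring

end TylerRate

end SignPCA

namespace SignPCA

/-! ### Tyler's equation for a balanced sample: linearisation and existence -/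

section TylerExistence

open Matrix RealInnerProductSpace

attribute [local instance] Matrix.frobeniusNormedRing Matrix.frobeniusNormedSpace

variable {p n : ℕ}

lemma isUnit_det_one_add {C : Matrix (Fin p) (Fin p) ℝ} (hC : ‖C‖ ≤ 1 / 2) :
    IsUnit (1 + C).det := by
  rw [← Matrix.isUnit_iff_isUnit_det, ← Matrix.mulVec_injective_iff_isUnit]
  intro x y hxy
  have h1 : mulE (1 + C) (WithLp.toLp 2 (x - y)) = 0 := by
    simp only [mulE, mulVec_sub]
    simp [hxy]
  rw [add_mulE, one_mulE, add_eq_zero_iff_eq_neg] at h1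
  have h2 := norm_mulE_le C (WithLp.toLp 2 (x - y))
  rw [← norm_neg, ← h1] at h2
  have h3 : ‖WithLp.toLp 2 (x - y)‖ = 0 := by
    nlinarith [norm_nonneg (WithLp.toLp 2 (x - y))]
  rw [norm_eq_zero] at h3
  exact sub_eq_zero.1 (congrArg WithLp.ofLp h3)

lemma posDef_one_add {C : Matrix (Fin p) (Fin p) ℝ} (hs : Cᵀ = C) (hC : ‖C‖ ≤ 1 / 2) :
    (1 + C).PosDef := by
  refine posDef_iff_inner.2 ⟨by simp [hs], fun x hx => ?_⟩
  have h1 := (abs_le.1 (abs_inner_mulE_le C x x)).1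
  have h2 : 0 < ‖x‖ := norm_pos_iff.2 hx
  rw [add_mulE, one_mulE, inner_add_right, real_inner_self_eq_norm_sq]
  nlinarith

lemma norm_inv_one_add_le [NeZero p] {C : Matrix (Fin p) (Fin p) ℝ} (hC : ‖C‖ ≤ 1 / 2) :
    ‖(1 + C)⁻¹‖ ≤ 2 * p := by
  have h1 : (1 + C)⁻¹ = 1 - C * (1 + C)⁻¹ := by
    have := Matrix.mul_nonsing_inv _ (isUnit_det_one_add hC)
    rw [add_mul, one_mul] at this
    exact eq_sub_of_add_eq this
  have h2 : ‖(1 + C)⁻¹‖ ≤ p + 1 / 2 * ‖(1 + C)⁻¹‖ := by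
    calc ‖(1 + C)⁻¹‖ = ‖1 - C * (1 + C)⁻¹‖ := by rw [← h1]
      _ ≤ ‖(1 : Matrix (Fin p) (Fin p) ℝ)‖ + ‖C * (1 + C)⁻¹‖ := norm_sub_le _ _
      _ ≤ _ := add_le_add norm_one_le ((norm_mul_le _ _).trans
          (mul_le_mul_of_nonneg_right hC (norm_nonneg _)))
  linarith

lemma norm_inv_one_add_sub_one_le [NeZero p] {C : Matrix (Fin p) (Fin p) ℝ} (hC : ‖C‖ ≤ 1 / 2) :
    ‖(1 + C)⁻¹ - 1‖ ≤ 2 * p * ‖C‖ := by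
  have h1 : (1 + C)⁻¹ - 1 = -(C * (1 + C)⁻¹) := by
    have := Matrix.mul_nonsing_inv _ (isUnit_det_one_add hC)
    rw [add_mul, one_mul] at this
    generalize C * (1 + C)⁻¹ = Z at this ⊢
    rw [eq_sub_of_add_eq this]; abel
  rw [h1, norm_neg]
  refine (norm_mul_le _ _).trans ?_
  rw [mul_comm]
  exact mul_le_mul_of_nonneg_right (norm_inv_one_add_le hC) (norm_nonneg _)

lemma inner_one_add_mulE {W : Fin n → EuclideanSpace ℝ (Fin p)} (hW : ∀ i, ‖W i‖ = 1)
    (C : Matrix (Fin p) (Fin p) ℝ) (i : Fin n) :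
    ⟪W i, mulE (1 + C) (W i)⟫ = 1 + ⟪W i, mulE C (W i)⟫ := by
  simp [add_mulE, one_mulE, inner_add_right, hW i]

/-- Tyler's equation gives `(1 + C)⁻¹ ≈ p (S - momentMap W C)`, isotropy gives `momentMap W C ≈ 2 C
/ (p (p + 2))`, and the Neumann series gives `C ≈ 1 - (1 + C)⁻¹`. Eliminating `C` leaves an explicit
approximation of the inverse that is affine in the sample covariance `S`, with an error of second
order. -/
lemma norm_linearisation_sub_le [NeZero p] {δ : ℝ}
    {W : Fin n → EuclideanSpace ℝ (Fin p)} (h : IsBalanced δ W)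
    {C : Matrix (Fin p) (Fin p) ℝ} (hC : Cᵀ = C) (ht : C.trace = 0) (hC2 : ‖C‖ ≤ 1 / 2)
    (hs : SolvesTyler W (1 + C)) :
    ‖(1 + C)⁻¹ - (1 + ((p : ℝ) + 2) • ((outerAvg W fun _ => 1) - (p : ℝ)⁻¹ • 1))‖ ≤
      (p + 2) * (2 * ‖C‖ ^ 2 + δ * ‖C‖) + 4 * ‖C‖ ^ 2 := by
  have hp : 0 < (p : ℝ) := by exact_mod_cast Nat.pos_of_ne_zero (NeZero.ne p)
  have hδ0 := h.nonneg
  set H := (1 + C)⁻¹ with hH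
  set S := outerAvg W fun _ => 1 with hS
  set w : Fin n → ℝ := fun i => ⟪W i, mulE C (W i)⟫ with hw
  have hwle : ∀ i, |w i| ≤ ‖C‖ := fun i => abs_inner_mulE_self_le h.norm_eq C i
  set R1 := H - (1 - C) with hR1
  set R2 := outerAvg W fun i => w i ^ 2 * (1 + w i)⁻¹ with hR2
  set R3 := momentMap W C - (2 * ((p : ℝ) * (p + 2))⁻¹) • C with hR3
  have b1 : ‖R1‖ ≤ 2 * p * ‖C‖ ^ 2 := by
    have : R1 = -(C * (H - 1)) := by
      have := Matrix.mul_nonsing_inv _ (isUnit_det_one_add hC2)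
      rw [add_mul, one_mul, ← hH] at this
      rw [hR1, mul_sub, mul_one]
      generalize C * H = Z at this ⊢
      rw [eq_sub_of_add_eq this]; abel
    rw [this, norm_neg]
    refine (norm_mul_le _ _).trans ?_
    have := mul_le_mul_of_nonneg_left (norm_inv_one_add_sub_one_le hC2) (norm_nonneg C)
    linarith
  have b2 : ‖R2‖ ≤ 2 * ‖C‖ ^ 2 := by
    refine norm_outerAvg_le h.norm_eq (by positivity) fun i => ?_
    have h1 := abs_le.1 (hwle i)
    have h2 : 0 < 1 + w i := by linarith
    rw [abs_of_nonneg (by positivity), ← div_eq_mul_inv, div_le_iff₀ h2]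
    have := pow_le_pow_left₀ (abs_nonneg _) (hwle i) 2
    rw [sq_abs] at this
    nlinarith [sq_nonneg ‖C‖]
  have b3 : ‖R3‖ ≤ δ * ‖C‖ := h.norm_moment_sub_le hC ht
  have e1 : H = (p : ℝ) • (S - momentMap W C + R2) := by
    have h1 : S - momentMap W C + R2 = outerAvg W fun i => ⟪W i, mulE (1 + C) (W i)⟫⁻¹ := by
      rw [hS, momentMap, ← outerAvg_sub, hR2, ← outerAvg_add]
      congr 1
      funext i
      rw [inner_one_add_mulE h.norm_eq]
      have h1 := abs_le.1 (hwle i)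
      have h2 : 1 + w i ≠ 0 := by linarith
      change 1 - w i + w i ^ 2 * (1 + w i)⁻¹ = (1 + w i)⁻¹
      field_simp; ring
    rw [h1, hs, smul_smul, mul_inv_cancel₀ hp.ne', one_smul]
  have e2 : H - (1 + ((p : ℝ) + 2) • (S - (p : ℝ)⁻¹ • 1)) =
      ((p : ℝ) + 2) • (R2 - R3) - (2 * (p : ℝ)⁻¹) • R1 := by
    have e3 : S = (p : ℝ)⁻¹ • H + momentMap W C - R2 := by
      rw [e1, smul_smul, inv_mul_cancel₀ hp.ne', one_smul]; abel
    have e4 : momentMap W C = R3 + (2 * ((p : ℝ) * (p + 2))⁻¹) • C := by rw [hR3]; abel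
    have e5 : H = R1 + 1 - C := by rw [hR1]; abel
    rw [e3, e4, e5]
    ext i j
    simp only [Matrix.sub_apply, Matrix.add_apply, Matrix.smul_apply, smul_eq_mul]
    field_simp
    ring
  rw [e2]
  refine (norm_sub_le _ _).trans (add_le_add ?_ ?_)
  · rw [norm_smul, Real.norm_of_nonneg (by positivity)]
    exact mul_le_mul_of_nonneg_left ((norm_sub_le _ _).trans (add_le_add b2 b3)) (by positivity)
  · rw [norm_smul, Real.norm_of_nonneg (by positivity)]
    refine (mul_le_mul_of_nonneg_left b1 (by positivity)).trans (le_of_eq ?_)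
    field_simp; ring

/-- Up to normalisation, the zeros of this map are the solutions of Tyler's equation; its
derivative at the origin is close to the identity. -/
noncomputable def tylerMap (W : Fin n → EuclideanSpace ℝ (Fin p)) (C : Matrix (Fin p) (Fin p) ℝ) :
    Matrix (Fin p) (Fin p) ℝ :=
  (((p : ℝ) + 2) / p) •
      ((p : ℝ) • outerAvg W (fun i => (1 + ⟪W i, mulE C (W i)⟫)⁻¹) - (1 + C)⁻¹) +
    (C.trace / p) • 1 - (p : ℝ)⁻¹ • (C - Cᵀ)

lemma tylerMap_transpose (W : Fin n → EuclideanSpace ℝ (Fin p)) (C : Matrix (Fin p) (Fin p) ℝ) :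
    tylerMap W Cᵀ = (tylerMap W C)ᵀ := by
  have h : ∀ i, ⟪W i, mulE Cᵀ (W i)⟫ = ⟪W i, mulE C (W i)⟫ := fun i => by
    rw [← inner_mulE_left, real_inner_comm]
  simp only [tylerMap, h, transpose_add, transpose_sub, transpose_smul, transpose_outerAvg,
    transpose_one, transpose_nonsing_inv, trace_transpose, transpose_transpose]

/-- Tracing against `1 + C` kills the Tyler part, by its scale invariance, and leaves `(C.trace / p)
* (p + C.trace) = 0`. The second factor is nonzero because `|C.trace| ≤ p / 2`. -/
lemma solvesTyler_of_tylerMap_eq_zero [NeZero p] (hn : 0 < n)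
    {W : Fin n → EuclideanSpace ℝ (Fin p)} (hW : ∀ i, ‖W i‖ = 1)
    {C : Matrix (Fin p) (Fin p) ℝ} (hC : Cᵀ = C) (hC2 : ‖C‖ ≤ 1 / 2)
    (h0 : tylerMap W C = 0) : C.trace = 0 ∧ SolvesTyler W (1 + C) := by
  have hp : 0 < (p : ℝ) := by exact_mod_cast Nat.pos_of_ne_zero (NeZero.ne p)
  have hn' : 0 < (n : ℝ) := by exact_mod_cast hn
  have hwpos : ∀ i, 1 + ⟪W i, mulE C (W i)⟫ ≠ 0 := fun i => by
    have := abs_le.1 (abs_inner_mulE_self_le hW C i); linarith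
  rw [tylerMap, hC, sub_self, smul_zero, sub_zero] at h0
  set D := (p : ℝ) • outerAvg W (fun i => (1 + ⟪W i, mulE C (W i)⟫)⁻¹) - (1 + C)⁻¹ with hD
  have h1 : ((1 + C) * D).trace = 0 := by
    have h2 : ((1 + C) * outerAvg W fun i => (1 + ⟪W i, mulE C (W i)⟫)⁻¹).trace = 1 := by
      rw [trace_mul_outerAvg]
      simp_rw [inner_one_add_mulE hW, inv_mul_cancel₀ (hwpos _)]
      simp [hn'.ne']
    rw [hD, mul_sub, Matrix.mul_smul, trace_sub, trace_smul, h2,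
      Matrix.mul_nonsing_inv _ (isUnit_det_one_add hC2)]
    simp
  have h2 := congrArg (fun B => ((1 + C) * B).trace) h0
  simp only [mul_add, Matrix.mul_smul, trace_add, trace_smul, h1, mul_zero, trace_zero, mul_one,
    smul_eq_mul, zero_add, trace_one, Fintype.card_fin] at h2
  have h3 : |C.trace| ≤ p * (1 / 2) :=
    (abs_trace_le C).trans (mul_le_mul norm_one_le hC2 (norm_nonneg _) hp.le)
  have h4 : C.trace = 0 := by
    rw [← mul_add] at h2
    rcases mul_eq_zero.1 h2 with h | h
    · rcases div_eq_zero_iff.1 h with h | h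
      · exact h
      · exact absurd h hp.ne'
    · have := (abs_le.1 h3).1; linarith
  refine ⟨h4, ?_⟩
  rw [h4, zero_div, zero_smul, add_zero, smul_eq_zero_iff_right (by positivity), hD,
    sub_eq_zero] at h0
  rw [SolvesTyler, ← h0, smul_smul, inv_mul_cancel₀ hp.ne', one_smul]
  simp_rw [inner_one_add_mulE hW]

/-- For exactly isotropic fourth moments the derivative at the origin is the identity: the factor
`(p + 2) / p` normalises the symmetric trace-free directions, and the two added terms of `tylerMap`
do so for the scale and the antisymmetric directions. What remains is quadratic (the term with `r`)
or due to the imbalance (the term with `δ`). -/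
lemma norm_tylerMap_sub_le [NeZero p] {δ r : ℝ} {W : Fin n → EuclideanSpace ℝ (Fin p)}
    (h : IsBalanced δ W) (hr : r ≤ 1 / 2) {X Y : Matrix (Fin p) (Fin p) ℝ}
    (hX : ‖X‖ ≤ r) (hY : ‖Y‖ ≤ r) :
    ‖tylerMap W X - tylerMap W Y - (X - Y)‖ ≤ (48 * p ^ 2 * r + 3 * p ^ 2 * δ) * ‖X - Y‖ := by
  have hp : 0 < (p : ℝ) := by exact_mod_cast Nat.pos_of_ne_zero (NeZero.ne p)
  have hp1 : (1 : ℝ) ≤ p := by exact_mod_cast Nat.one_le_iff_ne_zero.2 (NeZero.ne p)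
  have hδ0 := h.nonneg
  have hr0 : 0 ≤ r := (norm_nonneg _).trans hX
  set Δ := X - Y with hΔ
  set x : Fin n → ℝ := fun i => ⟪W i, mulE X (W i)⟫ with hx
  set y : Fin n → ℝ := fun i => ⟪W i, mulE Y (W i)⟫ with hy
  set d : Fin n → ℝ := fun i => ⟪W i, mulE Δ (W i)⟫ with hd
  have hxd : ∀ i, x i = y i + d i := fun i => by
    simp only [hx, hy, hd, hΔ, sub_mulE, inner_sub_right]; ring
  have hxr : ∀ i, |x i| ≤ r := fun i => (abs_inner_mulE_self_le h.norm_eq X i).trans hX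
  have hyr : ∀ i, |y i| ≤ r := fun i => (abs_inner_mulE_self_le h.norm_eq Y i).trans hY
  have hdr : ∀ i, |d i| ≤ ‖Δ‖ := fun i => abs_inner_mulE_self_le h.norm_eq Δ i
  set P := (1 + X)⁻¹ with hP
  set Q := (1 + Y)⁻¹ with hQ
  have uX := isUnit_det_one_add (hX.trans hr)
  have uY := isUnit_det_one_add (hY.trans hr)
  have hPQ : P - Q = -(P * Δ * Q) := by
    have h1 : Δ = (1 + X) - (1 + Y) := by rw [hΔ]; abel
    rw [h1, mul_sub, sub_mul, hP, hQ, Matrix.nonsing_inv_mul _ uX, mul_assoc,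
      Matrix.mul_nonsing_inv _ uY, one_mul, mul_one]
    abel
  set R1 := outerAvg W (fun i => d i * (1 - (1 + x i)⁻¹ * (1 + y i)⁻¹)) with hR1
  set R2 := momentMap W Δ - ((p : ℝ) * (p + 2))⁻¹ • (Δ + Δᵀ + Δ.trace • 1) with hR2
  have e1 : outerAvg W (fun i => (1 + x i)⁻¹) - outerAvg W (fun i => (1 + y i)⁻¹) =
      R1 - momentMap W Δ := by
    rw [← outerAvg_sub, hR1, momentMap, ← outerAvg_sub]
    congr 1
    funext i
    have h1 := abs_le.1 (hxr i)
    have h2 := abs_le.1 (hyr i)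
    have h3 : 1 + x i ≠ 0 := by linarith
    have h4 : 1 + y i ≠ 0 := by linarith
    change _ = _ - d i
    have h5 : d i = x i - y i := by rw [hxd]; ring
    rw [h5]
    field_simp
    ring
  have e2 : tylerMap W X - tylerMap W Y - Δ = ((p : ℝ) + 2) • (R1 - R2) +
      (((p : ℝ) + 2) / p) • (P * Δ * Q - Δ) := by
    have e3 : outerAvg W (fun i => (1 + x i)⁻¹) =
      outerAvg W (fun i => (1 + y i)⁻¹) + (R1 - momentMap W Δ) := by rw [← e1]; abel
    have e4 : momentMap W Δ = R2 + ((p : ℝ) * (p + 2))⁻¹ • (Δ + Δᵀ + Δ.trace • 1) := by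
      rw [hR2]; abel
    have e5 : P = Q - P * Δ * Q := by rw [← neg_neg (P * Δ * Q), ← hPQ]; abel
    have e6 : X = Y + Δ := by rw [hΔ]; abel
    have e7 : tylerMap W X = (((p : ℝ) + 2) / p) • ((p : ℝ) • outerAvg W (fun i => (1 + x i)⁻¹) -
      P) + (X.trace / p) • 1 - (p : ℝ)⁻¹ • (X - Xᵀ) := rfl
    have e8 : tylerMap W Y = (((p : ℝ) + 2) / p) • ((p : ℝ) • outerAvg W (fun i => (1 + y i)⁻¹) -
      Q) + (Y.trace / p) • 1 - (p : ℝ)⁻¹ • (Y - Yᵀ) := rfl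
    rw [e7, e8, e3, e4]
    generalize P * Δ * Q = Z at e5 ⊢
    rw [e5, e6, trace_add, transpose_add]
    ext i j
    simp only [Matrix.sub_apply, Matrix.add_apply, Matrix.smul_apply, smul_eq_mul, transpose_apply]
    field_simp
    ring
  have b1 : ‖R1‖ ≤ 10 * r * ‖Δ‖ := by
    refine norm_outerAvg_le h.norm_eq (by positivity) fun i => ?_
    have h1 := abs_le.1 (hxr i)
    have h2 := abs_le.1 (hyr i)
    have h3 : 1 / 2 ≤ 1 + x i := by linarith
    have h4 : 1 / 2 ≤ 1 + y i := by linarith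
    have h5 : 1 / 4 ≤ (1 + x i) * (1 + y i) := by nlinarith
    rw [abs_mul, mul_comm]
    refine mul_le_mul ?_ (hdr i) (abs_nonneg _) (by positivity)
    have h6 : 1 - (1 + x i)⁻¹ * (1 + y i)⁻¹ =
        (x i + y i + x i * y i) / ((1 + x i) * (1 + y i)) := by
      field_simp; ring
    rw [h6, abs_div, abs_of_pos (by linarith : 0 < (1 + x i) * (1 + y i)),
      div_le_iff₀ (by linarith)]
    have h7 : |x i * y i| ≤ r * (1 / 2) := by
      rw [abs_mul]; exact mul_le_mul (hxr i) ((hyr i).trans hr) (abs_nonneg _) hr0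
    have h8 : |x i + y i + x i * y i| ≤ 5 / 2 * r :=
      (abs_add_le _ _).trans (by linarith [abs_add_le (x i) (y i), hxr i, hyr i])
    nlinarith
  have b2 : ‖R2‖ ≤ δ * ‖Δ‖ := h.moment Δ
  have b3 : ‖P * Δ * Q - Δ‖ ≤ 6 * p ^ 2 * r * ‖Δ‖ := by
    have h1 : P * Δ * Q - Δ = (P - 1) * (Δ * Q) + Δ * (Q - 1) := by noncomm_ring
    have h2 : ‖P - 1‖ ≤ 2 * p * r := (norm_inv_one_add_sub_one_le (hX.trans hr)).trans (by gcongr)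
    have h3 : ‖Q - 1‖ ≤ 2 * p * r := (norm_inv_one_add_sub_one_le (hY.trans hr)).trans (by gcongr)
    have h4 : ‖Q‖ ≤ 2 * p := norm_inv_one_add_le (hY.trans hr)
    calc ‖P * Δ * Q - Δ‖ ≤ ‖P - 1‖ * (‖Δ‖ * ‖Q‖) + ‖Δ‖ * ‖Q - 1‖ := by
          rw [h1]
          exact (norm_add_le _ _).trans (add_le_add ((norm_mul_le _ _).trans
            (mul_le_mul_of_nonneg_left (norm_mul_le _ _) (norm_nonneg _))) (norm_mul_le _ _))
      _ ≤ (2 * p * r) * (‖Δ‖ * (2 * p)) + ‖Δ‖ * (2 * p * r) := by gcongr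
      _ ≤ _ := by
          have : p * (r * ‖Δ‖) ≤ p ^ 2 * (r * ‖Δ‖) :=
            mul_le_mul_of_nonneg_right (by nlinarith) (by positivity)
          nlinarith
  rw [e2]
  have c1 : ((p : ℝ) + 2) ≤ 3 * p ^ 2 := by nlinarith
  have c2 : ((p : ℝ) + 2) / p ≤ 3 := by rw [div_le_iff₀ hp]; linarith
  calc _ ≤ ((p : ℝ) + 2) * (‖R1‖ + ‖R2‖) + (((p : ℝ) + 2) / p) * ‖P * Δ * Q - Δ‖ := by
        refine (norm_add_le _ _).trans (add_le_add ?_ ?_)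
        · rw [norm_smul, Real.norm_of_nonneg (by positivity)]
          gcongr
          exact norm_sub_le _ _
        · rw [norm_smul, Real.norm_of_nonneg (by positivity)]
    _ ≤ (3 * p ^ 2) * (10 * r * ‖Δ‖ + δ * ‖Δ‖) + 3 * (6 * p ^ 2 * r * ‖Δ‖) := by gcongr
    _ = _ := by ring

/-- A quantitative inverse function theorem for `tylerMap` on a ball around the origin, where its
value is `O(δ)`. Symmetry of the zero follows from injectivity, since `tylerMap` commutes with
transposition. -/
lemma exists_solvesTyler [NeZero p] (hn : 0 < n) {δ : ℝ} {W : Fin n → EuclideanSpace ℝ (Fin p)}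
    (h : IsBalanced δ W) (hδ : δ ≤ (1152 * (p : ℝ) ^ 4)⁻¹) :
    ∃ A : Matrix (Fin p) (Fin p) ℝ, A.PosDef ∧ A.trace = p ∧ SolvesTyler W A := by
  have hp : 0 < (p : ℝ) := by exact_mod_cast Nat.pos_of_ne_zero (NeZero.ne p)
  have hp1 : (1 : ℝ) ≤ p := by exact_mod_cast Nat.one_le_iff_ne_zero.2 (NeZero.ne p)
  have hδ0 := h.nonneg
  have : CompleteSpace (Matrix (Fin p) (Fin p) ℝ) := FiniteDimensional.complete ℝ _
  -- With this radius `48 p² r = 1/4`, and the hypothesis on `δ` says `3 p² δ ≤ r / 2`. Hence the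
  -- distance from the identity has Lipschitz constant at most `1/2`, and the value at the origin
  -- lies in the ball of radius `r / 2` that the surjectivity statement requires.
  set r : ℝ := (192 * (p : ℝ) ^ 2)⁻¹ with hr
  have hpr : (p : ℝ) ^ 2 * r = 1 / 192 := by rw [hr]; field_simp
  have hr0 : 0 < r := by rw [hr]; positivity
  have hr2 : r ≤ 1 / 2 := by nlinarith
  have hpδ' : 1152 * (p : ℝ) ^ 4 * δ ≤ 1 := by
    have := mul_le_mul_of_nonneg_left hδ (by positivity : 0 ≤ 1152 * (p : ℝ) ^ 4)
    rwa [mul_inv_cancel₀ (by positivity)] at this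
  have hpδ : 3 * (p : ℝ) ^ 2 * δ ≤ r / 2 := by
    have : (p : ℝ) ^ 2 * (3 * (p : ℝ) ^ 2 * δ) ≤ p ^ 2 * (r / 2) := by nlinarith
    exact le_of_mul_le_mul_left this (by positivity)
  have happ : ApproximatesLinearOn (tylerMap W)
      (ContinuousLinearMap.id ℝ (Matrix (Fin p) (Fin p) ℝ)) (Metric.closedBall 0 r)
      (1 / 2 : NNReal) := by
    intro X hX Y hY
    rw [mem_closedBall_zero_iff] at hX hY
    refine (norm_tylerMap_sub_le h hr2 hX hY).trans ?_
    refine mul_le_mul_of_nonneg_right ?_ (norm_nonneg _)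
    push_cast
    nlinarith
  let inv : (ContinuousLinearMap.id ℝ (Matrix (Fin p) (Fin p) ℝ)).NonlinearRightInverse :=
    ⟨id, 1, fun y => by simp, fun y => rfl⟩
  have hsurj := happ.surjOn_closedBall_of_nonlinearRightInverse inv hr0.le subset_rfl
  have h0 : ‖tylerMap W 0‖ ≤ 3 * p ^ 2 * δ := by
    have e : tylerMap W 0 = ((p : ℝ) + 2) • ((outerAvg W fun _ => 1) - (p : ℝ)⁻¹ • 1) := by
      simp only [tylerMap, zero_mulE, inner_zero_right, add_zero, inv_one, trace_zero, zero_div,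
        zero_smul, transpose_zero, sub_self, smul_zero, sub_zero, smul_sub, smul_smul]
      congr 2
      field_simp
    rw [e, norm_smul, Real.norm_of_nonneg (by positivity)]
    refine (mul_le_mul_of_nonneg_left h.norm_cov_sub_le (by positivity)).trans ?_
    have : ((p : ℝ) + 2) * p ≤ 3 * p ^ 2 := by nlinarith
    nlinarith
  obtain ⟨C, hC, hC0⟩ := hsurj (show (0 : Matrix (Fin p) (Fin p) ℝ) ∈ _ by
    rw [Metric.mem_closedBall, dist_zero_left]
    refine (h0.trans hpδ).trans (le_of_eq ?_)
    simp only [inv]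
    push_cast
    ring)
  have hC1 := mem_closedBall_zero_iff.1 hC
  have hCT : Cᵀ ∈ Metric.closedBall (0 : Matrix (Fin p) (Fin p) ℝ) r := by
    rwa [mem_closedBall_zero_iff, frobenius_norm_transpose]
  have hinj : Set.InjOn (tylerMap W) (Metric.closedBall 0 r) := by
    intro X hX Y hY hXY
    have := happ X hX Y hY
    rw [hXY, sub_self, zero_sub, norm_neg] at this
    change ‖X - Y‖ ≤ _ at this
    push_cast at this
    have : ‖X - Y‖ = 0 := by linarith [norm_nonneg (X - Y)]
    exact sub_eq_zero.1 (norm_eq_zero.1 this)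
  have hsym : Cᵀ = C := hinj hCT hC (by rw [tylerMap_transpose, hC0, transpose_zero])
  have hsol := solvesTyler_of_tylerMap_eq_zero hn h.norm_eq hsym (hC1.trans hr2) hC0
  exact ⟨1 + C, posDef_one_add hsym (hC1.trans hr2), by simp [hsol.1], hsol.2⟩

end TylerExistence

end SignPCA

namespace SignPCA

/-! ### Gram–Schmidt correction of the eigenvectors -/

section GramSchmidt

open RealInnerProductSpace InnerProductSpace

variable {p : ℕ}

/-- Uniqueness of the orthogonal projection on the span of the preceding vectors. -/
lemma gramSchmidt_eq_of_mem_span {E ι : Type*} [NormedAddCommGroup E] [InnerProductSpace ℝ E]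
    [LinearOrder ι] [LocallyFiniteOrderBot ι] [WellFoundedLT ι] {f : ι → E} {n : ι} {g : E}
    (horth : ∀ i < n, ⟪f i, g⟫ = 0) (hmem : f n - g ∈ Submodule.span ℝ (f '' Set.Iio n)) :
    gramSchmidt ℝ f n = g := by
  set G := gramSchmidt ℝ f n
  set S := Submodule.span ℝ (f '' Set.Iio n) with hS
  have h1 : f n - G ∈ S := by
    rw [gramSchmidt_def'' ℝ f n, add_sub_cancel_left, hS, ← span_gramSchmidt_Iio]
    refine Submodule.sum_mem _ fun i hi => Submodule.smul_mem _ _ (Submodule.subset_span ?_)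
    exact ⟨i, by simpa using hi, rfl⟩
  have h2 : ∀ s ∈ S, ⟪s, g⟫ = 0 := fun s hs => by
    induction hs using Submodule.span_induction with
    | mem x hx => obtain ⟨i, hi, rfl⟩ := hx; exact horth i hi
    | zero => simp
    | add x y _ _ hx hy => rw [inner_add_left, hx, hy, add_zero]
    | smul a x _ hx => rw [inner_smul_left, hx, mul_zero]
  have h3 : ∀ s ∈ S, ⟪s, G⟫ = 0 := fun s hs => by
    rw [hS, ← span_gramSchmidt_Iio] at hs
    induction hs using Submodule.span_induction with
    | mem x hx => obtain ⟨i, hi, rfl⟩ := hx; exact gramSchmidt_orthogonal ℝ f (ne_of_lt hi)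
    | zero => simp
    | add x y _ _ hx hy => rw [inner_add_left, hx, hy, add_zero]
    | smul a x _ hx => rw [inner_smul_left, hx, mul_zero]
  have h4 : G - g ∈ S := by simpa using S.sub_mem hmem h1
  have h5 : ⟪G - g, G - g⟫ = 0 := by rw [inner_sub_right, h3 _ h4, h2 _ h4, sub_zero]
  exact sub_eq_zero.1 (inner_self_eq_zero.1 h5)

lemma Orthonormal.sum_inner_mul_inner {t : Fin p → EuclideanSpace ℝ (Fin p)}
    (ht : Orthonormal ℝ t) (x y : EuclideanSpace ℝ (Fin p)) :
    ∑ j, ⟪x, t j⟫ * ⟪t j, y⟫ = ⟪x, y⟫ := by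
  rcases Nat.eq_zero_or_pos p with rfl | hp
  · simp [Subsingleton.elim x 0]
  · have : Nonempty (Fin p) := ⟨⟨0, hp⟩⟩
    let b := basisOfOrthonormalOfCardEqFinrank ht (by simp)
    have hb : ⇑b = t := coe_basisOfOrthonormalOfCardEqFinrank ht (by simp)
    let o := b.toOrthonormalBasis (by rw [hb]; exact ht)
    have := o.sum_inner_mul_inner x y
    simpa [o, hb] using this

lemma Orthonormal.sum_inner_sq {t : Fin p → EuclideanSpace ℝ (Fin p)}
    (ht : Orthonormal ℝ t) (x : EuclideanSpace ℝ (Fin p)) :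
    ∑ j, ⟪t j, x⟫ ^ 2 = ‖x‖ ^ 2 := by
  rw [← real_inner_self_eq_norm_sq, ← Orthonormal.sum_inner_mul_inner ht]
  refine Finset.sum_congr rfl fun j _ => ?_
  rw [real_inner_comm, sq]

variable [NeZero p]

/-- The component of `θ₀` orthogonal to `tₖ`, `0 < k < j`. -/
noncomputable def residual (θ₀ : EuclideanSpace ℝ (Fin p))
    (t : Fin p → EuclideanSpace ℝ (Fin p)) (j : Fin p) : EuclideanSpace ℝ (Fin p) :=
  θ₀ - ∑ k ∈ Finset.Ioo 0 j, ⟪θ₀, t k⟫ • t k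

variable {θ₀ : EuclideanSpace ℝ (Fin p)} {t : Fin p → EuclideanSpace ℝ (Fin p)}

lemma inner_residual (ht : Orthonormal ℝ t) (j k : Fin p) :
    ⟪residual θ₀ t j, t k⟫ = if k ∈ Finset.Ioo 0 j then 0 else ⟪θ₀, t k⟫ := by
  rw [residual, inner_sub_left, sum_inner]
  simp_rw [inner_smul_left, orthonormal_iff_ite.1 ht]
  split_ifs with h
  · rw [Finset.sum_eq_single k] <;> simp +contextual [h]
  · rw [Finset.sum_eq_zero, sub_zero]
    intro m hm
    have : m ≠ k := fun h' => h (h' ▸ hm)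
    simp [this]

lemma inner_residual_self (ht : Orthonormal ℝ t) (j : Fin p) :
    ⟪residual θ₀ t j, θ₀⟫ = ‖residual θ₀ t j‖ ^ 2 := by
  rw [← real_inner_self_eq_norm_sq]
  conv_rhs => enter [3]; rw [residual]
  rw [inner_sub_right, inner_sum, Finset.sum_eq_zero, sub_zero]
  intro k hk
  rw [inner_smul_right, inner_residual ht, if_pos hk, mul_zero]

lemma norm_residual_le (hθ : ‖θ₀‖ = 1) (ht : Orthonormal ℝ t) (j : Fin p) :
    ‖residual θ₀ t j‖ ≤ 1 := by
  have h := real_inner_le_norm (residual θ₀ t j) θ₀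
  rw [inner_residual_self ht, hθ, mul_one] at h
  nlinarith [norm_nonneg (residual θ₀ t j)]

/-- The vectors preceding index `j` are `θ₀` and the `t k` with `0 < k < j`. They have the same span
as these `t k` together with the residual, which is orthogonal to them. As `t j` is already
orthogonal to the `t k`, only its projection on the residual has to be removed. -/
lemma gramSchmidt_update (ht : Orthonormal ℝ t) (h0 : ⟪θ₀, t 0⟫ ≠ 0)
    {j : Fin p} (hj : j ≠ 0) :
    gramSchmidt ℝ (Function.update t 0 θ₀) j =
      t j - (⟪θ₀, t j⟫ / ‖residual θ₀ t j‖ ^ 2) • residual θ₀ t j := by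
  have hr : ‖residual θ₀ t j‖ ≠ 0 := by
    rw [norm_ne_zero_iff]
    intro h
    have := inner_residual (θ₀ := θ₀) ht j 0
    rw [h] at this
    simp at this
    exact h0 this.symm
  have hj0 : 0 < j := Fin.pos_iff_ne_zero.2 hj
  apply gramSchmidt_eq_of_mem_span
  · intro i hi
    by_cases hi0 : i = 0
    · subst hi0
      rw [Function.update_self, inner_sub_right, inner_smul_right, real_inner_comm _ θ₀,
        real_inner_comm (residual θ₀ t j) θ₀, inner_residual_self ht, real_inner_comm]
      field_simp
      simp
    · have : i ∈ Finset.Ioo 0 j := Finset.mem_Ioo.2 ⟨Fin.pos_iff_ne_zero.2 hi0, hi⟩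
      rw [Function.update_of_ne hi0, inner_sub_right, inner_smul_right,
        real_inner_comm (residual θ₀ t j), inner_residual ht, if_pos this,
        orthonormal_iff_ite.1 ht, if_neg hi.ne]
      simp
  · rw [Function.update_of_ne hj, sub_sub_cancel]
    refine Submodule.smul_mem _ _ (Submodule.sub_mem _ (Submodule.subset_span ?_)
      (Submodule.sum_mem _ fun k hk => Submodule.smul_mem _ _ (Submodule.subset_span ?_)))
    · exact ⟨0, hj0, by simp⟩
    · have := Finset.mem_Ioo.1 hk
      exact ⟨k, this.2, by rw [Function.update_of_ne this.1.ne']⟩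

lemma norm_gramSchmidt_update_sq (ht : Orthonormal ℝ t) (h0 : ⟪θ₀, t 0⟫ ≠ 0)
    {j : Fin p} (hj : j ≠ 0) :
    ‖gramSchmidt ℝ (Function.update t 0 θ₀) j‖ ^ 2 =
      1 - ⟪θ₀, t j⟫ ^ 2 / ‖residual θ₀ t j‖ ^ 2 := by
  have hr : ‖residual θ₀ t j‖ ≠ 0 := by
    rw [norm_ne_zero_iff]
    intro h
    have := inner_residual (θ₀ := θ₀) ht j 0
    rw [h] at this
    simp at this
    exact h0 this.symm
  have e : ⟪residual θ₀ t j, t j⟫ = ⟪θ₀, t j⟫ := by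
    rw [inner_residual ht, if_neg (by simp)]
  rw [gramSchmidt_update ht h0 hj, ← real_inner_self_eq_norm_sq]
  simp only [inner_sub_left, inner_sub_right, inner_smul_left, inner_smul_right, e,
    real_inner_comm (residual θ₀ t j) (t j), real_inner_self_eq_norm_sq, ht.1 j]
  simp
  field_simp
  ring

lemma sq_le_norm_residual_sq (ht : Orthonormal ℝ t) {j : Fin p} (hj : j ≠ 0) :
    ⟪θ₀, t 0⟫ ^ 2 + ⟪θ₀, t j⟫ ^ 2 ≤ ‖residual θ₀ t j‖ ^ 2 := by
  have e : ⟪residual θ₀ t j, t j⟫ = ⟪θ₀, t j⟫ := by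
    rw [inner_residual ht, if_neg (by simp)]
  have e0 : ⟪residual θ₀ t j, t 0⟫ = ⟪θ₀, t 0⟫ := by
    rw [inner_residual ht, if_neg (by simp)]
  rw [← Orthonormal.sum_inner_sq ht (residual θ₀ t j), ← e, ← e0,
    real_inner_comm (t 0), real_inner_comm (t j)]
  rw [← Finset.sum_pair hj.symm (f := fun k => ⟪t k, residual θ₀ t j⟫ ^ 2)]
  exact Finset.sum_le_sum_of_subset_of_nonneg (Finset.subset_univ _) fun _ _ _ => sq_nonneg _

lemma correctedVecs_zero (hθ : ‖θ₀‖ = 1) : correctedVecs θ₀ t 0 = θ₀ := by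
  have h : gramSchmidt ℝ (Function.update t 0 θ₀) 0 = θ₀ := by
    apply gramSchmidt_eq_of_mem_span
    · intro i hi; exact absurd hi (Fin.not_lt_zero i)
    · simp
  simp [correctedVecs, gramSchmidtNormed, h, hθ]

/-- With `s = ‖residual θ₀ t j‖²`, this follows from `⟪θ₀, t 0⟫² + ⟪θ₀, t j⟫² ≤ s ≤ 1`. It keeps the
normalisation in Gram–Schmidt away from zero. -/
lemma sq_le_norm_gramSchmidt_sq (hθ : ‖θ₀‖ = 1) (ht : Orthonormal ℝ t) (h0 : ⟪θ₀, t 0⟫ ≠ 0)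
    {j : Fin p} (hj : j ≠ 0) :
    ⟪θ₀, t 0⟫ ^ 2 ≤ ‖gramSchmidt ℝ (Function.update t 0 θ₀) j‖ ^ 2 := by
  have h1 := sq_le_norm_residual_sq (θ₀ := θ₀) ht hj
  have h2 := norm_residual_le (θ₀ := θ₀) hθ ht j
  have h3 : 0 < ⟪θ₀, t 0⟫ ^ 2 := by positivity
  have h4 : 0 < ‖residual θ₀ t j‖ ^ 2 := by nlinarith [sq_nonneg ⟪θ₀, t j⟫]
  have h5 : ‖residual θ₀ t j‖ ^ 2 ≤ 1 := by nlinarith [norm_nonneg (residual θ₀ t j)]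
  rw [norm_gramSchmidt_update_sq ht h0 hj, ← sub_nonneg]
  have : 1 - ⟪θ₀, t j⟫ ^ 2 / ‖residual θ₀ t j‖ ^ 2 - ⟪θ₀, t 0⟫ ^ 2 =
      (‖residual θ₀ t j‖ ^ 2 - ⟪θ₀, t j⟫ ^ 2 - ⟪θ₀, t 0⟫ ^ 2 * ‖residual θ₀ t j‖ ^ 2) /
        ‖residual θ₀ t j‖ ^ 2 := by
    have hne : ‖residual θ₀ t j‖ ≠ 0 := fun h => by rw [h] at h4; simp at h4
    field_simp
  rw [this]
  apply div_nonneg _ h4.le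
  nlinarith

lemma orthonormal_correctedVecs (hθ : ‖θ₀‖ = 1) (ht : Orthonormal ℝ t) (h0 : ⟪θ₀, t 0⟫ ≠ 0) :
    Orthonormal ℝ (correctedVecs θ₀ t) := by
  refine ⟨fun j => ?_, fun i j hij => ?_⟩
  · by_cases hj : j = 0
    · rw [hj, correctedVecs_zero hθ, hθ]
    · apply gramSchmidtNormed_unit_length'
      rw [gramSchmidtNormed]
      have := sq_le_norm_gramSchmidt_sq hθ ht h0 hj
      have h3 : 0 < ⟪θ₀, t 0⟫ ^ 2 := by positivity
      have h4 : ‖gramSchmidt ℝ (Function.update t 0 θ₀) j‖ ≠ 0 := fun h => by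
        rw [h] at this; nlinarith
      simpa using h4
  · simp only [correctedVecs, gramSchmidtNormed, inner_smul_left, inner_smul_right,
      gramSchmidt_orthogonal ℝ _ hij, mul_zero]

/-- What matters is the factor `|⟪θ₀, t j⟫|` in front: it is paired later with the eigenvalue gap `l
0 - l j`. The power `η ^ 6` comes from one squared norm of a Gram–Schmidt vector and two squared
norms of residuals, each at least `η ^ 2`. -/
lemma abs_inner_correctedVecs_sq_sub_le (hθ : ‖θ₀‖ = 1) (ht : Orthonormal ℝ t) {η : ℝ}
    (hη : 0 < η) (hη0 : η ≤ |⟪θ₀, t 0⟫|) {j : Fin p} (hj : j ≠ 0)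
    (x : EuclideanSpace ℝ (Fin p)) :
    |⟪correctedVecs θ₀ t j, x⟫ ^ 2 - ⟪t j, x⟫ ^ 2| ≤
      |⟪θ₀, t j⟫| * (2 * |⟪t j, x⟫| * |⟪residual θ₀ t j, x⟫| +
        |⟪θ₀, t j⟫| * ⟪residual θ₀ t j, x⟫ ^ 2 + |⟪θ₀, t j⟫| * ⟪t j, x⟫ ^ 2) / η ^ 6 := by
  have hη1 : η ≤ 1 := by
    refine hη0.trans ((abs_real_inner_le_norm _ _).trans ?_)
    rw [hθ, ht.1 0, one_mul]
  have hη2 : η ^ 2 ≤ ⟪θ₀, t 0⟫ ^ 2 := by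
    rw [← sq_abs ⟪θ₀, t 0⟫]; exact pow_le_pow_left₀ hη.le hη0 2
  have h0 : ⟪θ₀, t 0⟫ ≠ 0 := fun h => by rw [h, abs_zero] at hη0; linarith
  set N := ‖gramSchmidt ℝ (Function.update t 0 θ₀) j‖ ^ 2 with hN
  set s := ‖residual θ₀ t j‖ ^ 2 with hs
  set c := ⟪θ₀, t j⟫ with hc
  set y := ⟪t j, x⟫ with hy
  set u := ⟪residual θ₀ t j, x⟫ with hu
  have hN1 : η ^ 2 ≤ N := hη2.trans (sq_le_norm_gramSchmidt_sq hθ ht h0 hj)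
  have hs1 : η ^ 2 ≤ s := by
    have := sq_le_norm_residual_sq (θ₀ := θ₀) ht hj
    nlinarith [sq_nonneg ⟪θ₀, t j⟫]
  have hη3 : 0 < η ^ 2 := by positivity
  have hN0 : 0 < N := hη3.trans_le hN1
  have hs0 : 0 < s := hη3.trans_le hs1
  have e1 : ⟪correctedVecs θ₀ t j, x⟫ ^ 2 = (y - c / s * u) ^ 2 / N := by
    rw [correctedVecs, gramSchmidtNormed, inner_smul_left, mul_pow, hN]
    simp only [gramSchmidt_update ht h0 hj, inner_sub_left, inner_smul_left]
    simp only [← hs, ← hc, ← hy, ← hu]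
    simp
    field_simp
  have e2 : N = 1 - c ^ 2 / s := norm_gramSchmidt_update_sq ht h0 hj
  have e3 : ⟪correctedVecs θ₀ t j, x⟫ ^ 2 - y ^ 2 =
      c * (-(2 * y * u) * s + c * u ^ 2 + c * y ^ 2 * s) / (N * s ^ 2) := by
    rw [e1]
    have : (y - c / s * u) ^ 2 / N - y ^ 2 = ((y - c / s * u) ^ 2 - N * y ^ 2) / N := by
      field_simp
    rw [this]
    rw [div_eq_div_iff hN0.ne' (by positivity), e2]
    field_simp
    ring
  have hs2 : s ≤ 1 := by
    have := norm_residual_le (θ₀ := θ₀) hθ ht j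
    rw [hs]; nlinarith [norm_nonneg (residual θ₀ t j)]
  rw [e3, abs_div, abs_of_pos (by positivity : 0 < N * s ^ 2), abs_mul]
  have h1 : |-(2 * y * u) * s + c * u ^ 2 + c * y ^ 2 * s| ≤
      2 * |y| * |u| + |c| * u ^ 2 + |c| * y ^ 2 := by
    refine (abs_add_three _ _ _).trans ?_
    have a1 : |-(2 * y * u) * s| ≤ 2 * |y| * |u| := by
      rw [abs_mul, abs_neg, abs_mul, abs_mul, abs_two, abs_of_pos hs0]
      exact mul_le_of_le_one_right (by positivity) hs2
    have a2 : |c * u ^ 2| ≤ |c| * u ^ 2 := by rw [abs_mul, abs_of_nonneg (sq_nonneg u)]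
    have a3 : |c * y ^ 2 * s| ≤ |c| * y ^ 2 := by
      rw [abs_mul, abs_mul, abs_of_nonneg (sq_nonneg y), abs_of_pos hs0]
      exact mul_le_of_le_one_right (by positivity) hs2
    linarith
  have h2 : η ^ 6 ≤ N * s ^ 2 := by
    calc η ^ 6 = η ^ 2 * (η ^ 2) ^ 2 := by ring
      _ ≤ N * s ^ 2 := by gcongr
  gcongr

lemma abs_inner_residual_le (ht : Orthonormal ℝ t) (j : Fin p) (x : EuclideanSpace ℝ (Fin p)) :
    |⟪residual θ₀ t j, x⟫| ≤ ∑ k, |⟪θ₀, t k⟫| * |⟪t k, x⟫| := by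
  rw [← Orthonormal.sum_inner_mul_inner ht]
  refine (Finset.abs_sum_le_sum_abs _ _).trans (Finset.sum_le_sum fun k _ => ?_)
  rw [abs_mul, inner_residual ht]
  split_ifs
  · rw [abs_zero, zero_mul]; positivity
  · rfl

/-- The error is relative to the form itself, which makes it independent of how spread out the
eigenvalues are. `h1` compensates large gaps by small inner products, and `h2` controls the
residual, whose coordinates mix all eigendirections. -/
lemma abs_correctedForm_sub_le (hθ : ‖θ₀‖ = 1) (ht : Orthonormal ℝ t) {η K : ℝ}
    (hη : 0 < η) (hη0 : η ≤ |⟪θ₀, t 0⟫|) {l : Fin p → ℝ} (hl : ∀ j, 0 < l j) (hl0 : ∀ j, l j ≤ l 0)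
    (h1 : ∀ j, (l 0 - l j) * |⟪θ₀, t j⟫| ≤ K * √(l 0 * l j))
    (h2 : ∀ j, |⟪θ₀, t j⟫| * √(l 0) ≤ 2 * √(l j)) (x : EuclideanSpace ℝ (Fin p)) :
    |∑ j, l j * ⟪correctedVecs θ₀ t j, x⟫ ^ 2 - ∑ j, l j * ⟪t j, x⟫ ^ 2| ≤
      14 * p ^ 3 / η ^ 6 * K * ∑ j, l j * ⟪t j, x⟫ ^ 2 := by
  have hp1 : (1 : ℝ) ≤ p := by exact_mod_cast Nat.one_le_iff_ne_zero.2 (NeZero.ne p)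
  have h0 : ⟪θ₀, t 0⟫ ≠ 0 := fun h => by rw [h, abs_zero] at hη0; linarith
  have hη1 : η ≤ 1 := by
    refine hη0.trans ((abs_real_inner_le_norm _ _).trans ?_)
    rw [hθ, ht.1 0, one_mul]
  have hK : 0 ≤ K := by
    have := h1 0
    rw [sub_self, zero_mul] at this
    exact nonneg_of_mul_nonneg_left this (Real.sqrt_pos.2 (mul_pos (hl 0) (hl 0)))
  set Q := ∑ j, l j * ⟪t j, x⟫ ^ 2 with hQ
  have hQj : ∀ j, l j * ⟪t j, x⟫ ^ 2 ≤ Q := fun j =>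
    Finset.single_le_sum (f := fun j => l j * ⟪t j, x⟫ ^ 2)
      (fun i _ => mul_nonneg (hl i).le (sq_nonneg _)) (Finset.mem_univ j)
  have hQ0 : 0 ≤ Q := (mul_nonneg (hl 0).le (sq_nonneg _)).trans (hQj 0)
  have hQs : ∀ j, √(l j) * |⟪t j, x⟫| ≤ √Q := fun j => by
    refine Real.le_sqrt_of_sq_le ?_
    rw [mul_pow, Real.sq_sqrt (hl j).le, sq_abs]; exact hQj j
  have hu : ∀ j, √(l 0) * |⟪residual θ₀ t j, x⟫| ≤ 2 * p * √Q := fun j => by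
    calc √(l 0) * |⟪residual θ₀ t j, x⟫| ≤ √(l 0) * ∑ k, |⟪θ₀, t k⟫| * |⟪t k, x⟫| := by
          gcongr; exact abs_inner_residual_le ht j x
      _ = ∑ k, (|⟪θ₀, t k⟫| * √(l 0)) * |⟪t k, x⟫| := by
          rw [Finset.mul_sum]; exact Finset.sum_congr rfl fun k _ => by ring
      _ ≤ ∑ k : Fin p, 2 * √Q := Finset.sum_le_sum fun k _ => by
          have := mul_le_mul_of_nonneg_right (h2 k) (abs_nonneg ⟪t k, x⟫)
          have := hQs k
          linarith
      _ = 2 * p * √Q := by simp; ring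
  -- Both families are orthonormal bases, so subtracting `l 0` from all eigenvalues does not change
  -- the difference of the two forms.
  have key : ∑ j, l j * ⟪correctedVecs θ₀ t j, x⟫ ^ 2 - Q =
      ∑ j, (l j - l 0) * (⟪correctedVecs θ₀ t j, x⟫ ^ 2 - ⟪t j, x⟫ ^ 2) := by
    have a1 := Orthonormal.sum_inner_sq (orthonormal_correctedVecs hθ ht h0) x
    have a2 := Orthonormal.sum_inner_sq ht x
    have a3 : ∑ j, (l j - l 0) * (⟪correctedVecs θ₀ t j, x⟫ ^ 2 - ⟪t j, x⟫ ^ 2) =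
        (∑ j, l j * ⟪correctedVecs θ₀ t j, x⟫ ^ 2 - Q) -
        l 0 * (∑ j, ⟪correctedVecs θ₀ t j, x⟫ ^ 2 - ∑ j, ⟪t j, x⟫ ^ 2) := by
      rw [hQ, ← Finset.sum_sub_distrib, ← Finset.sum_sub_distrib, Finset.mul_sum,
        ← Finset.sum_sub_distrib]
      exact Finset.sum_congr rfl fun k _ => by ring
    rw [a3, a1, a2, sub_self, mul_zero, sub_zero]
  rw [key]
  have term : ∀ j, |(l j - l 0) * (⟪correctedVecs θ₀ t j, x⟫ ^ 2 - ⟪t j, x⟫ ^ 2)| ≤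
      14 * p ^ 2 / η ^ 6 * K * Q := fun j => by
    by_cases hj : j = 0
    · rw [hj, sub_self, zero_mul, abs_zero]; positivity
    have b1 := abs_inner_correctedVecs_sq_sub_le hθ ht hη hη0 hj x
    set c := |⟪θ₀, t j⟫| with hc
    set y := ⟪t j, x⟫ with hy
    set u := ⟪residual θ₀ t j, x⟫ with hu'
    set R := 2 * |y| * |u| + c * u ^ 2 + c * y ^ 2 with hR
    have hc0 : 0 ≤ c := abs_nonneg _
    have hR0 : 0 ≤ R := by positivity
    have hsq : √(l 0 * l j) = √(l 0) * √(l j) := Real.sqrt_mul (hl 0).le _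
    -- The three terms of `R` contribute `4 p`, `8 p²` and `2` (see `d1`, `d4`, `d5`), whence `14
    -- p²`.
    have b2 : √(l 0 * l j) * R ≤ 14 * p ^ 2 * Q := by
      have hQQ : √Q * √Q = Q := Real.mul_self_sqrt hQ0
      have d1 : √(l 0) * √(l j) * (|y| * |u|) ≤ 2 * p * Q := by
        calc _ = (√(l j) * |y|) * (√(l 0) * |u|) := by ring
          _ ≤ √Q * (2 * p * √Q) := mul_le_mul (hQs j) (hu j) (by positivity) (by positivity)
          _ = 2 * p * (√Q * √Q) := by ring
          _ = _ := by rw [hQQ]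
      have d2 : √(l 0) * √(l j) * c ≤ 2 * l j := by
        calc _ = (c * √(l 0)) * √(l j) := by ring
          _ ≤ (2 * √(l j)) * √(l j) := mul_le_mul_of_nonneg_right (h2 j) (Real.sqrt_nonneg _)
          _ = 2 * (√(l j) * √(l j)) := by ring
          _ = _ := by rw [Real.mul_self_sqrt (hl j).le]
      have d3 : l 0 * u ^ 2 ≤ 4 * p ^ 2 * Q := by
        calc l 0 * u ^ 2 = (√(l 0) * |u|) ^ 2 := by
              rw [mul_pow, Real.sq_sqrt (hl 0).le, sq_abs]
          _ ≤ (2 * p * √Q) ^ 2 := pow_le_pow_left₀ (by positivity) (hu j) 2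
          _ = _ := by rw [mul_pow, Real.sq_sqrt hQ0]; ring
      have d4 : √(l 0) * √(l j) * c * u ^ 2 ≤ 8 * p ^ 2 * Q := by
        have := mul_le_mul_of_nonneg_right d2 (sq_nonneg u)
        have := mul_le_mul_of_nonneg_right (hl0 j) (sq_nonneg u)
        linarith
      have d5 : √(l 0) * √(l j) * c * y ^ 2 ≤ 2 * Q := by
        have := mul_le_mul_of_nonneg_right d2 (sq_nonneg y)
        have := hQj j
        linarith
      have d6 : p * Q ≤ p ^ 2 * Q := mul_le_mul_of_nonneg_right (by nlinarith) hQ0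
      have d7 : 1 * Q ≤ p ^ 2 * Q := mul_le_mul_of_nonneg_right (by nlinarith) hQ0
      rw [hsq, hR]
      linarith
    have b3 : |l j - l 0| = l 0 - l j := by rw [abs_sub_comm, abs_of_nonneg (by linarith [hl0 j])]
    rw [abs_mul, b3]
    calc (l 0 - l j) * |⟪correctedVecs θ₀ t j, x⟫ ^ 2 - y ^ 2|
        ≤ (l 0 - l j) * (c * R / η ^ 6) :=
          mul_le_mul_of_nonneg_left b1 (by linarith [hl0 j])
      _ = ((l 0 - l j) * c) * R / η ^ 6 := by ring
      _ ≤ (K * √(l 0 * l j)) * R / η ^ 6 :=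
          div_le_div_of_nonneg_right (mul_le_mul_of_nonneg_right (h1 j) hR0) (by positivity)
      _ = K * (√(l 0 * l j) * R) / η ^ 6 := by ring
      _ ≤ K * (14 * p ^ 2 * Q) / η ^ 6 := by gcongr
      _ = _ := by ring
  calc _ ≤ ∑ j : Fin p, 14 * p ^ 2 / η ^ 6 * K * Q :=
        (Finset.abs_sum_le_sum_abs _ _).trans (Finset.sum_le_sum fun j _ => term j)
    _ = _ := by simp; ring

end GramSchmidt

end SignPCA

namespace SignPCA

/-! ### The symmetric inverse square root -/

section InverseSquareRoot

open Matrix RealInnerProductSpace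

variable {p : ℕ}

lemma pos_of_mem_spectrum {V : Matrix (Fin p) (Fin p) ℝ} (hV : V.PosDef) {x : ℝ}
    (hx : x ∈ spectrum ℝ V) : 0 < x := by
  rw [hV.1.spectrum_real_eq_range_eigenvalues] at hx
  obtain ⟨i, rfl⟩ := hx
  exact hV.eigenvalues_pos i

lemma continuousOn_spectrum (V : Matrix (Fin p) (Fin p) ℝ) (f : ℝ → ℝ) :
    ContinuousOn f (spectrum ℝ V) :=
  (Matrix.finite_real_spectrum (A := V)).continuousOn f

lemma isSelfAdjoint_of_posDef {V : Matrix (Fin p) (Fin p) ℝ} (hV : V.PosDef) :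
    IsSelfAdjoint V := hV.1

lemma transpose_cfc (f : ℝ → ℝ) (V : Matrix (Fin p) (Fin p) ℝ) : (cfc f V)ᵀ = cfc f V := by
  have : IsSelfAdjoint (cfc f V) := cfc_predicate f V
  rw [← conjTranspose_eq_transpose_of_trivial]
  exact this

lemma transpose_invSqrt (V : Matrix (Fin p) (Fin p) ℝ) : (invSqrt V)ᵀ = invSqrt V :=
  transpose_cfc _ _

lemma invSqrt_mul_self {V : Matrix (Fin p) (Fin p) ℝ} (hV : V.PosDef) :
    invSqrt V * invSqrt V = V⁻¹ := by
  have hs := isSelfAdjoint_of_posDef hV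
  symm
  apply Matrix.inv_eq_left_inv
  have h1 : invSqrt V * invSqrt V = cfc (fun x : ℝ => (√x)⁻¹ * (√x)⁻¹) V :=
    (cfc_mul _ _ V (continuousOn_spectrum V _) (continuousOn_spectrum V _)).symm
  have h2 : cfc (fun x : ℝ => x) V = V := cfc_id' ℝ V
  conv_lhs => rw [h1]; enter [2]; rw [← h2]
  rw [← cfc_mul _ _ V (continuousOn_spectrum V _) (continuousOn_spectrum V _), ← cfc_one ℝ V]
  refine cfc_congr fun x hx => ?_
  have := pos_of_mem_spectrum hV hx
  simp only [Pi.one_apply]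
  rw [← mul_inv, Real.mul_self_sqrt this.le, inv_mul_cancel₀ this.ne']

lemma inner_invSqrt_nonneg (V : Matrix (Fin p) (Fin p) ℝ) (x : EuclideanSpace ℝ (Fin p)) :
    0 ≤ ⟪x, mulE (invSqrt V) x⟫ := by
  have h1 : invSqrt V = cfc (fun x : ℝ => √((√x)⁻¹)) V * cfc (fun x : ℝ => √((√x)⁻¹)) V := by
    rw [← cfc_mul _ _ V (continuousOn_spectrum V _) (continuousOn_spectrum V _)]
    refine cfc_congr fun x _ => ?_
    exact (Real.mul_self_sqrt (by positivity)).symm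
  rw [h1, mul_mulE, ← inner_mulE_symm (transpose_cfc _ _)]
  exact real_inner_self_nonneg

lemma mulE_inv_of_mulE_eq {V : Matrix (Fin p) (Fin p) ℝ} (hV : V.PosDef) {l : ℝ} (hl : l ≠ 0)
    {x : EuclideanSpace ℝ (Fin p)} (hx : mulE V x = l • x) : mulE V⁻¹ x = l⁻¹ • x := by
  have h1 : mulE (V⁻¹ * V) x = x := by
    rw [Matrix.nonsing_inv_mul _ ((Matrix.isUnit_iff_isUnit_det _).1 hV.isUnit), one_mulE]
  rw [mul_mulE, hx, mulE_smul] at h1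
  rw [eq_inv_smul_iff₀ hl, h1]

/-- The defect `z` would be an eigenvector of `invSqrt V` for the negative eigenvalue `-(√l)⁻¹`,
which is impossible for a nonnegative matrix. -/
lemma invSqrt_mulE_of_mulE_eq {V : Matrix (Fin p) (Fin p) ℝ} (hV : V.PosDef) {l : ℝ} (hl : 0 < l)
    {x : EuclideanSpace ℝ (Fin p)} (hx : mulE V x = l • x) :
    mulE (invSqrt V) x = (√l)⁻¹ • x := by
  have hs : 0 < (√l)⁻¹ := inv_pos.2 (Real.sqrt_pos.2 hl)
  have h1 : mulE (invSqrt V) (mulE (invSqrt V) x) = ((√l)⁻¹ * (√l)⁻¹) • x := by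
    rw [← mul_mulE, invSqrt_mul_self hV, mulE_inv_of_mulE_eq hV hl.ne' hx, ← mul_inv,
      Real.mul_self_sqrt hl.le]
  set z := mulE (invSqrt V) x - (√l)⁻¹ • x with hz
  have h2 : mulE (invSqrt V) z = -((√l)⁻¹ • z) := by
    rw [hz, mulE_sub, mulE_smul, h1, smul_sub, smul_smul]; abel
  have h3 := inner_invSqrt_nonneg V z
  rw [h2, inner_neg_right, inner_smul_right, real_inner_self_eq_norm_sq] at h3
  have h4 : ‖z‖ ^ 2 ≤ 0 := by
    by_contra h
    have := mul_pos hs (not_le.1 h)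
    linarith
  have h5 : z = 0 := by
    rw [← norm_eq_zero]
    exact pow_eq_zero_iff two_ne_zero |>.1 (le_antisymm h4 (sq_nonneg _))
  exact sub_eq_zero.1 h5

end InverseSquareRoot

/-! ### Reduction to a spherical sample -/

section Transfer

open Matrix RealInnerProductSpace

variable {p n : ℕ}

/-- `U` consists of the directions of the points `L Wᵢ`. -/
def IsImageSample (L : Matrix (Fin p) (Fin p) ℝ) (W : Fin n → EuclideanSpace ℝ (Fin p))
    (U : Fin n → Sph p) : Prop :=
  ∀ i, ∃ c : ℝ, c ≠ 0 ∧ (U i).1 = c • mulE L (W i)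

variable {L : Matrix (Fin p) (Fin p) ℝ} {W : Fin n → EuclideanSpace ℝ (Fin p)} {U : Fin n → Sph p}

lemma mul_outerAvg_mul (B : Matrix (Fin p) (Fin p) ℝ) (c : Fin n → ℝ) :
    B * outerAvg W c * Bᵀ = outerAvg (fun i => mulE B (W i)) c := by
  simp [outerAvg, Matrix.mul_sum, Matrix.sum_mul, mul_outer_mul]

lemma signCov_eq (hL : Lᵀ = L) (hU : IsImageSample L W U) {Y : Matrix (Fin p) (Fin p) ℝ}
    (hY : Y.PosDef) :
    signCov U Y = (invSqrt Y * L) *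
      outerAvg W (fun i => ⟪W i, mulE (L * Y⁻¹ * L) (W i)⟫⁻¹) * (L * invSqrt Y) := by
  have hN := transpose_invSqrt Y
  have h1 : L * invSqrt Y = (invSqrt Y * L)ᵀ := by rw [transpose_mul, hL, hN]
  rw [h1, mul_outerAvg_mul, signCov, outerAvg]
  congr 1
  refine Finset.sum_congr rfl fun i _ => ?_
  obtain ⟨c, hc, hUi⟩ := hU i
  have h2 : invSqrt Y * outer (U i).1 * invSqrt Y = outer (mulE (invSqrt Y) (U i).1) := by
    rw [← mul_outer_mul, hN]
  have h3 : mulE (invSqrt Y) (U i).1 = c • mulE (invSqrt Y * L) (W i) := by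
    rw [hUi, mulE_smul, mul_mulE]
  have h4 : ‖mulE (invSqrt Y * L) (W i)‖ ^ 2 = ⟪W i, mulE (L * Y⁻¹ * L) (W i)⟫ := by
    rw [← real_inner_self_eq_norm_sq, inner_mulE_left, ← h1, ← mul_mulE,
      ← invSqrt_mul_self hY]
    simp only [mul_assoc]
  rw [h2, h3, outer_smul, norm_smul, mul_pow, h4, smul_smul, mul_inv, Real.norm_eq_abs, sq_abs]
  congr 1
  have : c ^ 2 ≠ 0 := pow_ne_zero 2 hc
  field_simp

lemma posDef_mul_mul (hL : Lᵀ = L) (hL0 : IsUnit L) {Y : Matrix (Fin p) (Fin p) ℝ}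
    (hY : Y.PosDef) : (L * Y * L).PosDef := by
  have := (Matrix.IsUnit.posDef_star_right_conjugate_iff hL0 (x := Y)).2 hY
  rwa [star_eq_conjTranspose, conjTranspose_eq_transpose_of_trivial, hL] at this

/-- Affine equivariance of Tyler's equation: the matrix of `signCov_eq` is `B * X * Bᵀ` with `B =
invSqrt Y * L` invertible, and `Bᵀ * B = L * Y⁻¹ * L`. -/
lemma signCov_eq_iff_solvesTyler (hL : Lᵀ = L) (hL0 : IsUnit L) (hU : IsImageSample L W U)
    {Y : Matrix (Fin p) (Fin p) ℝ} (hY : Y.PosDef) :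
    signCov U Y = (p : ℝ)⁻¹ • 1 ↔ SolvesTyler W (L * Y⁻¹ * L) := by
  have hN0 : IsUnit (invSqrt Y) := by
    have h1 : IsUnit (invSqrt Y * invSqrt Y) := by
      rw [invSqrt_mul_self hY]; exact hY.inv.isUnit
    exact isUnit_of_mul_isUnit_left h1
  have hB := hN0.mul hL0
  have hB' := hL0.mul hN0
  have hBB : (L * Y⁻¹ * L)⁻¹ = (invSqrt Y * L)⁻¹ * (L * invSqrt Y)⁻¹ := by
    rw [← Matrix.mul_inv_rev, ← invSqrt_mul_self hY]
    simp only [mul_assoc]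
  have d1 := (Matrix.isUnit_iff_isUnit_det _).1 hB
  have d2 := (Matrix.isUnit_iff_isUnit_det _).1 hB'
  rw [signCov_eq hL hU hY, SolvesTyler, hBB]
  generalize (outerAvg W fun i => ⟪W i, mulE (L * Y⁻¹ * L) (W i)⟫⁻¹) = X
  generalize invSqrt Y * L = B at d1 ⊢
  generalize L * invSqrt Y = B' at d2 ⊢
  constructor
  · intro h
    have h1 := congrArg (fun Z => B⁻¹ * Z * B'⁻¹) h
    rw [mul_assoc B, Matrix.nonsing_inv_mul_cancel_left _ _ d1,
      Matrix.mul_nonsing_inv_cancel_right _ _ d2] at h1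
    rw [h1]; simp
  · intro h
    rw [h, Matrix.mul_smul, Matrix.smul_mul, ← mul_assoc, Matrix.mul_nonsing_inv _ d1, one_mul,
      Matrix.nonsing_inv_mul _ d2]

/-- As `θ₀` is an eigenvector of both `Y` and `L`, the projection `1 - outer θ₀` commutes with
`invSqrt Y` and `L`, so the statistic becomes a quadratic form in a vector built from `W` alone. The
sign covariance ignores the scale of `Y`; the factor `l / σ ^ 2` is chosen so that `F` annihilates
`θ₀`. -/
lemma testStat_eq {θ₀ : EuclideanSpace ℝ (Fin p)} (hL : Lᵀ = L)
    (hU : IsImageSample L W U) {σ l : ℝ} (hσ : 0 < σ) (hl : 0 < l) (hLθ : mulE L θ₀ = σ • θ₀)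
    {Y F : Matrix (Fin p) (Fin p) ℝ} (hY : Y.PosDef) (hYθ : mulE Y θ₀ = l • θ₀)
    (hF : 1 + F = (l / σ ^ 2) • (L * Y⁻¹ * L)) {z : EuclideanSpace ℝ (Fin p)}
    (hz : z = mulE ((1 - outer θ₀) * outerAvg W fun i => ⟪W i, mulE (1 + F) (W i)⟫⁻¹) θ₀) :
    testStat θ₀ U Y = n * p * (p + 2) * ⟪z, mulE (1 + F) z⟫ := by
  have hN := transpose_invSqrt Y
  have hNθ := invSqrt_mulE_of_mulE_eq hY hl hYθ
  have hcomm : ∀ (B : Matrix (Fin p) (Fin p) ℝ) (b : ℝ), Bᵀ = B → mulE B θ₀ = b • θ₀ →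
      (1 - outer θ₀) * B = B * (1 - outer θ₀) := by
    intro B b hB hb
    refine mulE_ext fun x => ?_
    simp only [mul_mulE, sub_mulE, one_mulE, outer_mulE, mulE_sub, mulE_smul, hb]
    rw [← inner_mulE_symm hB, hb, inner_smul_left, smul_smul]
    simp [mul_comm]
  have hsl : √l * √l = l := Real.mul_self_sqrt hl.le
  have hsl0 : √l ≠ 0 := (Real.sqrt_pos.2 hl).ne'
  set X := outerAvg W fun i => ⟪W i, mulE (L * Y⁻¹ * L) (W i)⟫⁻¹ with hX
  have hXF : outerAvg W (fun i => ⟪W i, mulE (1 + F) (W i)⟫⁻¹) = (σ ^ 2 / l) • X := by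
    rw [hX, ← outerAvg_smul]
    congr 1
    funext i
    rw [hF, smul_mulE, inner_smul_right, mul_inv, inv_div]
  have e1 : mulE ((1 - outer θ₀) * signCov U Y) θ₀ =
      (√l / σ) • mulE (invSqrt Y * L) z := by
    rw [hz, hXF, signCov_eq hL hU hY, ← hX, ← mul_mulE (invSqrt Y * L)]
    rw [mul_assoc, ← mul_assoc (1 - outer θ₀), ← mul_assoc (1 - outer θ₀),
      hcomm _ _ hN hNθ, mul_assoc (invSqrt Y), hcomm _ _ hL hLθ, ← mul_assoc (invSqrt Y)]
    clear_value X
    simp only [mul_mulE, hNθ, mulE_smul, hLθ, smul_mulE, smul_smul]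
    congr 1
    have : σ ≠ 0 := hσ.ne'
    field_simp
    rw [sq, hsl]
  rw [testStat, e1, norm_smul, mul_pow, ← real_inner_self_eq_norm_sq (mulE _ z), inner_mulE_left,
    transpose_mul, hL, hN, ← mul_mulE, hF, smul_mulE, inner_smul_right, ← invSqrt_mul_self hY,
    Real.norm_eq_abs, sq_abs, div_pow, Real.sq_sqrt hl.le]
  simp only [mul_assoc]

end Transfer

end SignPCA

namespace SignPCA

/-! ### Relative spectral perturbation bounds -/

section Perturbation

open Matrix RealInnerProductSpace

attribute [local instance] Matrix.frobeniusNormedRing Matrix.frobeniusNormedSpace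

variable {p n : ℕ}

lemma spectralSum_mulE (l : Fin p → ℝ) (t : Fin p → EuclideanSpace ℝ (Fin p))
    (x : EuclideanSpace ℝ (Fin p)) : mulE (spectralSum l t) x = ∑ j, (l j * ⟪t j, x⟫) • t j := by
  simp [spectralSum, sum_mulE, smul_mulE, outer_mulE, smul_smul]

lemma inner_spectralSum_mulE (l : Fin p → ℝ) (t : Fin p → EuclideanSpace ℝ (Fin p))
    (x : EuclideanSpace ℝ (Fin p)) :
    ⟪x, mulE (spectralSum l t) x⟫ = ∑ j, l j * ⟪t j, x⟫ ^ 2 := by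
  rw [spectralSum_mulE, inner_sum]
  refine Finset.sum_congr rfl fun j _ => ?_
  rw [inner_smul_right, real_inner_comm]; ring

lemma spectralSum_mulE_self {t : Fin p → EuclideanSpace ℝ (Fin p)} (ht : Orthonormal ℝ t)
    (l : Fin p → ℝ) (j : Fin p) : mulE (spectralSum l t) (t j) = l j • t j := by
  rw [spectralSum_mulE, Finset.sum_eq_single j]
  · simp [ht.1 j]
  · intro k _ hk
    simp [orthonormal_iff_ite.1 ht, hk]
  · simp

lemma transpose_spectralSum (l : Fin p → ℝ) (t : Fin p → EuclideanSpace ℝ (Fin p)) :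
    (spectralSum l t)ᵀ = spectralSum l t := by
  simp [spectralSum, transpose_sum, transpose_outer]

lemma posDef_spectralSum {t : Fin p → EuclideanSpace ℝ (Fin p)} (ht : Orthonormal ℝ t)
    {l : Fin p → ℝ} (hl : ∀ j, 0 < l j) : (spectralSum l t).PosDef := by
  refine posDef_iff_inner.2 ⟨transpose_spectralSum l t, fun x hx => ?_⟩
  rw [inner_spectralSum_mulE]
  have h1 : 0 < ∑ j, ⟪t j, x⟫ ^ 2 := by
    rw [Orthonormal.sum_inner_sq ht]
    have := norm_pos_iff.2 hx
    positivity
  obtain ⟨j, hj, hj'⟩ := Finset.exists_ne_zero_of_sum_ne_zero h1.ne'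
  refine Finset.sum_pos' (fun i _ => mul_nonneg (hl i).le (sq_nonneg _)) ⟨j, hj, ?_⟩
  exact mul_pos (hl j) (lt_of_le_of_ne (sq_nonneg _) hj'.symm)

lemma norm_le_of_abs_inner_le {D : Matrix (Fin p) (Fin p) ℝ} (hD : Dᵀ = D) {κ : ℝ} (hκ : 0 ≤ κ)
    (h : ∀ x, |⟪x, mulE D x⟫| ≤ κ * ‖x‖ ^ 2) : ‖D‖ ≤ p * κ := by
  have h1 : ∀ i j, |D i j| ≤ κ := fun i j => by
    set x : EuclideanSpace ℝ (Fin p) := EuclideanSpace.single i 1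
    set y : EuclideanSpace ℝ (Fin p) := EuclideanSpace.single j 1
    have e1 : D i j = ⟪x, mulE D y⟫ := by
      simp [x, y, mulE, EuclideanSpace.inner_single_left]
    have e2 : 4 * ⟪x, mulE D y⟫ = ⟪x + y, mulE D (x + y)⟫ - ⟪x - y, mulE D (x - y)⟫ := by
      simp only [mulE_add, mulE_sub, inner_add_left, inner_add_right, inner_sub_left,
        inner_sub_right]
      rw [← inner_mulE_symm hD y x, real_inner_comm x (mulE D y)]
      ring
    have h2 := h (x + y)
    have h3 := h (x - y)
    have h4 : ‖x + y‖ ^ 2 + ‖x - y‖ ^ 2 = 4 := by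
      rw [norm_add_sq_real, norm_sub_sq_real]
      simp [x, y]; ring
    have h5 : |4 * ⟪x, mulE D y⟫| ≤ 4 * κ := by
      rw [e2]
      refine (abs_sub _ _).trans ?_
      nlinarith
    rw [abs_mul, abs_of_pos (by norm_num : (0 : ℝ) < 4)] at h5
    rw [e1]; linarith
  refine (sq_le_sq₀ (norm_nonneg _) (by positivity)).1 ?_
  rw [frobenius_norm_sq]
  calc ∑ i, ∑ j, D i j ^ 2 ≤ ∑ i : Fin p, ∑ j : Fin p, κ ^ 2 :=
        Finset.sum_le_sum fun i _ => Finset.sum_le_sum fun j _ => by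
          rw [← sq_abs]; exact pow_le_pow_left₀ (abs_nonneg _) (h1 i j) 2
    _ = _ := by simp; ring

/-- A symmetric invertible matrix whose largest eigenvalue is `σ`, with unit eigenvector `θ₀`. -/
structure IsRoot (L : Matrix (Fin p) (Fin p) ℝ) (θ₀ : EuclideanSpace ℝ (Fin p)) (σ : ℝ) :
    Prop where
  symm : Lᵀ = L
  isUnit : IsUnit L
  pos : 0 < σ
  norm_eq : ‖θ₀‖ = 1
  mulE_eq : mulE L θ₀ = σ • θ₀
  norm_le : ∀ x, ‖mulE L x‖ ≤ σ * ‖x‖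

variable {L : Matrix (Fin p) (Fin p) ℝ} {θ₀ : EuclideanSpace ℝ (Fin p)} {σ : ℝ}

lemma IsRoot.mulE_inv_mulE (hL : IsRoot L θ₀ σ) (x : EuclideanSpace ℝ (Fin p)) :
    mulE L⁻¹ (mulE L x) = x := by
  rw [← mul_mulE, Matrix.nonsing_inv_mul _ ((Matrix.isUnit_iff_isUnit_det _).1 hL.isUnit), one_mulE]

lemma IsRoot.mulE_mulE_inv (hL : IsRoot L θ₀ σ) (x : EuclideanSpace ℝ (Fin p)) :
    mulE L (mulE L⁻¹ x) = x := by
  rw [← mul_mulE, Matrix.mul_nonsing_inv _ ((Matrix.isUnit_iff_isUnit_det _).1 hL.isUnit), one_mulE]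

lemma IsRoot.mulE_ne_zero (hL : IsRoot L θ₀ σ) {x : EuclideanSpace ℝ (Fin p)} (hx : x ≠ 0) :
    mulE L x ≠ 0 := fun h => hx (by rw [← hL.mulE_inv_mulE x, h, mulE_zero])

lemma abs_inner_mulE_sub_le {H : Matrix (Fin p) (Fin p) ℝ} {ρ : ℝ} (hH : ‖H - 1‖ ≤ ρ)
    (x y : EuclideanSpace ℝ (Fin p)) : |⟪x, mulE H y⟫ - ⟪x, y⟫| ≤ ρ * ‖x‖ * ‖y‖ := by
  have h := abs_inner_mulE_le (H - 1) x y
  rw [sub_mulE, one_mulE, inner_sub_right] at h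
  refine h.trans ?_
  gcongr

lemma IsRoot.inner_mulE_conj (hL : IsRoot L θ₀ σ) (B : Matrix (Fin p) (Fin p) ℝ)
    (x y : EuclideanSpace ℝ (Fin p)) :
    ⟪x, mulE (L * B * L) y⟫ = ⟪mulE L x, mulE B (mulE L y)⟫ := by
  rw [mul_mulE, mul_mulE, inner_mulE_symm hL.symm]

variable [NeZero p] {H : Matrix (Fin p) (Fin p) ℝ} {ρ : ℝ} {l : Fin p → ℝ}
  {t : Fin p → EuclideanSpace ℝ (Fin p)}

/-- The matrix `L H L` is close to `L²`, in the sense that `‖H - 1‖ ≤ ρ`, and has the spectral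
decomposition `∑ⱼ lⱼ tⱼ tⱼ'`. -/
structure IsPerturbation (L H : Matrix (Fin p) (Fin p) ℝ) (ρ : ℝ) (l : Fin p → ℝ)
    (t : Fin p → EuclideanSpace ℝ (Fin p)) : Prop where
  symm : Hᵀ = H
  norm_sub_le : ‖H - 1‖ ≤ ρ
  le_quarter : ρ ≤ 1 / 4
  orthonormal : Orthonormal ℝ t
  le_zero : ∀ j, l j ≤ l 0
  eq_sum : L * H * L = spectralSum l t

lemma IsPerturbation.mulE_eq (h : IsPerturbation L H ρ l t) (j : Fin p) :
    mulE (L * H * L) (t j) = l j • t j := by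
  rw [h.eq_sum, spectralSum_mulE_self h.orthonormal]

lemma IsPerturbation.eigenvalue_bounds (hL : IsRoot L θ₀ σ) (h : IsPerturbation L H ρ l t)
    (j : Fin p) : |l j - ‖mulE L (t j)‖ ^ 2| ≤ ρ * ‖mulE L (t j)‖ ^ 2 := by
  have h1 := abs_inner_mulE_sub_le h.norm_sub_le (mulE L (t j)) (mulE L (t j))
  rw [← hL.inner_mulE_conj, h.mulE_eq, inner_smul_right, real_inner_self_eq_norm_sq,
    h.orthonormal.1 j, real_inner_self_eq_norm_sq] at h1
  simpa [mul_assoc, sq] using h1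

lemma IsPerturbation.pos (hL : IsRoot L θ₀ σ) (h : IsPerturbation L H ρ l t) (j : Fin p) :
    0 < l j := by
  have h1 := (abs_le.1 (h.eigenvalue_bounds hL j)).1
  have h2 : 0 < ‖mulE L (t j)‖ := norm_pos_iff.2 (hL.mulE_ne_zero (h.orthonormal.ne_zero j))
  have h3 := h.le_quarter
  have : 0 < ‖mulE L (t j)‖ ^ 2 := by positivity
  nlinarith

/-- The upper bound is `eigenvalue_bounds` at index `0`; the lower bound is the Rayleigh quotient at
`θ₀`. -/
lemma IsPerturbation.abs_top_sub_le (hL : IsRoot L θ₀ σ) (h : IsPerturbation L H ρ l t) :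
    |l 0 - σ ^ 2| ≤ ρ * σ ^ 2 := by
  have hρ : 0 ≤ ρ := (norm_nonneg _).trans h.norm_sub_le
  have h1 := abs_le.1 (h.eigenvalue_bounds hL 0)
  have h2 : ‖mulE L (t 0)‖ ^ 2 ≤ σ ^ 2 := by
    have := hL.norm_le (t 0)
    rw [h.orthonormal.1 0, mul_one] at this
    exact pow_le_pow_left₀ (norm_nonneg _) this 2
  have h3 := abs_le.1 (abs_inner_mulE_sub_le h.norm_sub_le (mulE L θ₀) (mulE L θ₀))
  rw [← hL.inner_mulE_conj, h.eq_sum, inner_spectralSum_mulE, real_inner_self_eq_norm_sq,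
    hL.mulE_eq, norm_smul, hL.norm_eq, mul_one, Real.norm_of_nonneg hL.pos.le] at h3
  have h4 : ∑ j, l j * ⟪t j, θ₀⟫ ^ 2 ≤ l 0 := by
    calc _ ≤ ∑ j, l 0 * ⟪t j, θ₀⟫ ^ 2 :=
          Finset.sum_le_sum fun j _ => mul_le_mul_of_nonneg_right (h.le_zero j) (sq_nonneg _)
      _ = l 0 := by
          rw [← Finset.mul_sum, Orthonormal.sum_inner_sq h.orthonormal, hL.norm_eq]; ring
  rw [abs_le]
  constructor
  · nlinarith
  · nlinarith

/-- Evaluating `L * H * L` and `L * L` between `θ₀` and `t j` gives `l j * ⟪θ₀, t j⟫` and `σ² * ⟪θ₀,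
t j⟫`. These differ by at most `ρ σ ‖L (t j)‖`, which is of order `ρ √(l 0 * l j)`; this geometric
mean is what makes the bounds uniform in the spectrum. -/
lemma IsPerturbation.eigenvector_bounds (hL : IsRoot L θ₀ σ) (h : IsPerturbation L H ρ l t)
    (j : Fin p) : (l 0 - l j) * |⟪θ₀, t j⟫| ≤ 8 * ρ * √(l 0 * l j) ∧
      |⟪θ₀, t j⟫| * √(l 0) ≤ 2 * √(l j) := by
  have hρ : 0 ≤ ρ := (norm_nonneg _).trans h.norm_sub_le
  have hρ4 := h.le_quarter
  have hσ := hL.pos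
  have hl := h.pos hL
  have h1 := abs_le.1 (h.eigenvalue_bounds hL j)
  have h2 := abs_le.1 (h.abs_top_sub_le hL)
  rw [Real.sqrt_mul (hl 0).le]
  set c := |⟪θ₀, t j⟫| with hc
  have hc0 : 0 ≤ c := abs_nonneg _
  have hc1 : c ≤ 1 := by
    simpa [hL.norm_eq, h.orthonormal.1 j] using abs_real_inner_le_norm θ₀ (t j)
  set m := √(l 0) with hm
  set s := √(l j) with hs
  have hm2 : m ^ 2 = l 0 := Real.sq_sqrt (hl 0).le
  have hs2 : s ^ 2 = l j := Real.sq_sqrt (hl j).le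
  have hm0 : 0 < m := Real.sqrt_pos.2 (hl 0)
  have hs0 : 0 < s := Real.sqrt_pos.2 (hl j)
  rw [← hm2] at h2 ⊢
  rw [← hs2] at h1 ⊢
  have hsm : s ≤ m := Real.sqrt_le_sqrt (h.le_zero j)
  have hσm : 3 / 4 * σ ^ 2 ≤ m ^ 2 := by nlinarith [sq_nonneg σ]
  have hmσ : m ^ 2 ≤ 5 / 4 * σ ^ 2 := by nlinarith [sq_nonneg σ]
  have hLt : 3 / 4 * ‖mulE L (t j)‖ ^ 2 ≤ s ^ 2 := by nlinarith [sq_nonneg ‖mulE L (t j)‖]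
  have h3 : |s ^ 2 - σ ^ 2| * c ≤ ρ * (4 / 3 * (m * s)) := by
    have e1 := abs_inner_mulE_sub_le h.norm_sub_le (mulE L θ₀) (mulE L (t j))
    rw [← hL.inner_mulE_conj, h.mulE_eq, inner_smul_right, hL.mulE_eq, inner_smul_left,
      ← inner_mulE_symm hL.symm, hL.mulE_eq, inner_smul_left, norm_smul, hL.norm_eq, mul_one, Real.norm_of_nonneg hσ.le] at e1
    have e2 : |s ^ 2 - σ ^ 2| * c = |l j * ⟪θ₀, t j⟫ - σ * (σ * ⟪θ₀, t j⟫)| := by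
      rw [hc, ← abs_mul, hs2]; congr 1; ring
    rw [e2]
    refine e1.trans ?_
    rw [mul_assoc]
    refine mul_le_mul_of_nonneg_left ?_ hρ
    refine (sq_le_sq₀ (by positivity) (by positivity)).1 ?_
    have := mul_le_mul hσm hLt (by positivity) (by positivity)
    nlinarith
  -- If `l j` is comparable to `l 0`, replacing `σ²` by `l 0` costs only a multiple of `ρ √(l 0 * l
  -- j)`. Otherwise `|l j - σ²|` is at least a fixed fraction of `l 0`, and `h3` can be divided by
  -- `√(l 0)`.
  rcases le_or_gt (m ^ 2 / 2) (s ^ 2) with hcase | hcase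
  · have hms : m ≤ 3 / 2 * s := by
      refine (sq_le_sq₀ (by positivity) (by positivity)).1 ?_
      nlinarith
    constructor
    · have e1 : (m ^ 2 - s ^ 2) * c ≤ |s ^ 2 - σ ^ 2| * c + ρ * (4 / 3 * m ^ 2) := by
        have e2 : m ^ 2 - s ^ 2 ≤ |s ^ 2 - σ ^ 2| + ρ * σ ^ 2 := by
          have := neg_abs_le (s ^ 2 - σ ^ 2)
          linarith
        have e3 : ρ * σ ^ 2 * c ≤ ρ * (4 / 3 * m ^ 2) := by
          calc ρ * σ ^ 2 * c ≤ ρ * σ ^ 2 * 1 := by gcongr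
            _ ≤ _ := by rw [mul_one]; gcongr; linarith
        have := mul_le_mul_of_nonneg_right e2 hc0
        linarith
      have e4 : m ^ 2 ≤ 3 / 2 * (m * s) := by nlinarith
      have e5 := mul_le_mul_of_nonneg_left e4 hρ
      have : 0 ≤ ρ * (m * s) := by positivity
      nlinarith
    · nlinarith
  · have e1 : 3 / 10 * m ^ 2 ≤ |s ^ 2 - σ ^ 2| := by
      rw [abs_sub_comm]
      refine le_trans ?_ (le_abs_self _)
      linarith
    have e2 : m * (m * c) ≤ m * (40 / 9 * ρ * s) := by
      have := mul_le_mul_of_nonneg_right e1 hc0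
      linarith
    have e3 : m * c ≤ 40 / 9 * ρ * s := le_of_mul_le_mul_left e2 hm0
    constructor
    · have : s ^ 2 * c ≥ 0 := by positivity
      have : 0 ≤ ρ * (m * s) := by positivity
      nlinarith
    · have := mul_le_mul_of_nonneg_right hρ4 hs0.le
      nlinarith

lemma correctedShape_eq_spectralSum (hθ : ‖θ₀‖ = 1) (l : Fin p → ℝ)
    (t : Fin p → EuclideanSpace ℝ (Fin p)) :
    correctedShape θ₀ l t = spectralSum l (correctedVecs θ₀ t) := by
  rw [spectralSum, ← Finset.add_sum_erase _ _ (Finset.mem_univ 0), correctedVecs_zero hθ]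
  rfl

/-- If `t₀` is not close to being orthogonal to `θ₀`, the corrected shape matrix is as close to
`L²` as `L H L`. -/
lemma IsPerturbation.correctedShape (hL : IsRoot L θ₀ σ) (h : IsPerturbation L H ρ l t) {η : ℝ}
    (hη : 0 < η) (hη0 : η ≤ |⟪θ₀, t 0⟫|) {K : ℝ} (hK : K = 224 * p ^ 3 / η ^ 6 + 1)
    (hρK : p * (K * ρ) ≤ 1 / 2) :
    (correctedShape θ₀ l t).PosDef ∧ mulE (correctedShape θ₀ l t) θ₀ = l 0 • θ₀ ∧
      ‖(l 0 / σ ^ 2) • (L * (SignPCA.correctedShape θ₀ l t)⁻¹ * L) - 1‖ ≤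
        (3 * p ^ 2 * K + p) * ρ := by
  have hp1 : (1 : ℝ) ≤ p := by exact_mod_cast Nat.one_le_iff_ne_zero.2 (NeZero.ne p)
  have hρ : 0 ≤ ρ := (norm_nonneg _).trans h.norm_sub_le
  have hρ4 := h.le_quarter
  have hσ := hL.pos
  have hl := h.pos hL
  have h0 : ⟪θ₀, t 0⟫ ≠ 0 := fun h => by rw [h, abs_zero] at hη0; linarith
  have horth := orthonormal_correctedVecs hL.norm_eq h.orthonormal h0
  rw [correctedShape_eq_spectralSum hL.norm_eq]
  set Y := spectralSum l (correctedVecs θ₀ t) with hY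
  have hYpd : Y.PosDef := posDef_spectralSum horth hl
  have hYθ : mulE Y θ₀ = l 0 • θ₀ := by
    have := spectralSum_mulE_self horth l 0
    rwa [correctedVecs_zero hL.norm_eq] at this
  refine ⟨hYpd, hYθ, ?_⟩
  have uL := (Matrix.isUnit_iff_isUnit_det _).1 hL.isUnit
  -- The corrected matrix relative to `L²`; it is compared with `H` and then with `1`. The constant
  -- in `K` is `224 = 14 * 8 * 2`: from the corrected form, from `eigenvector_bounds`, and from `H ≤
  -- 2` as a form.
  set Q := L⁻¹ * Y * L⁻¹ with hQ
  have hLi : (L⁻¹)ᵀ = L⁻¹ := by rw [transpose_nonsing_inv, hL.symm]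
  have hQs : Qᵀ = Q := by
    rw [hQ, transpose_mul, transpose_mul, hLi, transpose_spectralSum, ← mul_assoc]
  have hK0 : 0 ≤ K := by rw [hK]; positivity
  have hQ1 : ‖Q - 1‖ ≤ p * (K * ρ) := by
    refine norm_le_of_abs_inner_le (by rw [transpose_sub, hQs, transpose_one]) (by positivity)
      fun x => ?_
    set y := mulE L⁻¹ x with hy
    have hLy : mulE L y = x := hL.mulE_mulE_inv x
    have e1 : ⟪x, mulE Q x⟫ = ⟪y, mulE Y y⟫ := by
      rw [hQ, mul_mulE, mul_mulE, ← inner_mulE_symm hLi]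
    have e2 := abs_correctedForm_sub_le hL.norm_eq h.orthonormal hη hη0 hl h.le_zero
      (fun j => (h.eigenvector_bounds hL j).1) (fun j => (h.eigenvector_bounds hL j).2) y
    rw [← inner_spectralSum_mulE, ← inner_spectralSum_mulE, ← h.eq_sum, hL.inner_mulE_conj,
      hLy, ← hY, ← e1] at e2
    have e3 := abs_inner_mulE_sub_le h.norm_sub_le x x
    rw [real_inner_self_eq_norm_sq, mul_assoc, ← sq] at e3
    rw [sub_mulE, one_mulE, inner_sub_right, real_inner_self_eq_norm_sq]
    have e4 : ⟪x, mulE H x⟫ ≤ 2 * ‖x‖ ^ 2 := by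
      have := (abs_le.1 e3).2
      nlinarith [sq_nonneg ‖x‖]
    have e5 : 14 * p ^ 3 / η ^ 6 * (8 * ρ) * ⟪x, mulE H x⟫ ≤
        14 * p ^ 3 / η ^ 6 * (8 * ρ) * (2 * ‖x‖ ^ 2) := by gcongr
    have e6 := abs_sub_le ⟪x, mulE Q x⟫ ⟪x, mulE H x⟫ (‖x‖ ^ 2)
    have e7 : K * ρ * ‖x‖ ^ 2 = 14 * p ^ 3 / η ^ 6 * (8 * ρ) * (2 * ‖x‖ ^ 2) + ρ * ‖x‖ ^ 2 := by
      rw [hK]; ring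
    rw [e7]
    linarith
  obtain ⟨C, hC⟩ : ∃ C, Q = 1 + C := ⟨Q - 1, by abel⟩
  have hC1 : ‖C‖ ≤ p * (K * ρ) := by rw [hC, add_sub_cancel_left] at hQ1; exact hQ1
  have hQi : L * Y⁻¹ * L = Q⁻¹ := by
    rw [hQ, Matrix.mul_inv_rev, Matrix.mul_inv_rev, Matrix.nonsing_inv_nonsing_inv _ uL, mul_assoc]
  have h2 : ‖Q⁻¹ - 1‖ ≤ 2 * p * (p * (K * ρ)) := by
    rw [hC]
    refine (norm_inv_one_add_sub_one_le (hC1.trans hρK)).trans ?_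
    gcongr
  have h3 := h.abs_top_sub_le hL
  have hσ2 : 0 < σ ^ 2 := by positivity
  have h4 : |l 0 / σ ^ 2 - 1| ≤ ρ := by
    have : l 0 / σ ^ 2 - 1 = (l 0 - σ ^ 2) / σ ^ 2 := by field_simp
    rw [this, abs_div, abs_of_pos hσ2, div_le_iff₀ hσ2]
    exact h3
  have h5 : |l 0 / σ ^ 2| ≤ 3 / 2 := by
    have := abs_le.1 h4
    rw [abs_le]; constructor <;> linarith
  have e : (l 0 / σ ^ 2) • (L * Y⁻¹ * L) - 1 =
      (l 0 / σ ^ 2) • (Q⁻¹ - 1) + (l 0 / σ ^ 2 - 1) • (1 : Matrix (Fin p) (Fin p) ℝ) := by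
    rw [hQi, smul_sub, sub_smul, one_smul]; abel
  rw [e]
  calc _ ≤ |l 0 / σ ^ 2| * ‖Q⁻¹ - 1‖ +
        |l 0 / σ ^ 2 - 1| * ‖(1 : Matrix (Fin p) (Fin p) ℝ)‖ := by
        refine (norm_add_le _ _).trans (le_of_eq ?_)
        rw [norm_smul, norm_smul, Real.norm_eq_abs, Real.norm_eq_abs]
    _ ≤ 3 / 2 * (2 * p * (p * (K * ρ))) + ρ * p := by
        gcongr
        exact norm_one_le
    _ = _ := by ring

end Perturbation

/-! ### Second-order expansion of the test statistic -/

section StatisticExpansion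

open Matrix RealInnerProductSpace

attribute [local instance] Matrix.frobeniusNormedRing Matrix.frobeniusNormedSpace

variable {p n : ℕ} {θ₀ : EuclideanSpace ℝ (Fin p)}

lemma norm_one_sub_outer_mulE_le (hθ : ‖θ₀‖ = 1) (x : EuclideanSpace ℝ (Fin p)) :
    ‖mulE (1 - outer θ₀) x‖ ≤ ‖x‖ := by
  refine (sq_le_sq₀ (norm_nonneg _) (norm_nonneg _)).1 ?_
  rw [sub_mulE, one_mulE, outer_mulE, norm_sub_sq_real, inner_smul_right, norm_smul, hθ,
    real_inner_comm, mul_one, Real.norm_eq_abs, sq_abs]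
  nlinarith [sq_nonneg ⟪θ₀, x⟫]

/-- The linear term in `F` is, by isotropy, `F + Fᵀ + F.trace • 1` up to a factor and up to `O(δ²)`.
Applied to `θ₀` it gives a multiple of `θ₀`, because `F θ₀ = 0`, and the projection removes it. So
`z - z₀ = O(δ²)` while `z₀ = O(δ)`, and the factor `1 + F` also costs only `O(δ³)`. -/
lemma abs_inner_expansion_sub_le [NeZero p] {δ φ κ : ℝ} {W : Fin n → EuclideanSpace ℝ (Fin p)}
    (h : IsBalanced δ W) (hθ : ‖θ₀‖ = 1) {F : Matrix (Fin p) (Fin p) ℝ} (hFs : Fᵀ = F)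
    (hFθ : mulE F θ₀ = 0) (hF : ‖F‖ ≤ φ) (hφ : φ ≤ 1 / 2) (hφδ : φ ≤ κ * δ) (hδ : δ ≤ 1)
    {z z₀ : EuclideanSpace ℝ (Fin p)}
    (hz : z = mulE ((1 - outer θ₀) * outerAvg W fun i => ⟪W i, mulE (1 + F) (W i)⟫⁻¹) θ₀)
    (hz₀ : z₀ = mulE ((1 - outer θ₀) * outerAvg W fun _ => 1) θ₀) :
    |⟪z, mulE (1 + F) z⟫ - ‖z₀‖ ^ 2| ≤
      ((κ + 2 * κ ^ 2) * (2 * p + (κ + 2 * κ ^ 2)) + κ * (p + (κ + 2 * κ ^ 2)) ^ 2) * δ ^ 3 := by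
  have hp : 0 < (p : ℝ) := by exact_mod_cast Nat.pos_of_ne_zero (NeZero.ne p)
  have hδ0 := h.nonneg
  have hφ0 : 0 ≤ φ := (norm_nonneg _).trans hF
  have hκδ : 0 ≤ κ * δ := hφ0.trans hφδ
  set w : Fin n → ℝ := fun i => ⟪W i, mulE F (W i)⟫ with hw
  have hwle : ∀ i, |w i| ≤ φ := fun i => (abs_inner_mulE_self_le h.norm_eq F i).trans hF
  set R := outerAvg W fun i => w i ^ 2 * (1 + w i)⁻¹ with hR
  have hRle : ‖R‖ ≤ 2 * φ ^ 2 := by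
    refine norm_outerAvg_le h.norm_eq (by positivity) fun i => ?_
    have h1 := abs_le.1 (hwle i)
    have h2 : 0 < 1 + w i := by linarith
    rw [abs_of_nonneg (by positivity), ← div_eq_mul_inv, div_le_iff₀ h2]
    have := pow_le_pow_left₀ (abs_nonneg _) (hwle i) 2
    rw [sq_abs] at this
    nlinarith [sq_nonneg φ]
  set M := momentMap W F - ((p : ℝ) * (p + 2))⁻¹ • (F + Fᵀ + F.trace • 1) with hM
  have hMle : ‖M‖ ≤ δ * φ := (h.moment F).trans (mul_le_mul_of_nonneg_left hF hδ0)
  have e1 : (outerAvg W fun i => ⟪W i, mulE (1 + F) (W i)⟫⁻¹) =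
      (outerAvg W fun _ => 1) - momentMap W F + R := by
    rw [momentMap, ← outerAvg_sub, hR, ← outerAvg_add]
    congr 1
    funext i
    rw [inner_one_add_mulE h.norm_eq]
    have h1 := abs_le.1 (hwle i)
    have h2 : 1 + w i ≠ 0 := by linarith
    change (1 + w i)⁻¹ = 1 - w i + w i ^ 2 * (1 + w i)⁻¹
    field_simp; ring
  have hPθ : mulE (1 - outer θ₀) θ₀ = 0 := by
    rw [sub_mulE, one_mulE, outer_mulE, real_inner_self_eq_norm_sq, hθ]; simp
  have e2 : z - z₀ = mulE (1 - outer θ₀) (mulE R θ₀ - mulE M θ₀) := by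
    have e3 : momentMap W F = M + ((p : ℝ) * (p + 2))⁻¹ • (F + Fᵀ + F.trace • 1) := by
      rw [hM]; abel
    rw [hz, hz₀, e1, e3, hFs]
    generalize 1 - outer θ₀ = P at hPθ ⊢
    simp only [mul_mulE, add_mulE, sub_mulE _ _ θ₀, smul_mulE, hFθ, one_mulE, mulE_add, mulE_sub,
      mulE_smul, hPθ, mulE_zero]
    simp only [smul_zero, add_zero]
    abel
  have hzz : ‖z - z₀‖ ≤ (κ + 2 * κ ^ 2) * δ ^ 2 := by
    rw [e2]
    refine (norm_one_sub_outer_mulE_le hθ _).trans ((norm_sub_le _ _).trans ?_)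
    have a1 := norm_mulE_le R θ₀
    have a2 := norm_mulE_le M θ₀
    rw [hθ, mul_one] at a1 a2
    have a3 : φ ^ 2 ≤ (κ * δ) ^ 2 := pow_le_pow_left₀ hφ0 hφδ 2
    have a4 : δ * φ ≤ δ * (κ * δ) := mul_le_mul_of_nonneg_left hφδ hδ0
    nlinarith
  have hz0 : ‖z₀‖ ≤ p * δ := by
    have : z₀ = mulE (1 - outer θ₀) (mulE ((outerAvg W fun _ => 1) - (p : ℝ)⁻¹ • 1) θ₀) := by
      rw [hz₀, mul_mulE, sub_mulE _ _ θ₀, mulE_sub, smul_mulE, one_mulE, mulE_smul, hPθ,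
        smul_zero, sub_zero]
    rw [this]
    refine (norm_one_sub_outer_mulE_le hθ _).trans ((norm_mulE_le _ _).trans ?_)
    rw [hθ, mul_one]
    exact h.norm_cov_sub_le
  set a := κ + 2 * κ ^ 2 with ha
  have haδ : 0 ≤ a * δ := by
    have : a * δ = κ * δ + 2 * κ * (κ * δ) := by rw [ha]; ring
    rw [this]
    rcases hδ0.eq_or_lt with h0 | h0
    · rw [← h0]; simp
    · have : 0 ≤ κ := nonneg_of_mul_nonneg_left hκδ h0
      positivity
  have hzn : ‖z‖ ≤ (p + a) * δ := by
    have a1 : ‖z‖ ≤ ‖z₀‖ + ‖z - z₀‖ := by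
      have := norm_add_le z₀ (z - z₀)
      rwa [add_sub_cancel] at this
    have a2 : a * δ ^ 2 ≤ a * δ := by nlinarith
    linarith
  have e3 : ⟪z, mulE (1 + F) z⟫ - ‖z₀‖ ^ 2 =
      (2 * ⟪z₀, z - z₀⟫ + ‖z - z₀‖ ^ 2) + ⟪z, mulE F z⟫ := by
    rw [add_mulE, one_mulE, inner_add_right, real_inner_self_eq_norm_sq]
    have : ‖z‖ ^ 2 = ‖z₀ + (z - z₀)‖ ^ 2 := by rw [add_sub_cancel]
    rw [this, norm_add_sq_real]; ring
  rw [e3]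
  have b1 : |⟪z₀, z - z₀⟫| ≤ (p * δ) * (a * δ ^ 2) :=
    (abs_real_inner_le_norm _ _).trans (mul_le_mul hz0 hzz (norm_nonneg _) (by positivity))
  have b2 : ‖z - z₀‖ ^ 2 ≤ a ^ 2 * δ ^ 3 := by
    have c1 := pow_le_pow_left₀ (norm_nonneg _) hzz 2
    have c2 : (a * δ ^ 2) ^ 2 = (a * δ) ^ 2 * δ ^ 2 := by ring
    have c3 : (a * δ) ^ 2 * δ ^ 2 ≤ (a * δ) ^ 2 * δ :=
      mul_le_mul_of_nonneg_left (by nlinarith) (sq_nonneg _)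
    nlinarith
  have b3 : |⟪z, mulE F z⟫| ≤ (κ * δ) * ((p + a) * δ) ^ 2 := by
    refine (abs_inner_mulE_le F z z).trans ?_
    rw [mul_assoc, ← sq]
    exact mul_le_mul (hF.trans hφδ) (pow_le_pow_left₀ (norm_nonneg _) hzn 2) (sq_nonneg _) hκδ
  have b4 : |2 * ⟪z₀, z - z₀⟫ + ‖z - z₀‖ ^ 2 + ⟪z, mulE F z⟫| ≤
      2 * |⟪z₀, z - z₀⟫| + ‖z - z₀‖ ^ 2 + |⟪z, mulE F z⟫| := by
    refine (abs_add_three _ _ _).trans (le_of_eq ?_)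
    rw [abs_mul, abs_two, abs_of_nonneg (sq_nonneg ‖z - z₀‖)]
  refine b4.trans ?_
  have : (a * (2 * p + a) + κ * (p + a) ^ 2) * δ ^ 3 =
      2 * ((p * δ) * (a * δ ^ 2)) + a ^ 2 * δ ^ 3 + (κ * δ) * ((p + a) * δ) ^ 2 := by ring
  rw [this]
  linarith

end StatisticExpansion

end SignPCA

namespace SignPCA

/-! ### Small-ball bound for Rademacher sums -/

section AntiConcentration

variable {n : ℕ}

/-- The sign `±1` encoded by a Boolean. -/
def boolSign (b : Bool) : ℝ := if b then 1 else -1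

lemma boolSign_sq (b : Bool) : boolSign b ^ 2 = 1 := by
  cases b <;> simp [boolSign]

lemma sum_cos_boolSign (a : Fin n → ℝ) :
    ∑ e : Fin n → Bool, Real.cos (∑ i, boolSign (e i) * a i) = 2 ^ n * ∏ i, Real.cos (a i) := by
  have h : ∑ e : Fin n → Bool, Complex.exp ((∑ i, boolSign (e i) * a i : ℝ) * Complex.I) =
      ((2 ^ n * ∏ i, Real.cos (a i) : ℝ) : ℂ) := by
    have h1 : ∀ e : Fin n → Bool, Complex.exp ((∑ i, boolSign (e i) * a i : ℝ) * Complex.I) =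
        ∏ i, Complex.exp ((boolSign (e i) * a i : ℝ) * Complex.I) := fun e => by
      rw [← Complex.exp_sum]; congr 1; push_cast; rw [Finset.sum_mul]
    simp_rw [h1]
    rw [← Fintype.prod_sum (fun i (b : Bool) => Complex.exp ((boolSign b * a i : ℝ) * Complex.I))]
    push_cast
    have h2 : (2 : ℂ) ^ n = ∏ _i : Fin n, (2 : ℂ) := by simp
    rw [h2, ← Finset.prod_mul_distrib]
    refine Finset.prod_congr rfl fun i _ => ?_
    rw [Complex.two_cos, Fintype.sum_bool]
    simp [boolSign]
  have h2 := congrArg Complex.re h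
  rw [Complex.ofReal_re, Complex.re_sum] at h2
  rw [← h2]
  refine Finset.sum_congr rfl fun e _ => ?_
  rw [Complex.exp_ofReal_mul_I_re]

lemma abs_prod_cos_le {a : Fin n → ℝ} (ha : ∀ i, |a i| ≤ 1) :
    ∏ i, Real.cos (a i) ≤ Real.exp (-(2 / Real.pi ^ 2) * ∑ i, a i ^ 2) := by
  rw [Finset.mul_sum, Real.exp_sum]
  refine Finset.prod_le_prod (fun i _ => ?_) fun i _ => ?_
  · have := abs_le.1 (ha i)
    exact Real.cos_nonneg_of_mem_Icc ⟨by linarith [Real.pi_gt_three], by linarith [Real.pi_gt_three]⟩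
  · have h2 := Real.cos_le_one_sub_mul_cos_sq ((ha i).trans (by linarith [Real.pi_gt_three]))
    have h3 := Real.add_one_le_exp (-(2 / Real.pi ^ 2) * a i ^ 2)
    linarith

/-- The squared modulus of the Fourier transform of the uniform distribution on `[0, 1]`. -/
noncomputable def smoothingKernel (x : ℝ) : ℝ :=
  ∫ t in (0 : ℝ)..1, ∫ u in (0 : ℝ)..1, Real.cos ((t - u) * x)

lemma smoothingKernel_eq (x : ℝ) : smoothingKernel x =
    (∫ t in (0 : ℝ)..1, Real.cos (t * x)) ^ 2 + (∫ t in (0 : ℝ)..1, Real.sin (t * x)) ^ 2 := by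
  have h1 : ∀ t : ℝ, ∫ u in (0 : ℝ)..1, Real.cos ((t - u) * x) =
      Real.cos (t * x) * (∫ u in (0 : ℝ)..1, Real.cos (u * x)) +
        Real.sin (t * x) * ∫ u in (0 : ℝ)..1, Real.sin (u * x) := fun t => by
    rw [← intervalIntegral.integral_const_mul, ← intervalIntegral.integral_const_mul,
      ← intervalIntegral.integral_add]
    · refine intervalIntegral.integral_congr fun u _ => ?_
      simp only [sub_mul, Real.cos_sub]
    · exact (by fun_prop : Continuous _).intervalIntegrable _ _
    · exact (by fun_prop : Continuous _).intervalIntegrable _ _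
  rw [smoothingKernel]
  simp_rw [h1]
  rw [intervalIntegral.integral_add, intervalIntegral.integral_mul_const,
    intervalIntegral.integral_mul_const]
  · ring
  · exact (by fun_prop : Continuous _).intervalIntegrable _ _
  · exact (by fun_prop : Continuous _).intervalIntegrable _ _

lemma smoothingKernel_nonneg (x : ℝ) : 0 ≤ smoothingKernel x := by
  rw [smoothingKernel_eq]; positivity

lemma one_fourth_le_smoothingKernel {x : ℝ} (hx : |x| ≤ 1) : 1 / 4 ≤ smoothingKernel x := by
  have h1 : 1 / 2 ≤ ∫ t in (0 : ℝ)..1, Real.cos (t * x) := by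
    have h2 : ∫ _ in (0 : ℝ)..1, (1 / 2 : ℝ) ≤ ∫ t in (0 : ℝ)..1, Real.cos (t * x) := by
      refine intervalIntegral.integral_mono_on zero_le_one (by simp)
        ((by fun_prop : Continuous _).intervalIntegrable _ _) fun t ht => ?_
      have h3 : |t * x| ≤ 1 := by
        rw [abs_mul, abs_of_nonneg ht.1]
        exact mul_le_one₀ ht.2 (abs_nonneg _) hx
      have h4 := Real.one_sub_sq_div_two_le_cos (x := t * x)
      have h5 : (t * x) ^ 2 ≤ 1 := by rw [← sq_abs]; exact pow_le_one₀ (abs_nonneg _) h3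
      linarith
    simpa using h2
  rw [smoothingKernel_eq]
  nlinarith [sq_nonneg (∫ t in (0 : ℝ)..1, Real.sin (t * x))]

/-- Averaging over the signs turns each cosine into a product of cosines. As `|(t - u) * a i| ≤ 1`,
the product is nonnegative and at most a Gaussian in `t - u`, whose integral over the line is of
order `(∑ (a i)²)^{-1/2}`. -/
lemma sum_smoothingKernel_le {a : Fin n → ℝ} (ha : ∀ i, |a i| ≤ 1) (hA : 0 < ∑ i, a i ^ 2) :
    ∑ e : Fin n → Bool, smoothingKernel (∑ i, boolSign (e i) * a i) ≤
      2 ^ n * (4 / √(∑ i, a i ^ 2)) := by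
  set A := ∑ i, a i ^ 2 with hA'
  set b := 2 / Real.pi ^ 2 * A with hb
  have hb0 : 0 < b := by positivity
  have h1 : ∑ e : Fin n → Bool, smoothingKernel (∑ i, boolSign (e i) * a i) =
      ∫ t in (0 : ℝ)..1, ∫ u in (0 : ℝ)..1, 2 ^ n * ∏ i, Real.cos ((t - u) * a i) := by
    have h2 : ∀ t u : ℝ, 2 ^ n * ∏ i, Real.cos ((t - u) * a i) =
        ∑ e : Fin n → Bool, Real.cos ((t - u) * ∑ i, boolSign (e i) * a i) := fun t u => by
      rw [← sum_cos_boolSign]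
      refine Finset.sum_congr rfl fun e _ => ?_
      rw [Finset.mul_sum]; congr 1
      exact Finset.sum_congr rfl fun i _ => by ring
    simp_rw [h2]
    have h3 : ∀ t : ℝ, ∫ u in (0 : ℝ)..1,
        ∑ e : Fin n → Bool, Real.cos ((t - u) * ∑ i, boolSign (e i) * a i) =
        ∑ e : Fin n → Bool, ∫ u in (0 : ℝ)..1,
          Real.cos ((t - u) * ∑ i, boolSign (e i) * a i) := fun t =>
      intervalIntegral.integral_finsetSum fun e _ =>
        (by fun_prop : Continuous _).intervalIntegrable _ _
    simp_rw [h3]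
    rw [intervalIntegral.integral_finsetSum]
    · rfl
    · intro e _
      refine Continuous.intervalIntegrable ?_ _ _
      exact intervalIntegral.continuous_parametric_intervalIntegral_of_continuous'
        (by fun_prop) 0 1
  have h4 : ∀ t ∈ Set.Icc (0 : ℝ) 1, ∫ u in (0 : ℝ)..1, 2 ^ n * ∏ i, Real.cos ((t - u) * a i) ≤
      2 ^ n * (4 / √A) := fun t ht => by
    rw [intervalIntegral.integral_const_mul]
    refine mul_le_mul_of_nonneg_left ?_ (by positivity)
    have hint : Integrable fun u : ℝ => Real.exp (-b * (t - u) ^ 2) :=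
      (integrable_exp_neg_mul_sq hb0).comp_sub_left t
    calc ∫ u in (0 : ℝ)..1, ∏ i, Real.cos ((t - u) * a i)
        ≤ ∫ u in (0 : ℝ)..1, Real.exp (-b * (t - u) ^ 2) := by
          refine intervalIntegral.integral_mono_on zero_le_one
            ((by fun_prop : Continuous _).intervalIntegrable _ _)
            ((by fun_prop : Continuous _).intervalIntegrable _ _) fun u hu => ?_
          have h5 : ∀ i, |(t - u) * a i| ≤ 1 := fun i => by
            rw [abs_mul]
            refine mul_le_one₀ ?_ (abs_nonneg _) (ha i)
            rw [abs_le]; constructor <;> linarith [ht.1, ht.2, hu.1, hu.2]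
          refine (abs_prod_cos_le h5).trans (le_of_eq ?_)
          congr 1
          simp_rw [mul_pow]
          rw [← Finset.mul_sum, hb]; ring
      _ ≤ ∫ u : ℝ, Real.exp (-b * (t - u) ^ 2) := by
          rw [intervalIntegral.integral_of_le zero_le_one]
          exact setIntegral_le_integral hint (ae_of_all _ fun u => (Real.exp_pos _).le)
      _ = √(Real.pi / b) := by
          rw [integral_sub_left_eq_self (fun u => Real.exp (-b * u ^ 2)) volume t,
            integral_gaussian]
      _ ≤ 4 / √A := by
          -- The constant `4` works because `π ^ 3 / 2 ≤ 16`.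
          rw [Real.sqrt_le_left (by positivity), div_pow, Real.sq_sqrt hA.le, hb]
          have h6 : Real.pi / (2 / Real.pi ^ 2 * A) = Real.pi ^ 3 / 2 / A := by field_simp
          rw [h6]
          have h7 : Real.pi ^ 3 ≤ 3.15 ^ 3 :=
            pow_le_pow_left₀ Real.pi_pos.le Real.pi_lt_d2.le 3
          gcongr
          norm_num at h7 ⊢
          linarith
  rw [h1]
  have h8 : Continuous fun t : ℝ => ∫ u in (0 : ℝ)..1, 2 ^ n * ∏ i, Real.cos ((t - u) * a i) :=
    intervalIntegral.continuous_parametric_intervalIntegral_of_continuous' (by fun_prop) 0 1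
  have h9 := intervalIntegral.integral_mono_on zero_le_one (h8.intervalIntegrable 0 1)
    (intervalIntegrable_const (μ := volume) (a := 0) (b := 1) (c := (2 : ℝ) ^ n * (4 / √A)))
    h4
  simpa using h9

/-- Rademacher sums are not concentrated: a bound for the number of choices of signs for which
`∑ ±aᵢ` is at most `s` in absolute value. -/
lemma card_abs_sum_le {a : Fin n → ℝ} {s : ℝ} (hs : 1 ≤ s) (ha : ∀ i, |a i| ≤ 1)
    (hA : 0 < ∑ i, a i ^ 2) :
    (((Finset.univ : Finset (Fin n → Bool)).filter
      fun e => |∑ i, boolSign (e i) * a i| ≤ s).card : ℝ) ≤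
        2 ^ n * (16 * s / √(∑ i, a i ^ 2)) := by
  have hs0 : 0 < s := by linarith
  set T := (Finset.univ : Finset (Fin n → Bool)).filter
      fun e => |∑ i, boolSign (e i) * a i| ≤ s with hT
  have hsum : ∑ i, (a i / s) ^ 2 = (∑ i, a i ^ 2) / s ^ 2 := by
    rw [Finset.sum_div]; exact Finset.sum_congr rfl fun i _ => by rw [div_pow]
  -- After division by `s` the event is that the sum is at most `1` in absolute value, where the
  -- kernel is at least `1/4`.
  have h1 := sum_smoothingKernel_le (a := fun i => a i / s)
    (fun i => by
      rw [abs_div, abs_of_pos hs0, div_le_one hs0]; exact (ha i).trans hs)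
    (by rw [hsum]; positivity)
  rw [hsum, Real.sqrt_div' _ (by positivity), Real.sqrt_sq hs0.le] at h1
  have h2 : (T.card : ℝ) * (1 / 4) ≤
      ∑ e : Fin n → Bool, smoothingKernel (∑ i, boolSign (e i) * (a i / s)) := by
    rw [← nsmul_eq_mul, ← Finset.sum_const]
    calc _ ≤ ∑ e ∈ T, smoothingKernel (∑ i, boolSign (e i) * (a i / s)) := by
          refine Finset.sum_le_sum fun e he => one_fourth_le_smoothingKernel ?_
          have h3 : ∑ i, boolSign (e i) * (a i / s) = (∑ i, boolSign (e i) * a i) / s := by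
            rw [Finset.sum_div]; exact Finset.sum_congr rfl fun i _ => by ring
          rw [h3, abs_div, abs_of_pos hs0, div_le_one hs0]
          exact (Finset.mem_filter.1 he).2
      _ ≤ _ := Finset.sum_le_sum_of_subset_of_nonneg (Finset.subset_univ _)
          fun _ _ _ => smoothingKernel_nonneg _
  have h4 := h2.trans h1
  have h5 : (2 : ℝ) ^ n * (16 * s / √(∑ i, a i ^ 2)) =
      4 * (2 ^ n * (4 / (√(∑ i, a i ^ 2) / s))) := by
    field_simp; ring
  rw [h5]; linarith

end AntiConcentration

end SignPCA

namespace SignPCA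

/-! ### Near-orthogonality of the leading eigenvector forces a small Rademacher sum -/

section NearMaximum

open Matrix RealInnerProductSpace

attribute [local instance] Matrix.frobeniusNormedRing Matrix.frobeniusNormedSpace

variable {p n : ℕ}

/-- The first-order approximation of (the inverse of the solution of) Tyler's equation. -/
noncomputable def linearised (W : Fin n → EuclideanSpace ℝ (Fin p)) : Matrix (Fin p) (Fin p) ℝ :=
  1 + ((p : ℝ) + 2) • ((outerAvg W fun _ => 1) - (p : ℝ)⁻¹ • 1)

/-- The quadratic form of the matrix `L (linearised W) L`. -/
noncomputable def linForm (L : Matrix (Fin p) (Fin p) ℝ) (W : Fin n → EuclideanSpace ℝ (Fin p))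
    (x : EuclideanSpace ℝ (Fin p)) : ℝ :=
  ⟪mulE L x, mulE (linearised W) (mulE L x)⟫

/-- Up to `κ`, the maximum of `linForm L W` over the unit sphere is attained at a point that is
orthogonal to `θ₀`. -/
def IsNearMax (L : Matrix (Fin p) (Fin p) ℝ) (θ₀ : EuclideanSpace ℝ (Fin p)) (κ : ℝ)
    (W : Fin n → EuclideanSpace ℝ (Fin p)) : Prop :=
  ∃ v : EuclideanSpace ℝ (Fin p), (‖v‖ = 1 ∧ ⟪θ₀, v⟫ = 0) ∧
    ∀ x, ‖x‖ = 1 → linForm L W x ≤ linForm L W v + κ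

lemma transpose_linearised (W : Fin n → EuclideanSpace ℝ (Fin p)) :
    (linearised W)ᵀ = linearised W := by
  simp [linearised, transpose_outerAvg]

lemma norm_linearised_sub_one_le [NeZero p] {δ : ℝ} {W : Fin n → EuclideanSpace ℝ (Fin p)}
    (h : IsBalanced δ W) : ‖linearised W - 1‖ ≤ p * (p + 2) * δ := by
  rw [linearised, add_sub_cancel_left, norm_smul, Real.norm_of_nonneg (by positivity)]
  have := mul_le_mul_of_nonneg_left h.norm_cov_sub_le (by positivity : (0 : ℝ) ≤ p + 2)
  linarith

lemma linForm_eq (L : Matrix (Fin p) (Fin p) ℝ) (W : Fin n → EuclideanSpace ℝ (Fin p))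
    (x : EuclideanSpace ℝ (Fin p)) : linForm L W x =
      (1 - (p + 2) * (p : ℝ)⁻¹) * ‖mulE L x‖ ^ 2 +
        (p + 2) * ((n : ℝ)⁻¹ * ∑ i, ⟪W i, mulE L x⟫ ^ 2) := by
  simp only [linForm, linearised, add_mulE, sub_mulE, one_mulE, smul_mulE, outerAvg_mulE, one_mul,
    inner_add_right, inner_sub_right, inner_smul_right, inner_sum, real_inner_self_eq_norm_sq]
  have : ∀ i, ⟪W i, mulE L x⟫ * ⟪mulE L x, W i⟫ = ⟪W i, mulE L x⟫ ^ 2 := fun i => by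
    rw [real_inner_comm (W i), sq]
  simp_rw [this]
  ring

lemma linForm_smul (L : Matrix (Fin p) (Fin p) ℝ) (W : Fin n → EuclideanSpace ℝ (Fin p)) (c : ℝ)
    (x : EuclideanSpace ℝ (Fin p)) : linForm L W (c • x) = c ^ 2 * linForm L W x := by
  simp only [linForm, mulE_smul, inner_smul_left, inner_smul_right]
  simp; ring

lemma linForm_le_of_forall {L : Matrix (Fin p) (Fin p) ℝ} {W : Fin n → EuclideanSpace ℝ (Fin p)}
    {b : ℝ} (h : ∀ x, ‖x‖ = 1 → linForm L W x ≤ b) (x : EuclideanSpace ℝ (Fin p)) :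
    linForm L W x ≤ b * ‖x‖ ^ 2 := by
  by_cases hx : x = 0
  · simp [hx, linForm, mulE_zero]
  · have h1 := h (‖x‖⁻¹ • x) (by
      rw [norm_smul, norm_inv, norm_norm, inv_mul_cancel₀ (norm_ne_zero_iff.2 hx)])
    have : 0 < ‖x‖ := norm_pos_iff.2 hx
    rw [linForm_smul, inv_pow, inv_mul_le_iff₀ (by positivity)] at h1
    linarith

variable {L : Matrix (Fin p) (Fin p) ℝ} {θ₀ : EuclideanSpace ℝ (Fin p)} {σ : ℝ}

lemma IsRoot.inner_mulE_eq (hL : IsRoot L θ₀ σ) (x : EuclideanSpace ℝ (Fin p)) :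
    ⟪θ₀, mulE L x⟫ = σ * ⟪θ₀, x⟫ := by
  rw [← inner_mulE_symm hL.symm, hL.mulE_eq, inner_smul_left]; rfl

/-- If the leading eigenvector of a perturbation of `L²` is almost orthogonal to `θ₀`, then the
linearised quadratic form is almost maximised on the orthogonal complement of `θ₀`. -/
lemma IsPerturbation.isNearMax [NeZero p] (hL : IsRoot L θ₀ σ) {H : Matrix (Fin p) (Fin p) ℝ}
    {ρ ρ₀ ρ₂ η : ℝ} {l : Fin p → ℝ} {t : Fin p → EuclideanSpace ℝ (Fin p)}
    (h : IsPerturbation L H ρ l t) {W : Fin n → EuclideanSpace ℝ (Fin p)}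
    (h0 : ‖linearised W - 1‖ ≤ ρ₀) (h2 : ‖H - linearised W‖ ≤ ρ₂)
    (hη : |⟪θ₀, t 0⟫| ≤ η) (hη2 : η ≤ 1 / 2) :
    IsNearMax L θ₀ (4 * (ρ₂ + η * ρ₀) * σ ^ 2) W := by
  have hσ := hL.pos
  have hρ₀ : 0 ≤ ρ₀ := (norm_nonneg _).trans h0
  have hρ₂ : 0 ≤ ρ₂ := (norm_nonneg _).trans h2
  have hη0 : 0 ≤ η := (abs_nonneg _).trans hη
  set c := ⟪θ₀, t 0⟫ with hc
  have hc2 : c ^ 2 ≤ 1 / 4 := by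
    rw [← sq_abs]
    have := pow_le_pow_left₀ (abs_nonneg c) (hη.trans hη2) 2
    linarith
  set y := t 0 - c • θ₀ with hy
  have hθy : ⟪θ₀, y⟫ = 0 := by
    rw [hy, inner_sub_right, inner_smul_right, real_inner_self_eq_norm_sq, hL.norm_eq, ← hc]; ring
  have hyn : ‖y‖ ^ 2 = 1 - c ^ 2 := by
    rw [hy, norm_sub_sq_real, inner_smul_right, real_inner_comm, ← hc, norm_smul, hL.norm_eq,
      h.orthonormal.1 0, mul_one, Real.norm_eq_abs, sq_abs]
    ring
  have hy0 : 0 < ‖y‖ := by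
    refine (norm_nonneg _).lt_of_ne fun h' => ?_
    rw [← h'] at hyn; nlinarith
  have hte : t 0 = c • θ₀ + y := by rw [hy]; abel
  have hdiff : ∀ x, ‖x‖ = 1 →
      |⟪mulE L x, mulE H (mulE L x)⟫ - linForm L W x| ≤ ρ₂ * σ ^ 2 := fun x hx => by
    have h3 := abs_inner_mulE_le (H - linearised W) (mulE L x) (mulE L x)
    rw [sub_mulE, inner_sub_right, mul_assoc, ← sq] at h3
    have h4 : ‖mulE L x‖ ^ 2 ≤ σ ^ 2 := by
      have := hL.norm_le x
      rw [hx, mul_one] at this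
      exact pow_le_pow_left₀ (norm_nonneg _) this 2
    exact h3.trans (mul_le_mul h2 h4 (sq_nonneg _) hρ₂)
  -- `t 0` maximises the exact form of `L * H * L`; passing to the linearised form and back costs
  -- `ρ₂ * σ ^ 2` twice.
  set T := linForm L W (t 0) + 2 * ρ₂ * σ ^ 2 with hT
  have hmax : ∀ x, ‖x‖ = 1 → linForm L W x ≤ T := fun x hx => by
    have h3 := (abs_le.1 (hdiff x hx)).1
    have h4 := (abs_le.1 (hdiff (t 0) (h.orthonormal.1 0))).2
    have h5 : ⟪mulE L (t 0), mulE H (mulE L (t 0))⟫ = l 0 := by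
      rw [← hL.inner_mulE_conj, h.mulE_eq, inner_smul_right, real_inner_self_eq_norm_sq,
        h.orthonormal.1 0]; ring
    have h6 : ⟪mulE L x, mulE H (mulE L x)⟫ ≤ l 0 := by
      rw [← hL.inner_mulE_conj, h.eq_sum, inner_spectralSum_mulE]
      calc _ ≤ ∑ j, l 0 * ⟪t j, x⟫ ^ 2 :=
            Finset.sum_le_sum fun j _ => mul_le_mul_of_nonneg_right (h.le_zero j) (sq_nonneg _)
        _ = l 0 := by
            rw [← Finset.mul_sum, Orthonormal.sum_inner_sq h.orthonormal, hx]; ring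
    linarith
  refine ⟨‖y‖⁻¹ • y, ⟨?_, ?_⟩, fun x hx => (hmax x hx).trans ?_⟩
  · rw [norm_smul, norm_inv, norm_norm, inv_mul_cancel₀ hy0.ne']
  · rw [inner_smul_right, hθy, mul_zero]
  set q := linForm L W (‖y‖⁻¹ • y) with hq
  have hqy : linForm L W y = (1 - c ^ 2) * q := by
    rw [hq, linForm_smul, ← hyn]; field_simp
  -- `mulE L θ₀` and `mulE L y` are orthogonal, so only `linearised W - 1` contributes.
  have hcross : |⟪mulE L θ₀, mulE (linearised W) (mulE L y)⟫| ≤ ρ₀ * σ ^ 2 := by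
    have h3 := abs_inner_mulE_sub_le h0 (mulE L θ₀) (mulE L y)
    have h4 : ⟪mulE L θ₀, mulE L y⟫ = 0 := by
      rw [hL.mulE_eq, inner_smul_left, hL.inner_mulE_eq, hθy]; simp
    rw [h4, sub_zero] at h3
    refine h3.trans ?_
    have h5 := hL.norm_le y
    have h6 : ‖y‖ ≤ 1 := by nlinarith [sq_nonneg c]
    have h7 : ‖mulE L θ₀‖ = σ := by
      rw [hL.mulE_eq, norm_smul, hL.norm_eq, Real.norm_of_nonneg hσ.le, mul_one]
    rw [h7, mul_assoc, sq]
    gcongr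
    nlinarith
  have hexp : linForm L W (t 0) = c ^ 2 * linForm L W θ₀ +
      2 * (c * ⟪mulE L θ₀, mulE (linearised W) (mulE L y)⟫) + linForm L W y := by
    rw [hte]
    simp only [linForm, mulE_add, mulE_smul, inner_add_left, inner_add_right, inner_smul_left,
      inner_smul_right]
    rw [← inner_mulE_symm (transpose_linearised W) (mulE L y) (mulE L θ₀),
      real_inner_comm (mulE L θ₀) (mulE (linearised W) (mulE L y))]
    simp; ring
  have h3 := hmax θ₀ hL.norm_eq
  have h4 : c * ⟪mulE L θ₀, mulE (linearised W) (mulE L y)⟫ ≤ η * (ρ₀ * σ ^ 2) := by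
    refine (le_abs_self _).trans ?_
    rw [abs_mul]
    exact mul_le_mul hη hcross (abs_nonneg _) hη0
  have h5 := mul_le_mul_of_nonneg_left h3 (sq_nonneg c)
  have h6 : (1 - c ^ 2) * (T - q) ≤ 2 * (ρ₂ + η * ρ₀) * σ ^ 2 := by
    have : T = linForm L W (t 0) + 2 * ρ₂ * σ ^ 2 := hT
    linarith
  by_contra h7
  have h8 : 0 ≤ 2 * (ρ₂ + η * ρ₀) * σ ^ 2 := by positivity
  have h9 : 4 * (ρ₂ + η * ρ₀) * σ ^ 2 < T - q := by linarith
  nlinarith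

/-- Near-stationarity: comparing `v` with `v ± s θ₀` bounds the mixed term of the form between `θ₀`
and `v`, which is the average in the first conclusion up to a factor. Comparing `v` with `θ₀` bounds
`‖mulE L v‖` below by a multiple of `σ`, so that the Rademacher sum built from this average is not
degenerate. -/
lemma IsNearMax.bounds (hL : IsRoot L θ₀ σ) {W : Fin n → EuclideanSpace ℝ (Fin p)} {ρ₀ κ s : ℝ}
    (h0 : ‖linearised W - 1‖ ≤ ρ₀) (hκ : 0 ≤ κ) (hs : 0 < s) (hs1 : s ≤ 1)
    {v : EuclideanSpace ℝ (Fin p)} (hv : ‖v‖ = 1) (hθv : ⟪θ₀, v⟫ = 0)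
    (hmax : ∀ x, ‖x‖ = 1 → linForm L W x ≤ linForm L W v + κ * σ ^ 2) :
    (p + 2) * |(n : ℝ)⁻¹ * ∑ i, ⟪W i, θ₀⟫ * ⟪W i, mulE L v⟫| ≤ (κ / s + ρ₀ * s) * σ ∧
      (1 - ρ₀ - κ) * σ ^ 2 ≤ (1 + ρ₀) * ‖mulE L v‖ ^ 2 := by
  have hσ := hL.pos
  have hρ₀ : 0 ≤ ρ₀ := (norm_nonneg _).trans h0
  have hmax' := linForm_le_of_forall hmax
  set β := ⟪mulE L θ₀, mulE (linearised W) (mulE L v)⟫ with hβ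
  have hLθ : ⟪mulE L θ₀, mulE L v⟫ = 0 := by
    rw [hL.mulE_eq, inner_smul_left, hL.inner_mulE_eq, hθv]; simp
  have hβ' : β = σ * ((p + 2) * ((n : ℝ)⁻¹ * ∑ i, ⟪W i, θ₀⟫ * ⟪W i, mulE L v⟫)) := by
    have h1 : ⟪θ₀, mulE L v⟫ = 0 := by rw [hL.inner_mulE_eq, hθv, mul_zero]
    rw [hβ, hL.mulE_eq, inner_smul_left]
    simp only [linearised, add_mulE, sub_mulE, one_mulE, smul_mulE, outerAvg_mulE, one_mul,
      inner_add_right, inner_sub_right, inner_smul_right, inner_sum, h1]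
    simp only [mul_zero, sub_zero, zero_add]
    have : ∀ i, ⟪W i, mulE L v⟫ * ⟪θ₀, W i⟫ = ⟪W i, θ₀⟫ * ⟪W i, mulE L v⟫ := fun i => by
      rw [real_inner_comm (W i) θ₀, mul_comm]
    simp_rw [this]; rfl
  have hLv : ‖mulE L v‖ ^ 2 ≤ σ ^ 2 := by
    have := hL.norm_le v
    rw [hv, mul_one] at this
    exact pow_le_pow_left₀ (norm_nonneg _) this 2
  have hμ : linForm L W v ≤ (1 + ρ₀) * ‖mulE L v‖ ^ 2 := by
    have := (abs_le.1 (abs_inner_mulE_sub_le h0 (mulE L v) (mulE L v))).2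
    rw [real_inner_self_eq_norm_sq, mul_assoc, ← sq] at this
    rw [linForm]; linarith
  have ha : (1 - ρ₀) * σ ^ 2 ≤ linForm L W θ₀ := by
    have := (abs_le.1 (abs_inner_mulE_sub_le h0 (mulE L θ₀) (mulE L θ₀))).1
    rw [real_inner_self_eq_norm_sq, mul_assoc, ← sq, hL.mulE_eq, norm_smul, hL.norm_eq, mul_one,
      Real.norm_of_nonneg hσ.le, ← hL.mulE_eq] at this
    rw [linForm]; linarith
  constructor
  · have hexp : ∀ r : ℝ, linForm L W (r • θ₀ + v) = r ^ 2 * linForm L W θ₀ + 2 * (r * β) +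
        linForm L W v := fun r => by
      simp only [linForm, mulE_add, mulE_smul, inner_add_left, inner_add_right, inner_smul_left,
        inner_smul_right]
      rw [← inner_mulE_symm (transpose_linearised W) (mulE L v) (mulE L θ₀),
        real_inner_comm (mulE L θ₀) (mulE (linearised W) (mulE L v))]
      simp; ring
    have hnorm : ∀ r : ℝ, ‖r • θ₀ + v‖ ^ 2 = 1 + r ^ 2 := fun r => by
      rw [norm_add_sq_real, inner_smul_left, hθv, norm_smul, hL.norm_eq, hv, mul_one,
        Real.norm_eq_abs, sq_abs]
      simp; ring
    have hμ' : linForm L W v ≤ (1 + ρ₀) * σ ^ 2 :=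
      hμ.trans (mul_le_mul_of_nonneg_left hLv (by linarith))
    have key : ∀ r : ℝ, r ^ 2 = s ^ 2 → r * β ≤ (κ + ρ₀ * s ^ 2) * σ ^ 2 := fun r hr => by
      have h1 := hmax' (r • θ₀ + v)
      rw [hexp, hnorm, hr] at h1
      have hs2 : 0 ≤ s ^ 2 := sq_nonneg _
      have hs3 : s ^ 2 ≤ 1 := pow_le_one₀ hs.le hs1
      have h2 := mul_le_mul_of_nonneg_left ha hs2
      have h3 := mul_le_mul_of_nonneg_left hμ' hs2
      have h4 : s ^ 2 * (κ * σ ^ 2) ≤ 1 * (κ * σ ^ 2) :=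
        mul_le_mul_of_nonneg_right hs3 (by positivity)
      nlinarith
    have h1 := key s rfl
    have h2 := key (-s) (by ring)
    have h3 : s * |β| ≤ (κ + ρ₀ * s ^ 2) * σ ^ 2 := by
      rcases abs_cases β with ⟨h, _⟩ | ⟨h, _⟩ <;> rw [h] <;> linarith
    have hp2 : (0 : ℝ) < p + 2 := by positivity
    rw [hβ', abs_mul, abs_mul, abs_of_pos hσ, abs_of_pos hp2] at h3
    have h4 : (κ / s + ρ₀ * s) * σ = (κ + ρ₀ * s ^ 2) * σ ^ 2 / (s * σ) := by
      field_simp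
    rw [h4, le_div_iff₀ (by positivity)]
    linarith
  · have := hmax θ₀ hL.norm_eq
    linarith

/-- The sample with the signs of the components along `θ₀` multiplied by `±1`. -/
noncomputable def signFlip (θ₀ : EuclideanSpace ℝ (Fin p)) (e : Fin n → Bool)
    (W : Fin n → EuclideanSpace ℝ (Fin p)) (i : Fin n) : EuclideanSpace ℝ (Fin p) :=
  W i + ((boolSign (e i) - 1) * ⟪θ₀, W i⟫) • θ₀

lemma inner_signFlip_of_orthogonal {e : Fin n → Bool} {W : Fin n → EuclideanSpace ℝ (Fin p)}
    {f : EuclideanSpace ℝ (Fin p)} (hf : ⟪θ₀, f⟫ = 0) (i : Fin n) :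
    ⟪signFlip θ₀ e W i, f⟫ = ⟪W i, f⟫ := by
  rw [signFlip, inner_add_left, inner_smul_left, hf, mul_zero, add_zero]

lemma inner_signFlip_self (hθ : ‖θ₀‖ = 1) (e : Fin n → Bool) (W : Fin n → EuclideanSpace ℝ (Fin p))
    (i : Fin n) : ⟪signFlip θ₀ e W i, θ₀⟫ = boolSign (e i) * ⟪W i, θ₀⟫ := by
  rw [signFlip, inner_add_left, inner_smul_left, real_inner_self_eq_norm_sq, hθ,
    real_inner_comm θ₀]
  simp; ring

lemma linForm_signFlip (hL : IsRoot L θ₀ σ) (e : Fin n → Bool)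
    (W : Fin n → EuclideanSpace ℝ (Fin p)) {v : EuclideanSpace ℝ (Fin p)} (hv : ⟪θ₀, v⟫ = 0) :
    linForm L (signFlip θ₀ e W) v = linForm L W v := by
  rw [linForm_eq, linForm_eq]
  have h : ⟪θ₀, mulE L v⟫ = 0 := by rw [hL.inner_mulE_eq, hv, mul_zero]
  simp_rw [inner_signFlip_of_orthogonal h]

lemma continuous_mulE (A : Matrix (Fin p) (Fin p) ℝ) : Continuous (mulE A) := by
  unfold mulE
  fun_prop

lemma continuous_linForm (L : Matrix (Fin p) (Fin p) ℝ) (W : Fin n → EuclideanSpace ℝ (Fin p)) :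
    Continuous (linForm L W) := by
  have := continuous_mulE L
  have : linForm L W = fun x => (1 - (p + 2) * (p : ℝ)⁻¹) * ‖mulE L x‖ ^ 2 +
        (p + 2) * ((n : ℝ)⁻¹ * ∑ i, ⟪W i, mulE L x⟫ ^ 2) := funext (linForm_eq L W)
  rw [this]
  fun_prop

lemma isCompact_orthogonal_sphere (θ₀ : EuclideanSpace ℝ (Fin p)) :
    IsCompact {v : EuclideanSpace ℝ (Fin p) | ‖v‖ = 1 ∧ ⟪θ₀, v⟫ = 0} := by
  have h1 : {v : EuclideanSpace ℝ (Fin p) | ‖v‖ = 1 ∧ ⟪θ₀, v⟫ = 0} =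
      Metric.sphere 0 1 ∩ {v | ⟪θ₀, v⟫ = 0} := by ext; simp
  rw [h1]
  exact (isCompact_sphere 0 1).inter_right (isClosed_eq (by fun_prop) continuous_const)

/-- The moment condition for `C = outer f`, tested at `θ₀`; for orthogonal vectors the uniform value
is `‖f‖² / (p (p + 2))`. -/
lemma IsBalanced.le_sum_sq [NeZero p] {δ : ℝ} {W : Fin n → EuclideanSpace ℝ (Fin p)}
    (h : IsBalanced δ W) (hθ : ‖θ₀‖ = 1) {f : EuclideanSpace ℝ (Fin p)} (hf : ⟪θ₀, f⟫ = 0) :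
    (((p : ℝ) * (p + 2))⁻¹ - δ) * ‖f‖ ^ 2 ≤ (n : ℝ)⁻¹ * ∑ i, (⟪W i, θ₀⟫ * ⟪W i, f⟫) ^ 2 := by
  have h1 := h.moment (outer f)
  have h2 := (abs_inner_mulE_le _ θ₀ θ₀).trans
    (mul_le_mul_of_nonneg_right (mul_le_mul_of_nonneg_right h1 (norm_nonneg θ₀)) (norm_nonneg θ₀))
  rw [hθ, mul_one, mul_one, norm_outer] at h2
  have h3 : ⟪θ₀, mulE (momentMap W (outer f)) θ₀⟫ =
      (n : ℝ)⁻¹ * ∑ i, (⟪W i, θ₀⟫ * ⟪W i, f⟫) ^ 2 := by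
    rw [momentMap, outerAvg_mulE, inner_smul_right, inner_sum]
    congr 1
    refine Finset.sum_congr rfl fun i _ => ?_
    rw [inner_smul_right, outer_mulE, inner_smul_right, real_inner_comm (W i) θ₀,
      real_inner_comm (W i) f]
    ring
  have h4 : ⟪θ₀, mulE (((p : ℝ) * (p + 2))⁻¹ • (outer f + (outer f)ᵀ + (outer f).trace • 1)) θ₀⟫ =
      ((p : ℝ) * (p + 2))⁻¹ * ‖f‖ ^ 2 := by
    rw [smul_mulE, inner_smul_right, transpose_outer, trace_outer]
    simp only [add_mulE, outer_mulE, smul_mulE, one_mulE, inner_add_right, inner_smul_right, hf,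
      real_inner_self_eq_norm_sq, hθ]
    ring
  rw [sub_mulE, inner_sub_right, h3, h4] at h2
  linarith [(abs_le.1 h2).1]

/-- For a fixed sample, few choices of signs lead to a balanced sample whose linearised quadratic
form is almost maximised on the orthogonal complement of `θ₀`. -/
lemma card_isNearMax_le [NeZero p] (hn : 0 < n) (hL : IsRoot L θ₀ σ) {δ κ s r : ℝ} (hκ : 0 ≤ κ)
    (hκ4 : κ ≤ 1 / 4) (hs : 0 < s) (hs1 : s ≤ 1) (hδ : p * (p + 2) * δ ≤ 1 / 4) (hr : 1 ≤ r)
    (hr' : n * (κ / s + p * (p + 2) * δ * s) ≤ r)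
    {W : Fin n → EuclideanSpace ℝ (Fin p)} (T : Finset (Fin n → Bool))
    (hT : ∀ e ∈ T, IsBalanced δ (signFlip θ₀ e W) ∧
      IsNearMax L θ₀ (κ * σ ^ 2) (signFlip θ₀ e W)) :
    (T.card : ℝ) ≤ 2 ^ n * (64 * p * (p + 2) * r / √n) := by
  have hσ := hL.pos
  have hp1 : (1 : ℝ) ≤ p := by exact_mod_cast Nat.one_le_iff_ne_zero.2 (NeZero.ne p)
  have hn' : 0 < (n : ℝ) := by exact_mod_cast hn
  rcases T.eq_empty_or_nonempty with rfl | ⟨e₀, he₀⟩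
  · simp; positivity
  -- A near-maximiser for one sign pattern shows that the orthogonal sphere is nonempty, which fails
  -- when `p = 1`.
  obtain ⟨hb₀, v₀, hv₀, -⟩ := hT e₀ he₀
  have hδ0 := hb₀.nonneg
  -- On `θ₀^⊥` the form does not depend on the signs, so a single maximiser `v` there serves every
  -- `e ∈ T`. This makes the coefficients `a` independent of `e`.
  obtain ⟨v, ⟨hv1, hv2⟩, hvmax⟩ := (isCompact_orthogonal_sphere θ₀).exists_isMaxOn ⟨v₀, hv₀⟩
    (continuous_linForm L W).continuousOn
  set f := mulE L v with hf
  have hθf : ⟪θ₀, f⟫ = 0 := by rw [hf, hL.inner_mulE_eq, hv2, mul_zero]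
  have hmax : ∀ e ∈ T, ∀ x, ‖x‖ = 1 →
      linForm L (signFlip θ₀ e W) x ≤ linForm L (signFlip θ₀ e W) v + κ * σ ^ 2 := by
    intro e he x hx
    obtain ⟨-, w, hw, hwmax⟩ := hT e he
    refine (hwmax x hx).trans ?_
    rw [linForm_signFlip hL e W hv2, linForm_signFlip hL e W hw.2]
    have : linForm L W w ≤ linForm L W v := hvmax hw
    linarith
  set a : Fin n → ℝ := fun i => ⟪W i, θ₀⟫ * ⟪W i, f⟫ / σ with ha
  have hfn : ‖f‖ ≤ σ := by have := hL.norm_le v; rwa [hv1, mul_one] at this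
  have hbd := fun e he => IsNearMax.bounds hL
    (norm_linearised_sub_one_le (hT e he).1) hκ hs hs1 hv1 hv2 (hmax e he)
  have hsum : ∀ e ∈ T, |∑ i, boolSign (e i) * a i| ≤ r := by
    intro e he
    have h1 := (hbd e he).1
    have h2 : ∀ i, ⟪signFlip θ₀ e W i, θ₀⟫ * ⟪signFlip θ₀ e W i, mulE L v⟫ =
        σ * (boolSign (e i) * a i) := fun i => by
      rw [inner_signFlip_self hL.norm_eq, inner_signFlip_of_orthogonal hθf, ha]
      field_simp
    simp_rw [h2] at h1
    rw [← Finset.mul_sum, abs_mul, abs_mul, abs_of_pos hσ, abs_of_pos (inv_pos.2 hn')] at h1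
    set X := |∑ i, boolSign (e i) * a i|
    have h3 : (p + 2) * ((n : ℝ)⁻¹ * X) ≤ κ / s + p * (p + 2) * δ * s := by
      refine le_of_mul_le_mul_right ?_ hσ
      linarith
    have h4 : (n : ℝ)⁻¹ * X ≤ κ / s + p * (p + 2) * δ * s := by
      have : 0 ≤ (n : ℝ)⁻¹ * X := by positivity
      nlinarith
    rw [inv_mul_le_iff₀ hn'] at h4
    exact h4.trans hr'
  -- Bounds for the coefficients are read off from the flipped sample, as only that one is assumed
  -- balanced; they involve the signs only through absolute values and squares.
  have hW0 : ∀ i, ‖signFlip θ₀ e₀ W i‖ = 1 := hb₀.norm_eq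
  have habs : ∀ i, |⟪W i, θ₀⟫| ≤ 1 ∧ |⟪W i, f⟫| ≤ σ := fun i => by
    constructor
    · have h1 := abs_real_inner_le_norm (signFlip θ₀ e₀ W i) θ₀
      rw [inner_signFlip_self hL.norm_eq, hW0, hL.norm_eq, one_mul, abs_mul] at h1
      have h2 : |boolSign (e₀ i)| = 1 := by cases e₀ i <;> simp [boolSign]
      rwa [h2, one_mul] at h1
    · have h1 := abs_real_inner_le_norm (signFlip θ₀ e₀ W i) f
      rw [inner_signFlip_of_orthogonal hθf, hW0, one_mul] at h1
      exact h1.trans hfn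
  have ha1 : ∀ i, |a i| ≤ 1 := fun i => by
    simp only [ha]
    rw [abs_div, abs_mul, abs_of_pos hσ, div_le_one hσ]
    calc _ ≤ 1 * σ := mul_le_mul (habs i).1 (habs i).2 (abs_nonneg _) zero_le_one
      _ = σ := one_mul σ
  have hA : (n : ℝ) / (16 * (p * (p + 2))) ≤ ∑ i, a i ^ 2 := by
    have h1 := hb₀.le_sum_sq hL.norm_eq hθf
    have h2 : ∀ i, (⟪signFlip θ₀ e₀ W i, θ₀⟫ * ⟪signFlip θ₀ e₀ W i, f⟫) ^ 2 = σ ^ 2 * a i ^ 2 :=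
      fun i => by
        rw [inner_signFlip_self hL.norm_eq, inner_signFlip_of_orthogonal hθf, ha, mul_pow, mul_pow,
          boolSign_sq]
        field_simp
    simp_rw [h2] at h1
    rw [← Finset.mul_sum] at h1
    have h3 := (hbd e₀ he₀).2
    rw [← hf] at h3
    have h4 : σ ^ 2 / 4 ≤ ‖f‖ ^ 2 := by nlinarith [sq_nonneg σ, sq_nonneg ‖f‖]
    set P := (p : ℝ) * (p + 2) with hP
    have hP0 : 0 < P := by positivity
    have h5 : P⁻¹ * (3 / 4) ≤ P⁻¹ - δ := by
      have : P⁻¹ * (P * δ) ≤ P⁻¹ * (1 / 4) := by gcongr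
      rw [inv_mul_cancel_left₀ hP0.ne'] at this
      linarith
    have h6 : P⁻¹ * (3 / 4) * (σ ^ 2 / 4) ≤ (n : ℝ)⁻¹ * (σ ^ 2 * ∑ i, a i ^ 2) :=
      (mul_le_mul h5 h4 (by positivity) ((by positivity : 0 ≤ P⁻¹ * (3 / 4)).trans h5)).trans h1
    have h7 : P⁻¹ * (3 / 16) ≤ (n : ℝ)⁻¹ * ∑ i, a i ^ 2 := by
      refine le_of_mul_le_mul_left ?_ (by positivity : 0 < σ ^ 2)
      linarith
    rw [le_inv_mul_iff₀ hn'] at h7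
    refine le_trans ?_ h7
    rw [div_eq_mul_inv, mul_inv]
    have : 0 < (n : ℝ) * P⁻¹ := by positivity
    linarith
  have hA0 : 0 < ∑ i, a i ^ 2 := lt_of_lt_of_le (by positivity) hA
  have hcard := card_abs_sum_le hr ha1 hA0
  have hsub : T ⊆ (Finset.univ : Finset (Fin n → Bool)).filter
      fun e => |∑ i, boolSign (e i) * a i| ≤ r := fun e he => by
    simpa using hsum e he
  refine (Nat.cast_le.2 (Finset.card_le_card hsub)).trans (hcard.trans ?_)
  refine mul_le_mul_of_nonneg_left ?_ (by positivity)
  have h1 : √n / (4 * (p * (p + 2))) ≤ √(∑ i, a i ^ 2) := by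
    refine Real.le_sqrt_of_sq_le (le_trans ?_ hA)
    rw [div_pow, Real.sq_sqrt hn'.le]
    have : (1 : ℝ) ≤ p * (p + 2) := by nlinarith
    gcongr
    nlinarith
  calc 16 * r / √(∑ i, a i ^ 2) ≤ 16 * r / (√n / (4 * (p * (p + 2)))) := by gcongr
    _ = _ := by field_simp; ring

end NearMaximum

end SignPCA

namespace SignPCA

/-! ### Angular Gaussian laws under linear maps -/

section Law

open Matrix RealInnerProductSpace

variable {p : ℕ}

/-- The part of the cone over `B` where the homogeneous quadratic form with restriction `q` to the
sphere is less than `1`. -/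
def truncatedCone (B : Set (Sph p)) (q : Sph p → ℝ) : Set (EuclideanSpace ℝ (Fin p)) :=
  {x | ∃ u ∈ B, ∃ r : ℝ, 0 < r ∧ x = r • u.1 ∧ r ^ 2 * q u < 1}

lemma lt_rpow_neg_half_iff {q r : ℝ} (hq : 0 < q) (hr : 0 < r) :
    r < q ^ (-(1 / 2) : ℝ) ↔ r ^ 2 * q < 1 := by
  have hs : 0 < √q := Real.sqrt_pos.2 hq
  rw [Real.rpow_neg hq.le, ← Real.sqrt_eq_rpow, lt_inv_comm₀ hr hs, Real.sqrt_lt' (inv_pos.2 hr),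
    inv_pow, lt_inv_comm₀ hq (by positivity), ← one_div, lt_div_iff₀ hq]

/-- Polar coordinates: the radius runs up to `q u ^ (-1/2)`, and integrating `r ^ (p - 1)` gives `q
u ^ (-p/2) / p`. -/
lemma volume_truncatedCone [NeZero p] {B : Set (Sph p)} (hB : MeasurableSet B) {q : Sph p → ℝ}
    (hq : Continuous q) (hq0 : ∀ u, 0 < q u) :
    volume (truncatedCone B q) =
      ∫⁻ u in B, ENNReal.ofReal (q u ^ (-(p : ℝ) / 2) / p)
        ∂(volume : Measure (EuclideanSpace ℝ (Fin p))).toSphere := by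
  have hp : 0 < p := Nat.pos_of_ne_zero (NeZero.ne p)
  set R : Sph p → Set.Ioi (0 : ℝ) := fun u => ⟨q u ^ (-(1 / 2) : ℝ), Real.rpow_pos_of_pos (hq0 u) _⟩
    with hR
  have hRc : Continuous R :=
    Continuous.subtype_mk (hq.rpow_const fun u => Or.inl (hq0 u).ne') _
  set S : Set (Sph p × Set.Ioi (0 : ℝ)) := {z | z.1 ∈ B ∧ z.2 < R z.1} with hS
  have hSm : MeasurableSet S :=
    (measurable_fst hB).inter (measurableSet_lt (measurable_subtype_coe.comp measurable_snd)
      (measurable_subtype_coe.comp (hRc.measurable.comp measurable_fst)))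
  have hmp := (volume : Measure (EuclideanSpace ℝ (Fin p))).measurePreserving_homeomorphUnitSphereProd
  have h1 := hmp.measure_preimage hSm.nullMeasurableSet
  rw [comap_subtype_coe_apply (measurableSet_singleton _).compl] at h1
  have h2 : (Subtype.val '' (homeomorphUnitSphereProd (EuclideanSpace ℝ (Fin p)) ⁻¹' S)) =
      truncatedCone B q := by
    rw [← Homeomorph.image_symm, Set.image_image]
    ext x
    constructor
    · rintro ⟨⟨u, r⟩, ⟨hu, hr⟩, rfl⟩
      refine ⟨u, hu, r.1, r.2, by simp, ?_⟩
      exact (lt_rpow_neg_half_iff (hq0 u) r.2).1 hr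
    · rintro ⟨u, hu, r, hr, rfl, hq1⟩
      exact ⟨(u, ⟨r, hr⟩), ⟨hu, (lt_rpow_neg_half_iff (hq0 u) hr).2 hq1⟩, by simp⟩
  rw [← h2, h1, Measure.prod_apply hSm, ← lintegral_indicator hB]
  refine lintegral_congr fun u => ?_
  by_cases hu : u ∈ B
  · rw [Set.indicator_of_mem hu]
    have h3 : Prod.mk u ⁻¹' S = Set.Iio (R u) := by ext r; simp [hS, hu]
    rw [h3, Measure.volumeIoiPow_apply_Iio, finrank_euclideanSpace, Fintype.card_fin]
    congr 1
    rw [Nat.sub_add_cancel hp, Nat.cast_sub hp]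
    simp only [hR, Nat.cast_one, sub_add_cancel]
    rw [← Real.rpow_mul_natCast (hq0 u).le]
    congr 2
    ring
  · rw [Set.indicator_of_notMem hu]
    have h3 : Prod.mk u ⁻¹' S = ∅ := by ext r; simp [hS, hu]
    rw [h3, measure_empty]

lemma sph_norm (u : Sph p) : ‖u.1‖ = 1 := by simp

lemma sph_ne_zero (u : Sph p) : u.1 ≠ 0 := fun h => by simpa [h] using sph_norm u

/-- Expressing the law by Lebesgue measure of cones replaces a change of variables on the sphere by
the determinant formula for linear maps. -/
lemma angularGaussian_apply [NeZero p] {V : Matrix (Fin p) (Fin p) ℝ} (hV : V.PosDef)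
    {B : Set (Sph p)} (hB : MeasurableSet B) :
    angularGaussian V B = ENNReal.ofReal (p * (Real.Gamma ((p : ℝ) / 2) /
      (2 * Real.pi ^ ((p : ℝ) / 2) * V.det ^ ((1 : ℝ) / 2)))) *
        volume (truncatedCone B fun u => ⟪u.1, mulE V⁻¹ u.1⟫) := by
  have hp : 0 < (p : ℝ) := by exact_mod_cast Nat.pos_of_ne_zero (NeZero.ne p)
  have hq : Continuous fun u : Sph p => ⟪u.1, mulE V⁻¹ u.1⟫ := by
    have := continuous_mulE V⁻¹
    fun_prop
  have hq0 : ∀ u : Sph p, 0 < ⟪u.1, mulE V⁻¹ u.1⟫ := fun u =>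
    (posDef_iff_inner.1 hV.inv).2 _ (sph_ne_zero u)
  have hdet := hV.det_pos
  have hK : 0 ≤ Real.Gamma ((p : ℝ) / 2) /
      (2 * Real.pi ^ ((p : ℝ) / 2) * V.det ^ ((1 : ℝ) / 2)) := by
    have := Real.Gamma_pos_of_pos (by positivity : 0 < (p : ℝ) / 2)
    positivity
  rw [volume_truncatedCone hB hq hq0, angularGaussian, withDensity_apply _ hB,
    ← lintegral_const_mul']
  · refine lintegral_congr fun u => ?_
    rw [← ENNReal.ofReal_mul (by positivity)]
    congr 1
    have : u.1.ofLp ⬝ᵥ V⁻¹.mulVec u.1.ofLp = ⟪u.1, mulE V⁻¹ u.1⟫ := by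
      rw [inner_eq_dotProduct]; rfl
    rw [this]
    field_simp
  · exact ENNReal.ofReal_ne_top

/-- The direction of `L⁻¹ u`. -/
noncomputable def sphMap (L : Matrix (Fin p) (Fin p) ℝ) (hL : IsUnit L) (u : Sph p) : Sph p :=
  ⟨‖mulE L⁻¹ u.1‖⁻¹ • mulE L⁻¹ u.1, by
    have : mulE L⁻¹ u.1 ≠ 0 := fun h => sph_ne_zero u (by
      have := congrArg (mulE L) h
      rwa [← mul_mulE, Matrix.mul_nonsing_inv _ ((Matrix.isUnit_iff_isUnit_det _).1 hL), one_mulE,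
        mulE_zero] at this)
    rw [mem_sphere_zero_iff_norm, norm_smul, norm_inv, norm_norm,
      inv_mul_cancel₀ (norm_ne_zero_iff.2 this)]⟩

variable {L : Matrix (Fin p) (Fin p) ℝ}

lemma mulE_inv_cancel (hL : IsUnit L) (x : EuclideanSpace ℝ (Fin p)) :
    mulE L (mulE L⁻¹ x) = x := by
  rw [← mul_mulE, Matrix.mul_nonsing_inv _ ((Matrix.isUnit_iff_isUnit_det _).1 hL), one_mulE]

lemma mulE_inv_ne_zero (hL : IsUnit L) {x : EuclideanSpace ℝ (Fin p)} (hx : x ≠ 0) :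
    mulE L⁻¹ x ≠ 0 := fun h => hx (by rw [← mulE_inv_cancel hL x, h, mulE_zero])

lemma continuous_sphMap (hL : IsUnit L) : Continuous (sphMap L hL) := by
  have hc : Continuous fun u : Sph p => mulE L⁻¹ u.1 :=
    (continuous_mulE _).comp continuous_subtype_val
  exact Continuous.subtype_mk ((hc.norm.inv₀ fun u =>
    norm_ne_zero_iff.2 (mulE_inv_ne_zero hL (sph_ne_zero u))).smul hc) _

lemma truncatedCone_preimage (hL : IsUnit L) (B : Set (Sph p)) :
    truncatedCone (sphMap L hL ⁻¹' B) (fun u => ‖mulE L⁻¹ u.1‖ ^ 2) =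
      mulE L⁻¹ ⁻¹' truncatedCone B fun _ => 1 := by
  ext x
  constructor
  · rintro ⟨u, hu, r, hr, rfl, h1⟩
    have h0 : 0 < ‖mulE L⁻¹ u.1‖ := norm_pos_iff.2 (mulE_inv_ne_zero hL (sph_ne_zero u))
    refine ⟨sphMap L hL u, hu, r * ‖mulE L⁻¹ u.1‖, by positivity, ?_, ?_⟩
    · rw [mulE_smul, sphMap, smul_smul]; congr 1; field_simp
    · rw [mul_one, mul_pow]; exact h1
  · rintro ⟨u, hu, r, hr, hx, h1⟩
    have hx0 : x ≠ 0 := fun h => by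
      rw [h, mulE_zero] at hx
      exact smul_ne_zero hr.ne' (sph_ne_zero u) hx.symm
    have hn : 0 < ‖x‖ := norm_pos_iff.2 hx0
    have hLx : ‖mulE L⁻¹ x‖ = r := by
      rw [hx, norm_smul, sph_norm, mul_one, Real.norm_of_nonneg hr.le]
    refine ⟨⟨‖x‖⁻¹ • x, by
      rw [mem_sphere_zero_iff_norm, norm_smul, norm_inv, norm_norm, inv_mul_cancel₀ hn.ne']⟩,
      ?_, ‖x‖, hn, ?_, ?_⟩
    · have : sphMap L hL ⟨‖x‖⁻¹ • x, by
          rw [mem_sphere_zero_iff_norm, norm_smul, norm_inv, norm_norm, inv_mul_cancel₀ hn.ne']⟩ =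
          u := by
        apply Subtype.ext
        simp only [sphMap]
        rw [mulE_smul, norm_smul, hLx, hx, norm_inv, norm_norm, smul_smul, smul_smul]
        have : (‖x‖⁻¹ * r)⁻¹ * (‖x‖⁻¹ * r) = 1 := inv_mul_cancel₀ (by positivity)
        rw [mul_assoc, this, one_smul]
      rw [Set.mem_preimage, this]; exact hu
    · simp only; rw [smul_smul, mul_inv_cancel₀ hn.ne', one_smul]
    · simp only
      rw [mulE_smul, norm_smul, hLx, norm_inv, norm_norm]
      rw [mul_one] at h1
      have : ‖x‖ ^ 2 * (‖x‖⁻¹ * r) ^ 2 = r ^ 2 := by field_simp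
      rw [this]; exact h1

lemma volume_preimage_mulE {A : Matrix (Fin p) (Fin p) ℝ} (hA : A.det ≠ 0)
    (s : Set (EuclideanSpace ℝ (Fin p))) :
    volume (mulE A ⁻¹' s) = ENNReal.ofReal |A.det⁻¹| * volume s := by
  have h1 : LinearMap.det (Matrix.toEuclideanLin A) = A.det := by
    rw [show Matrix.toEuclideanLin A = Matrix.toLpLin 2 2 A from rfl, Matrix.toLpLin_eq_toLin,
      LinearMap.det_toLin]
  have h2 : mulE A = Matrix.toEuclideanLin A := by
    funext x; rfl
  rw [h2, Measure.addHaar_preimage_linearMap _ (by rw [h1]; exact hA), h1]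

lemma posDef_mul_transpose (hL : IsUnit L) : (L * Lᵀ).PosDef := by
  refine posDef_iff_inner.2 ⟨by simp, fun x hx => ?_⟩
  have hLt : IsUnit Lᵀ := (Matrix.isUnit_transpose L).2 hL
  rw [mul_mulE, ← transpose_transpose L, ← inner_mulE_left, transpose_transpose,
    real_inner_self_eq_norm_sq]
  have : mulE Lᵀ x ≠ 0 := fun h => hx (by
    have := congrArg (mulE (Lᵀ)⁻¹) h
    rwa [← mul_mulE, Matrix.nonsing_inv_mul _ ((Matrix.isUnit_iff_isUnit_det _).1 hLt), one_mulE,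
        mulE_zero] at this)
  have := norm_pos_iff.2 this
  positivity

/-- For `V = L * Lᵀ` the cone defining the law of `V` is the preimage under `L⁻¹` of the cone with
unit radius. Its volume gains the factor `|L.det|`, which cancels `V.det ^ (1/2)` in the density. -/
lemma measurePreserving_sphMap [NeZero p] (hL : IsUnit L) {V : Matrix (Fin p) (Fin p) ℝ}
    (hV : V = L * Lᵀ) :
    MeasurePreserving (sphMap L hL) (angularGaussian V) (angularGaussian 1) := by
  have hdet := (Matrix.isUnit_iff_isUnit_det _).1 hL
  refine ⟨(continuous_sphMap hL).measurable, Measure.ext fun B hB => ?_⟩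
  have hVpd : V.PosDef := hV ▸ posDef_mul_transpose hL
  rw [Measure.map_apply (continuous_sphMap hL).measurable hB, angularGaussian_apply hVpd
    ((continuous_sphMap hL).measurable hB), angularGaussian_apply Matrix.PosDef.one hB]
  have h1 : (fun u : Sph p => ⟪u.1, mulE V⁻¹ u.1⟫) = fun u => ‖mulE L⁻¹ u.1‖ ^ 2 := by
    funext u
    rw [← real_inner_self_eq_norm_sq, inner_mulE_left, ← mul_mulE, hV, Matrix.mul_inv_rev,
      transpose_nonsing_inv]
  have h2 : (fun u : Sph p => ⟪u.1, mulE (1 : Matrix (Fin p) (Fin p) ℝ)⁻¹ u.1⟫) = fun _ => 1 := by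
    funext u
    rw [inv_one, one_mulE, real_inner_self_eq_norm_sq, sph_norm, one_pow]
  have h3 : V.det ^ ((1 : ℝ) / 2) = |L.det| := by
    rw [hV, det_mul, det_transpose, ← Real.sqrt_eq_rpow, Real.sqrt_mul_self_eq_abs]
  have h4 : (L⁻¹).det = (L.det)⁻¹ := by
    rw [det_nonsing_inv, Ring.inverse_eq_inv']
  have hL0 : L.det ≠ 0 := hdet.ne_zero
  rw [h1, h2, truncatedCone_preimage, volume_preimage_mulE (by rw [h4]; exact inv_ne_zero hL0), h4,
    inv_inv, ← mul_assoc, ← ENNReal.ofReal_mul' (abs_nonneg _), h3, det_one, Real.one_rpow, mul_one]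
  congr 2
  have : |L.det| ≠ 0 := abs_ne_zero.2 hL0
  field_simp

instance isProbabilityMeasure_angularGaussian_one [NeZero p] :
    IsProbabilityMeasure (angularGaussian (1 : Matrix (Fin p) (Fin p) ℝ)) := by
  have hp : 0 < (p : ℝ) := by exact_mod_cast Nat.pos_of_ne_zero (NeZero.ne p)
  have : Nonempty (Fin p) := ⟨0⟩
  constructor
  rw [angularGaussian_apply Matrix.PosDef.one MeasurableSet.univ]
  have h2 : (fun u : Sph p => ⟪u.1, mulE (1 : Matrix (Fin p) (Fin p) ℝ)⁻¹ u.1⟫) = fun _ => 1 := by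
    funext u
    rw [inv_one, one_mulE, real_inner_self_eq_norm_sq, sph_norm, one_pow]
  have h3 : truncatedCone (Set.univ : Set (Sph p)) (fun _ => 1) = Metric.ball 0 1 \ {0} := by
    ext x
    simp only [Set.mem_sdiff, mem_ball_zero_iff, Set.mem_singleton_iff]
    constructor
    · rintro ⟨u, -, r, hr, rfl, h1⟩
      rw [norm_smul, sph_norm, mul_one, Real.norm_of_nonneg hr.le]
      exact ⟨by nlinarith, smul_ne_zero hr.ne' (sph_ne_zero u)⟩
    · rintro ⟨h1, h0⟩
      have hn : 0 < ‖x‖ := norm_pos_iff.2 h0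
      refine ⟨⟨‖x‖⁻¹ • x, by
        rw [mem_sphere_zero_iff_norm, norm_smul, norm_inv, norm_norm, inv_mul_cancel₀ hn.ne']⟩,
        Set.mem_univ _, ‖x‖, hn, ?_, by nlinarith⟩
      simp only; rw [smul_smul, mul_inv_cancel₀ hn.ne', one_smul]
  rw [h2, h3, measure_sdiff_null (measure_singleton _), EuclideanSpace.volume_ball, det_one,
    Real.one_rpow, mul_one, Fintype.card_fin, ENNReal.ofReal_one, one_pow, one_mul,
    ← ENNReal.ofReal_mul (by
      have := Real.Gamma_pos_of_pos (by positivity : 0 < (p : ℝ) / 2)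
      positivity), ← ENNReal.ofReal_one]
  congr 1
  rw [Real.Gamma_add_one (by positivity), Real.sqrt_eq_rpow, ← Real.rpow_mul_natCast Real.pi_pos.le]
  have h5 : (1 : ℝ) / 2 * p = p / 2 := by ring
  have h6 := (Real.Gamma_pos_of_pos (by positivity : 0 < (p : ℝ) / 2)).ne'
  have h7 := (Real.rpow_pos_of_pos Real.pi_pos ((p : ℝ) / 2)).ne'
  rw [h5]
  field_simp

end Law

end SignPCA

namespace SignPCA

/-! ### Fourth moments of the uniform distribution -/

section Moments

open Matrix RealInnerProductSpace

attribute [local instance] Matrix.frobeniusNormedRing Matrix.frobeniusNormedSpace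

variable {p n : ℕ}

/-- The uniform distribution on the sphere is invariant under symmetric orthogonal matrices. -/
lemma exists_measurePreserving_of_mul_self [NeZero p] {R : Matrix (Fin p) (Fin p) ℝ} (hRt : Rᵀ = R)
    (hR : R * R = 1) : ∃ f : Sph p → Sph p,
      MeasurePreserving f (angularGaussian 1) (angularGaussian 1) ∧ ∀ u, (f u).1 = mulE R u.1 := by
  have hu : IsUnit R := IsUnit.of_mul_eq_one R hR
  refine ⟨sphMap R hu, measurePreserving_sphMap hu (by rw [hRt, hR]), fun u => ?_⟩
  have h1 : R⁻¹ = R := Matrix.inv_eq_right_inv hR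
  have h2 : ‖mulE R u.1‖ = 1 := by
    have : ‖mulE R u.1‖ ^ 2 = 1 := by
      rw [← real_inner_self_eq_norm_sq, inner_mulE_left, hRt, ← mul_mulE, hR, one_mulE,
        real_inner_self_eq_norm_sq, sph_norm, one_pow]
    exact (pow_eq_one_iff_of_nonneg (norm_nonneg _) two_ne_zero).1 this
  simp only [sphMap]
  rw [h1, h2, inv_one, one_smul]

/-- The Householder reflection in the hyperplane orthogonal to `v`. -/
noncomputable def householder (v : EuclideanSpace ℝ (Fin p)) : Matrix (Fin p) (Fin p) ℝ :=
  1 - (2 / ‖v‖ ^ 2) • outer v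

lemma householder_mulE (v x : EuclideanSpace ℝ (Fin p)) :
    mulE (householder v) x = x - (2 / ‖v‖ ^ 2 * ⟪v, x⟫) • v := by
  rw [householder, sub_mulE, one_mulE, smul_mulE, outer_mulE, smul_smul]

lemma transpose_householder (v : EuclideanSpace ℝ (Fin p)) : (householder v)ᵀ = householder v := by
  simp [householder, transpose_outer]

lemma householder_mul_self (v : EuclideanSpace ℝ (Fin p)) : householder v * householder v = 1 := by
  refine mulE_ext fun x => ?_
  rw [mul_mulE, one_mulE, householder_mulE, householder_mulE, inner_sub_right, inner_smul_right,
    real_inner_self_eq_norm_sq]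
  by_cases hv : v = 0
  · simp [hv]
  · have := norm_ne_zero_iff.2 hv
    rw [sub_sub, ← add_smul]
    have : 2 / ‖v‖ ^ 2 * ⟪v, x⟫ + 2 / ‖v‖ ^ 2 * (⟪v, x⟫ - 2 / ‖v‖ ^ 2 * ⟪v, x⟫ * ‖v‖ ^ 2) = 0 := by
      field_simp; ring
    rw [this, zero_smul, sub_zero]

lemma householder_sub_mulE {x y : EuclideanSpace ℝ (Fin p)} (h : ‖x‖ = ‖y‖) :
    mulE (householder (x - y)) x = y := by
  rw [householder_mulE]
  by_cases hv : x - y = 0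
  · simp [sub_eq_zero.1 hv]
  · have h0 := norm_ne_zero_iff.2 hv
    have h1 : ‖x - y‖ ^ 2 = 2 * ⟪x - y, x⟫ := by
      rw [norm_sub_sq_real, inner_sub_left, real_inner_self_eq_norm_sq, real_inner_comm, ← h]; ring
    have h2 : 2 / ‖x - y‖ ^ 2 * ⟪x - y, x⟫ = 1 := by
      rw [div_mul_eq_mul_div, ← h1]; exact div_self (by positivity)
    rw [h2, one_smul, sub_sub_cancel]

/-- The fourth moments of the uniform distribution on the sphere. -/
noncomputable def fourthMoment (x y z t : EuclideanSpace ℝ (Fin p)) : ℝ :=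
  ∫ u : Sph p, ⟪u.1, x⟫ * ⟪u.1, y⟫ * ⟪u.1, z⟫ * ⟪u.1, t⟫ ∂angularGaussian 1

lemma integrable_of_continuous [NeZero p] {f : Sph p → ℝ} (hf : Continuous f) :
    Integrable f (angularGaussian 1) :=
  hf.integrable_of_hasCompactSupport (HasCompactSupport.of_compactSpace f)

/-- A Householder reflection maps `x` to `y` and preserves the uniform law. -/
lemma fourthMoment_self_eq [NeZero p] {x y : EuclideanSpace ℝ (Fin p)} (h : ‖x‖ = ‖y‖) :
    fourthMoment x x x x = fourthMoment y y y y := by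
  obtain ⟨f, hf, hfu⟩ := exists_measurePreserving_of_mul_self
    (transpose_householder (x - y)) (householder_mul_self (x - y))
  have h1 := integral_map (μ := angularGaussian (1 : Matrix (Fin p) (Fin p) ℝ)) (φ := f)
    hf.measurable.aemeasurable
    (f := fun u : Sph p => ⟪u.1, x⟫ * ⟪u.1, x⟫ * ⟪u.1, x⟫ * ⟪u.1, x⟫)
    (Continuous.aestronglyMeasurable (by fun_prop))
  rw [hf.map_eq] at h1
  rw [fourthMoment, h1, fourthMoment]
  refine integral_congr_ae (Eventually.of_forall fun u => ?_)
  simp only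
  rw [hfu, inner_mulE_left, transpose_householder, householder_sub_mulE h]

lemma fourthMoment_self [NeZero p] (x : EuclideanSpace ℝ (Fin p)) :
    fourthMoment x x x x = fourthMoment (p := p) (EuclideanSpace.single 0 1)
      (EuclideanSpace.single 0 1) (EuclideanSpace.single 0 1) (EuclideanSpace.single 0 1) *
        ‖x‖ ^ 4 := by
  have h : ‖x‖ = ‖‖x‖ • (EuclideanSpace.single 0 1 : EuclideanSpace ℝ (Fin p))‖ := by
    rw [norm_smul]; simp
  rw [fourthMoment_self_eq h, fourthMoment, fourthMoment, ← integral_mul_const]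
  refine integral_congr_ae (Eventually.of_forall fun u => ?_)
  simp only [inner_smul_right]
  ring

lemma fourthMoment_pair [NeZero p] {c : ℝ}
    (hc : ∀ x : EuclideanSpace ℝ (Fin p), fourthMoment x x x x = 3 * c * ‖x‖ ^ 4)
    (x y : EuclideanSpace ℝ (Fin p)) :
    fourthMoment x x y y = c * (‖x‖ ^ 2 * ‖y‖ ^ 2 + 2 * ⟪x, y⟫ ^ 2) := by
  have h : fourthMoment (x + y) (x + y) (x + y) (x + y) + fourthMoment (x - y) (x - y) (x - y)
      (x - y) = 2 * fourthMoment x x x x + 2 * fourthMoment y y y y + 12 * fourthMoment x x y y := by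
    simp only [fourthMoment]
    rw [← integral_const_mul, ← integral_const_mul, ← integral_const_mul, ← integral_add,
      ← integral_add, ← integral_add]
    · refine integral_congr_ae (Eventually.of_forall fun u => ?_)
      simp only [inner_add_right, inner_sub_right]
      ring
    all_goals exact integrable_of_continuous (by fun_prop)
  have h1 : ∀ v : EuclideanSpace ℝ (Fin p), ‖v‖ ^ 4 = (‖v‖ ^ 2) ^ 2 := fun v => by ring
  simp only [hc, h1] at h
  rw [norm_add_sq_real, norm_sub_sq_real] at h
  linarith

lemma fourthMoment_triple [NeZero p] {c : ℝ}
    (hc : ∀ x : EuclideanSpace ℝ (Fin p), fourthMoment x x x x = 3 * c * ‖x‖ ^ 4)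
    (x y z : EuclideanSpace ℝ (Fin p)) :
    fourthMoment x x y z = c * (‖x‖ ^ 2 * ⟪y, z⟫ + 2 * ⟪x, y⟫ * ⟪x, z⟫) := by
  have h : fourthMoment x x (y + z) (y + z) = fourthMoment x x (y - z) (y - z)
      + 4 * fourthMoment x x y z := by
    simp only [fourthMoment]
    rw [← integral_const_mul, ← integral_add]
    · refine integral_congr_ae (Eventually.of_forall fun u => ?_)
      simp only [inner_add_right, inner_sub_right]
      ring
    all_goals exact integrable_of_continuous (by fun_prop)
  simp only [fourthMoment_pair hc, norm_add_sq_real, norm_sub_sq_real, inner_add_right,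
    inner_sub_right] at h
  linarith

lemma fourthMoment_eq_mul [NeZero p] {c : ℝ}
    (hc : ∀ x : EuclideanSpace ℝ (Fin p), fourthMoment x x x x = 3 * c * ‖x‖ ^ 4)
    (x y z t : EuclideanSpace ℝ (Fin p)) :
    fourthMoment x y z t = c * (⟪x, y⟫ * ⟪z, t⟫ + ⟪x, z⟫ * ⟪y, t⟫ + ⟪x, t⟫ * ⟪y, z⟫) := by
  have h : fourthMoment (x + y) (x + y) z t = fourthMoment (x - y) (x - y) z t
      + 4 * fourthMoment x y z t := by
    simp only [fourthMoment]
    rw [← integral_const_mul, ← integral_add]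
    · refine integral_congr_ae (Eventually.of_forall fun u => ?_)
      simp only [inner_add_right, inner_sub_right]
      ring
    all_goals exact integrable_of_continuous (by fun_prop)
  simp only [fourthMoment_triple hc, norm_add_sq_real, norm_sub_sq_real, inner_add_left,
    inner_sub_left] at h
  linarith

lemma inner_single_one (u : EuclideanSpace ℝ (Fin p)) (a : Fin p) :
    ⟪u, EuclideanSpace.single a (1 : ℝ)⟫ = u a := by
  simp [EuclideanSpace.inner_single_right]

/-- Rotation invariance gives `fourthMoment x x x x = 3 * c * ‖x‖ ^ 4`, and polarisation then
determines all fourth moments in terms of `c`. -/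
lemma fourthMoment_eq [NeZero p] (x y z t : EuclideanSpace ℝ (Fin p)) :
    fourthMoment x y z t =
      ((p : ℝ) * (p + 2))⁻¹ * (⟪x, y⟫ * ⟪z, t⟫ + ⟪x, z⟫ * ⟪y, t⟫ + ⟪x, t⟫ * ⟪y, z⟫) := by
  have hp : 0 < (p : ℝ) := by exact_mod_cast Nat.pos_of_ne_zero (NeZero.ne p)
  obtain ⟨c, hc⟩ : ∃ c : ℝ, ∀ x : EuclideanSpace ℝ (Fin p),
      fourthMoment x x x x = 3 * c * ‖x‖ ^ 4 :=
    ⟨fourthMoment (p := p) (EuclideanSpace.single 0 1)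
      (EuclideanSpace.single 0 1) (EuclideanSpace.single 0 1) (EuclideanSpace.single 0 1) / 3,
      fun x => by rw [fourthMoment_self]; ring⟩
  -- The mean of `‖u‖ ^ 4 = 1`, which yields `c * (p ^ 2 + 2 * p) = 1`.
  have h1 : ∑ a : Fin p, ∑ b : Fin p, fourthMoment (p := p) (EuclideanSpace.single a 1)
      (EuclideanSpace.single a 1) (EuclideanSpace.single b 1) (EuclideanSpace.single b 1) = 1 := by
    simp only [fourthMoment, inner_single_one]
    have hint : ∀ a b : Fin p, Integrable (fun u : Sph p => u.1 a * u.1 a * u.1 b * u.1 b)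
        (angularGaussian 1) := fun a b => integrable_of_continuous (by fun_prop)
    have h2 : ∀ a : Fin p, ∑ b : Fin p, ∫ u : Sph p, u.1 a * u.1 a * u.1 b * u.1 b
        ∂angularGaussian 1 = ∫ u : Sph p, ∑ b, u.1 a * u.1 a * u.1 b * u.1 b ∂angularGaussian 1 :=
      fun a => (integral_finsetSum _ fun b _ => hint a b).symm
    simp_rw [h2]
    rw [← integral_finsetSum _ fun a _ => integrable_finsetSum _ fun b _ => hint a b]
    have : ∀ u : Sph p, ∑ a, ∑ b, u.1 a * u.1 a * u.1 b * u.1 b = 1 := fun u => by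
      have h := sph_norm u
      have h' : ∑ a, u.1 a * u.1 a = 1 := by
        have := EuclideanSpace.real_norm_sq_eq u.1
        rw [h, one_pow] at this
        simp_rw [← sq]; exact this.symm
      simp_rw [mul_assoc (_ * _), ← Finset.mul_sum, h', mul_one, h']
    simp [this]
  simp only [fourthMoment_pair hc, inner_single_one] at h1
  have h2 : ∑ a : Fin p, ∑ b : Fin p,
      (EuclideanSpace.single a (1 : ℝ) : EuclideanSpace ℝ (Fin p)) b ^ 2 = p := by
    simp [PiLp.single_apply]
  simp only [PiLp.norm_single, norm_one, one_pow, mul_one, ← Finset.mul_sum,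
    Finset.sum_add_distrib, h2] at h1
  have h3 : c = ((p : ℝ) * (p + 2))⁻¹ := by
    simp at h1
    field_simp
    linarith
  rw [fourthMoment_eq_mul hc, h3]

end Moments

end SignPCA

namespace SignPCA

/-! ### Uniform samples are balanced with high probability -/

section Concentration

open Matrix RealInnerProductSpace

attribute [local instance] Matrix.frobeniusNormedRing Matrix.frobeniusNormedSpace

variable {p n : ℕ}

/-- The law of a sample of size `n` from the uniform distribution on the sphere. -/
noncomputable abbrev uniformSample (p n : ℕ) : Measure (Fin n → Sph p) :=
  sampleLaw n (1 : Matrix (Fin p) (Fin p) ℝ)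

instance isProbabilityMeasure_uniformSample [NeZero p] :
    IsProbabilityMeasure (uniformSample p n) := by
  unfold uniformSample sampleLaw; infer_instance

lemma uniformSample_deviation_le [NeZero p] (hn : 0 < n) {f : Sph p → ℝ} (hf : Continuous f)
    (hf1 : ∀ u, |f u| ≤ 1) {M : ℝ} (hM : 0 < M) :
    uniformSample p n {U | M / √n ≤ |(n : ℝ)⁻¹ * ∑ i, f (U i) - ∫ u, f u ∂angularGaussian 1|} ≤
      ENNReal.ofReal (1 / M ^ 2) := by
  have hn' : (0 : ℝ) < n := by exact_mod_cast hn
  have hs : 0 < √(n : ℝ) := Real.sqrt_pos.2 hn'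
  have hmem : MemLp f 2 (angularGaussian 1) :=
    MemLp.of_bound hf.aestronglyMeasurable 1 (Eventually.of_forall hf1)
  set X : (Fin n → Sph p) → ℝ := ∑ i, fun U => f (U i) with hX
  have hXm : MemLp X 2 (uniformSample p n) :=
    memLp_finsetSum' _ fun i _ => hmem.comp_measurePreserving
      (measurePreserving_eval (fun _ : Fin n => angularGaussian (1 : Matrix (Fin p) (Fin p) ℝ)) i)
  have hmean : ∫ U, X U ∂uniformSample p n = n * ∫ u, f u ∂angularGaussian 1 := by
    simp only [hX, Finset.sum_apply]
    rw [integral_finsetSum]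
    · have : ∀ i : Fin n, ∫ U, f (U i) ∂uniformSample p n = ∫ u, f u ∂angularGaussian 1 :=
        fun i => integral_comp_eval hf.aestronglyMeasurable
      simp [this]
    · exact fun i _ => (hmem.comp_measurePreserving (measurePreserving_eval (fun _ : Fin n =>
        angularGaussian (1 : Matrix (Fin p) (Fin p) ℝ)) i)).integrable one_le_two
  have hvar : ProbabilityTheory.variance X (uniformSample p n) ≤ n := by
    rw [hX, uniformSample, sampleLaw, ProbabilityTheory.variance_sum_pi fun _ => hmem]
    calc _ ≤ ∑ _ : Fin n, (1 : ℝ) := Finset.sum_le_sum fun i _ => by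
          have := ProbabilityTheory.variance_le_sq_of_bounded (a := -1) (b := 1)
            (Eventually.of_forall fun u => Set.mem_Icc.2 (abs_le.1 (hf1 u))) hf.aemeasurable
            (μ := angularGaussian (1 : Matrix (Fin p) (Fin p) ℝ))
          norm_num at this
          exact this
      _ = n := by simp
  have hcheb := ProbabilityTheory.meas_ge_le_variance_div_sq hXm (c := M * √n) (by positivity)
  refine (measure_mono fun U hU => ?_).trans (hcheb.trans (ENNReal.ofReal_le_ofReal ?_))
  · simp only [Set.mem_ofPred_eq] at hU ⊢
    rw [hmean]
    have h1 : X U - n * ∫ u, f u ∂angularGaussian 1 =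
        n * ((n : ℝ)⁻¹ * ∑ i, f (U i) - ∫ u, f u ∂angularGaussian 1) := by
      simp only [hX, Finset.sum_apply]; field_simp
    rw [h1, abs_mul, abs_of_pos hn']
    calc M * √n = n * (M / √n) := by
          field_simp; rw [Real.sq_sqrt hn'.le]
      _ ≤ _ := by gcongr
  · rw [mul_pow, Real.sq_sqrt hn'.le, div_le_div_iff₀ (by positivity) (by positivity), one_mul]
    nlinarith [sq_nonneg M]

lemma momentMap_apply (W : Fin n → EuclideanSpace ℝ (Fin p)) (C : Matrix (Fin p) (Fin p) ℝ)
    (a b : Fin p) : momentMap W C a b =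
      ∑ c, ∑ d, C c d * ((n : ℝ)⁻¹ * ∑ i, W i c * W i d * W i a * W i b) := by
  have h : ∀ i, ⟪W i, mulE C (W i)⟫ = ∑ c, ∑ d, C c d * (W i c * W i d) := fun i => by
    rw [inner_eq_dotProduct]
    simp only [dotProduct, mulE, mulVec, Finset.mul_sum]
    exact Finset.sum_congr rfl fun c _ => Finset.sum_congr rfl fun d _ => by ring
  simp only [momentMap, outerAvg, h, Matrix.smul_apply, Matrix.sum_apply, outer, vecMulVec_apply, smul_eq_mul,
    Finset.sum_mul, Finset.mul_sum]
  refine Finset.sum_comm.trans (Finset.sum_congr rfl fun c _ => Finset.sum_comm.trans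
    (Finset.sum_congr rfl fun d _ => Finset.sum_congr rfl fun i _ => by ring))

lemma norm_le_of_forall_abs_le {A : Matrix (Fin p) (Fin p) ℝ} {b : ℝ} (hb : 0 ≤ b)
    (h : ∀ i j, |A i j| ≤ b) : ‖A‖ ≤ p * b := by
  refine abs_le_of_sq_le_sq' ?_ (by positivity) |>.2
  rw [frobenius_norm_sq]
  calc _ ≤ ∑ _ : Fin p, ∑ _ : Fin p, b ^ 2 :=
        Finset.sum_le_sum fun i _ => Finset.sum_le_sum fun j _ => sq_le_sq' (abs_le.1 (h i j)).1
          (abs_le.1 (h i j)).2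
    _ = (p * b) ^ 2 := by simp; ring

lemma sum_abs_le_norm (C : Matrix (Fin p) (Fin p) ℝ) : ∑ c, ∑ d, |C c d| ≤ p * ‖C‖ := by
  refine abs_le_of_sq_le_sq' ?_ (by positivity) |>.2
  rw [mul_pow, frobenius_norm_sq, ← Fintype.sum_prod_type', ← Fintype.sum_prod_type']
  have := sq_sum_le_card_mul_sum_sq (s := (Finset.univ : Finset (Fin p × Fin p)))
    (f := fun x => |C x.1 x.2|)
  simp only [sq_abs, Finset.card_univ, Fintype.card_prod, Fintype.card_fin] at this
  push_cast at this
  rwa [← sq] at this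

/-- One factor `p` passes from entries to the Frobenius norm, the other from `∑ |C c d|` to `‖C‖`.
-/
lemma isBalanced_of_entries {W : Fin n → EuclideanSpace ℝ (Fin p)} (hW : ∀ i, ‖W i‖ = 1) {ε : ℝ}
    (hε : 0 ≤ ε) (h : ∀ a b c d : Fin p, |(n : ℝ)⁻¹ * ∑ i, W i c * W i d * W i a * W i b -
      ((p : ℝ) * (p + 2))⁻¹ * ((1 : Matrix (Fin p) (Fin p) ℝ) c d * (1 : Matrix _ _ ℝ) a b +
        (1 : Matrix _ _ ℝ) c a * (1 : Matrix _ _ ℝ) d b +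
        (1 : Matrix _ _ ℝ) c b * (1 : Matrix _ _ ℝ) d a)| ≤ ε) : IsBalanced (p ^ 2 * ε) W := by
  refine ⟨hW, fun C => ?_⟩
  have h1 : ∀ a b, |(momentMap W C - ((p : ℝ) * (p + 2))⁻¹ • (C + Cᵀ + C.trace • 1)) a b| ≤
      p * ‖C‖ * ε := fun a b => by
    have h2 : (((p : ℝ) * (p + 2))⁻¹ • (C + Cᵀ + C.trace • 1)) a b = ∑ c, ∑ d, C c d *
      (((p : ℝ) * (p + 2))⁻¹ * ((1 : Matrix (Fin p) (Fin p) ℝ) c d * (1 : Matrix _ _ ℝ) a b +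
        (1 : Matrix _ _ ℝ) c a * (1 : Matrix _ _ ℝ) d b +
        (1 : Matrix _ _ ℝ) c b * (1 : Matrix _ _ ℝ) d a)) := by
      generalize ((p : ℝ) * (p + 2))⁻¹ = k
      simp only [mul_left_comm _ k, ← Finset.mul_sum, Matrix.smul_apply, Matrix.add_apply,
        transpose_apply, smul_eq_mul, trace, diag]
      congr 1
      simp only [mul_add, Finset.sum_add_distrib]
      by_cases hab : a = b
      · simp [one_apply, hab, eq_comm]
        ring
      · simp [one_apply, hab, eq_comm]
    rw [Matrix.sub_apply, h2, momentMap_apply, ← Finset.sum_sub_distrib]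
    simp_rw [← Finset.sum_sub_distrib, ← mul_sub]
    calc _ ≤ ∑ c, ∑ d, |C c d| * ε := by
          refine (Finset.abs_sum_le_sum_abs _ _).trans (Finset.sum_le_sum fun c _ => ?_)
          refine (Finset.abs_sum_le_sum_abs _ _).trans (Finset.sum_le_sum fun d _ => ?_)
          rw [abs_mul]
          exact mul_le_mul_of_nonneg_left (h a b c d) (abs_nonneg _)
      _ = (∑ c, ∑ d, |C c d|) * ε := by simp_rw [Finset.sum_mul]
      _ ≤ _ := mul_le_mul_of_nonneg_right (sum_abs_le_norm C) hε
  calc _ ≤ p * (p * ‖C‖ * ε) := norm_le_of_forall_abs_le (by positivity) h1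
    _ = _ := by ring

lemma abs_apply_le_one (u : Sph p) (a : Fin p) : |u.1 a| ≤ 1 := by
  have := PiLp.norm_apply_le u.1 a
  rwa [sph_norm, Real.norm_eq_abs] at this

/-- Chebyshev's inequality for each of the `p ^ 4` coordinate monomials, and a union bound. -/
lemma uniformSample_not_isBalanced_le [NeZero p] (hn : 0 < n) {M : ℝ} (hM : 0 < M) :
    uniformSample p n {U | ¬ IsBalanced (p ^ 2 * (M / √n)) fun i => (U i).1} ≤
      ENNReal.ofReal (p ^ 4 / M ^ 2) := by
  set f : Fin p × Fin p × Fin p × Fin p → Sph p → ℝ := fun k u =>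
    u.1 k.2.2.1 * u.1 k.2.2.2 * u.1 k.1 * u.1 k.2.1 with hf
  have hsub : {U | ¬ IsBalanced (p ^ 2 * (M / √n)) fun i => (U i).1} ⊆
      ⋃ k, {U : Fin n → Sph p | M / √n ≤
        |(n : ℝ)⁻¹ * ∑ i, f k (U i) - ∫ u, f k u ∂angularGaussian 1|} := by
    intro U hU
    by_contra hcon
    simp only [Set.mem_iUnion, Set.mem_ofPred_eq, not_exists, not_le] at hcon
    refine hU (isBalanced_of_entries (fun i => sph_norm _) (by positivity) fun a b c d => ?_)
    have h1 := (hcon (a, b, c, d)).le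
    have h2 : ∫ u, f (a, b, c, d) u ∂angularGaussian 1 = ((p : ℝ) * (p + 2))⁻¹ *
        ((1 : Matrix (Fin p) (Fin p) ℝ) c d * (1 : Matrix _ _ ℝ) a b +
        (1 : Matrix _ _ ℝ) c a * (1 : Matrix _ _ ℝ) d b +
        (1 : Matrix _ _ ℝ) c b * (1 : Matrix _ _ ℝ) d a) := by
      have h3 := fourthMoment_eq (p := p) (EuclideanSpace.single c 1) (EuclideanSpace.single d 1)
        (EuclideanSpace.single a 1) (EuclideanSpace.single b 1)
      have h4 : ∀ i j : Fin p, (EuclideanSpace.single i (1 : ℝ) : EuclideanSpace ℝ (Fin p)) j =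
          (1 : Matrix (Fin p) (Fin p) ℝ) i j := fun i j => by
        simp [one_apply, PiLp.single_apply, eq_comm]
      simp only [fourthMoment, inner_single_one, h4] at h3
      rw [← h3]
    rw [h2] at h1
    exact h1
  refine (measure_mono hsub).trans ((measure_iUnion_le _).trans ?_)
  rw [tsum_fintype]
  calc _ ≤ ∑ _ : Fin p × Fin p × Fin p × Fin p, ENNReal.ofReal (1 / M ^ 2) :=
        Finset.sum_le_sum fun k _ => uniformSample_deviation_le hn (by fun_prop) (fun u => by
          simp only [hf, abs_mul]
          have := abs_apply_le_one u
          exact mul_le_one₀ (mul_le_one₀ (mul_le_one₀ (this _) (abs_nonneg _) (this _))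
            (abs_nonneg _) (this _)) (abs_nonneg _) (this _)) hM
    _ = ENNReal.ofReal (p ^ 4 / M ^ 2) := by
      rw [Finset.sum_const, nsmul_eq_mul, ← ENNReal.ofReal_natCast, ← ENNReal.ofReal_mul (Nat.cast_nonneg _)]
      congr 1
      simp only [Finset.card_univ, Fintype.card_prod, Fintype.card_fin]
      push_cast
      ring

end Concentration

end SignPCA

namespace SignPCA

/-! ### Averaging over sign flips -/

section SignFlips

open Matrix RealInnerProductSpace

attribute [local instance] Matrix.frobeniusNormedRing Matrix.frobeniusNormedSpace

variable {p n : ℕ}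

lemma isClosed_isBalanced (δ : ℝ) :
    IsClosed {U : Fin n → Sph p | IsBalanced δ fun i => (U i).1} := by
  have h : {U : Fin n → Sph p | IsBalanced δ fun i => (U i).1} = ⋂ C : Matrix (Fin p) (Fin p) ℝ,
      {U | ‖momentMap (fun i => (U i).1) C -
        ((p : ℝ) * (p + 2))⁻¹ • (C + Cᵀ + C.trace • 1)‖ ≤ δ * ‖C‖} := by
    ext U
    simp only [Set.mem_iInter, Set.mem_ofPred_eq]
    exact ⟨fun h => h.moment, fun h => ⟨fun i => sph_norm _, h⟩⟩
  rw [h]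
  refine isClosed_iInter fun C => isClosed_le ?_ continuous_const
  have hnorm : ∀ A : Matrix (Fin p) (Fin p) ℝ, ‖A‖ = √(∑ i, ∑ j, A i j ^ 2) := fun A => by
    rw [← frobenius_norm_sq, Real.sqrt_sq (norm_nonneg _)]
  simp only [hnorm, Matrix.sub_apply, momentMap_apply]
  fun_prop

/-- Needed for measurability. The set is the projection of a closed set along the compact factor of
candidate points `v`. -/
lemma isClosed_isNearMax (L : Matrix (Fin p) (Fin p) ℝ) (θ₀ : EuclideanSpace ℝ (Fin p)) (κ : ℝ) :
    IsClosed {U : Fin n → Sph p | IsNearMax L θ₀ κ fun i => (U i).1} := by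
  have hK : CompactSpace {v : EuclideanSpace ℝ (Fin p) | ‖v‖ = 1 ∧ ⟪θ₀, v⟫ = 0} :=
    isCompact_iff_compactSpace.1 (isCompact_orthogonal_sphere θ₀)
  have hlin : ∀ x : EuclideanSpace ℝ (Fin p),
      Continuous fun U : Fin n → Sph p => linForm L (fun i => (U i).1) x := fun x => by
    simp only [linForm_eq]; fun_prop
  have hlin' : Continuous fun z : {v : EuclideanSpace ℝ (Fin p) | ‖v‖ = 1 ∧ ⟪θ₀, v⟫ = 0} ×
      (Fin n → Sph p) => linForm L (fun i => (z.2 i).1) z.1.1 := by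
    have hm : Continuous fun z : {v : EuclideanSpace ℝ (Fin p) | ‖v‖ = 1 ∧ ⟪θ₀, v⟫ = 0} ×
      (Fin n → Sph p) => mulE L z.1.1 := (continuous_mulE L).comp (by fun_prop)
    simp only [linForm_eq]; fun_prop
  have h : {U : Fin n → Sph p | IsNearMax L θ₀ κ fun i => (U i).1} = Prod.snd ''
      ⋂ x : EuclideanSpace ℝ (Fin p), {z : {v : EuclideanSpace ℝ (Fin p) | ‖v‖ = 1 ∧ ⟪θ₀, v⟫ = 0} ×
        (Fin n → Sph p) | ‖x‖ = 1 → linForm L (fun i => (z.2 i).1) x ≤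
          linForm L (fun i => (z.2 i).1) z.1.1 + κ} := by
    ext U
    constructor
    · rintro ⟨v, hv, h⟩
      exact ⟨(⟨v, hv⟩, U), Set.mem_iInter.2 h, rfl⟩
    · rintro ⟨⟨v, U⟩, h, rfl⟩
      exact ⟨v.1, v.2, Set.mem_iInter.1 h⟩
  rw [h]
  refine isClosedMap_snd_of_compactSpace _ (isClosed_iInter fun x => ?_)
  by_cases hx : ‖x‖ = 1
  · simp only [hx, true_imp_iff]
    exact isClosed_le ((hlin x).comp continuous_snd) (hlin'.add continuous_const)
  · simp only [hx, false_imp_iff]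
    exact isClosed_univ

/-- Changing the signs of the components along `θ₀` of the observations preserves the law of a
uniform sample. -/
lemma exists_measurePreserving_signFlip [NeZero p] {θ₀ : EuclideanSpace ℝ (Fin p)} (hθ : ‖θ₀‖ = 1)
    (e : Fin n → Bool) : ∃ f : (Fin n → Sph p) → Fin n → Sph p,
      MeasurePreserving f (uniformSample p n) (uniformSample p n) ∧
      ∀ U, (fun i => (f U i).1) = signFlip θ₀ e fun i => (U i).1 := by
  obtain ⟨g, hg, hgu⟩ := exists_measurePreserving_of_mul_self (transpose_householder θ₀)
    (householder_mul_self θ₀)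
  refine ⟨fun U i => (if e i then id else g) (U i), measurePreserving_pi _ _ fun i => ?_,
    fun U => funext fun i => ?_⟩
  · cases e i
    · simpa using hg
    · simpa using MeasurePreserving.id _
  · cases h : e i
    · simp only [h, signFlip, boolSign]
      simp only [Bool.false_eq_true, if_false, hgu, householder_mulE, hθ, sub_eq_add_neg,
        ← neg_smul]
      congr 2
      ring
    · simp [h, signFlip, boolSign]

/-- The event has the same probability under each of the `2 ^ n` sign flips; summing over them under
the integral reduces the claim to the counting bound for a fixed sample. -/
lemma uniformSample_isNearMax_le [NeZero p] (hn : 0 < n) {L : Matrix (Fin p) (Fin p) ℝ}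
    {θ₀ : EuclideanSpace ℝ (Fin p)} {σ δ κ s r : ℝ} (hL : IsRoot L θ₀ σ) (hκ : 0 ≤ κ)
    (hκ4 : κ ≤ 1 / 4) (hs : 0 < s) (hs1 : s ≤ 1) (hδ : p * (p + 2) * δ ≤ 1 / 4) (hr : 1 ≤ r)
    (hr' : n * (κ / s + p * (p + 2) * δ * s) ≤ r) :
    uniformSample p n {U | IsBalanced δ (fun i => (U i).1) ∧
      IsNearMax L θ₀ (κ * σ ^ 2) fun i => (U i).1} ≤
        ENNReal.ofReal (64 * p * (p + 2) * r / √n) := by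
  classical
  set E : Set (Fin n → Sph p) := {U | IsBalanced δ (fun i => (U i).1) ∧
      IsNearMax L θ₀ (κ * σ ^ 2) fun i => (U i).1} with hE
  have hEm : MeasurableSet E :=
    ((isClosed_isBalanced δ).inter (isClosed_isNearMax L θ₀ (κ * σ ^ 2))).measurableSet
  choose f hf hfU using exists_measurePreserving_signFlip (n := n) hL.norm_eq
  set b : ℝ := 64 * p * (p + 2) * r / √n with hb
  have hb0 : 0 ≤ b := by positivity
  have hpt : ∀ U, ∑ e, (f e ⁻¹' E).indicator (1 : (Fin n → Sph p) → ENNReal) U ≤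
      ENNReal.ofReal (2 ^ n * b) := fun U => by
    have h1 := card_isNearMax_le (W := fun i => (U i).1) hn hL hκ hκ4 hs hs1 hδ hr hr'
      (Finset.univ.filter fun e => U ∈ f e ⁻¹' E) (fun e he => by
        have := (Finset.mem_filter.1 he).2
        simp only [Set.mem_preimage, hE, Set.mem_ofPred_eq, hfU] at this
        exact this)
    have h2 : ∑ e, (f e ⁻¹' E).indicator (1 : (Fin n → Sph p) → ENNReal) U =
        ((Finset.univ.filter fun e => U ∈ f e ⁻¹' E).card : ENNReal) := by
      rw [Finset.card_filter, Nat.cast_sum]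
      refine Finset.sum_congr rfl fun e _ => ?_
      by_cases he : U ∈ f e ⁻¹' E <;> simp [he]
    rw [h2, ← ENNReal.ofReal_natCast]
    exact ENNReal.ofReal_le_ofReal h1
  have h1 : (2 ^ n : ENNReal) * uniformSample p n E ≤ ENNReal.ofReal (2 ^ n * b) := by
    calc (2 ^ n : ENNReal) * uniformSample p n E
        = ∑ e : Fin n → Bool, uniformSample p n (f e ⁻¹' E) := by
          simp [fun e => (hf e).measure_preimage hEm.nullMeasurableSet]
      _ = ∫⁻ U, ∑ e, (f e ⁻¹' E).indicator 1 U ∂uniformSample p n := by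
          rw [lintegral_finsetSum _ fun e _ =>
            measurable_one.indicator ((hf e).measurable hEm)]
          exact Finset.sum_congr rfl fun e _ =>
            (lintegral_indicator_one ((hf e).measurable hEm)).symm
      _ ≤ ∫⁻ _, ENNReal.ofReal (2 ^ n * b) ∂uniformSample p n := lintegral_mono hpt
      _ = _ := by simp
  rw [ENNReal.ofReal_mul (by positivity), ENNReal.ofReal_pow (by norm_num)] at h1
  simp only [ENNReal.ofReal_ofNat] at h1
  exact (ENNReal.mul_le_mul_iff_right (by simp) (by simp)).1 h1

end SignFlips

end SignPCA

namespace SignPCA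

/-! ### Tyler's estimator and the statistic on the balanced event -/

section TylerPerturbation

open Matrix RealInnerProductSpace

attribute [local instance] Matrix.frobeniusNormedRing Matrix.frobeniusNormedSpace

variable {p n : ℕ} {L : Matrix (Fin p) (Fin p) ℝ} {θ₀ : EuclideanSpace ℝ (Fin p)} {σ δ : ℝ}
  {W : Fin n → EuclideanSpace ℝ (Fin p)} {U : Fin n → Sph p}

lemma exists_isRoot [NeZero p] {V : Matrix (Fin p) (Fin p) ℝ} (hV : IsNullShape θ₀ V) :
    ∃ L σ, IsRoot L θ₀ σ ∧ V = L * L := by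
  obtain ⟨⟨hpd, -⟩, l, t, ⟨ht, hanti, rfl⟩, rfl, -⟩ := hV
  have hl : ∀ j, 0 < l j := fun j => by
    have h1 := (posDef_iff_inner.1 hpd).2 (t j) (ht.ne_zero j)
    rw [spectralSum_mulE_self ht, inner_smul_right, real_inner_self_eq_norm_sq, ht.1 j] at h1
    simpa using h1
  have hs : ∀ j, 0 < √(l j) := fun j => Real.sqrt_pos.2 (hl j)
  refine ⟨spectralSum (fun j => √(l j)) t, √(l 0), ⟨transpose_spectralSum _ _,
    (posDef_spectralSum ht hs).isUnit, hs 0, ht.1 0, spectralSum_mulE_self ht _ 0, fun x => ?_⟩,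
    mulE_ext fun x => ?_⟩
  · refine abs_le_of_sq_le_sq' ?_ (by positivity) |>.2
    rw [← real_inner_self_eq_norm_sq, inner_mulE_symm (transpose_spectralSum _ _),
      spectralSum_mulE, inner_sum, mul_pow, Real.sq_sqrt (hl 0).le,
      ← Orthonormal.sum_inner_sq ht, Finset.mul_sum]
    refine Finset.sum_le_sum fun j _ => ?_
    rw [← inner_mulE_symm (transpose_spectralSum _ _), spectralSum_mulE_self ht, inner_smul_right,
      inner_smul_left, real_inner_comm (t j) x, RCLike.conj_to_real, ← mul_assoc,
      Real.mul_self_sqrt (hl j).le, mul_assoc, ← sq]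
    exact mul_le_mul_of_nonneg_right (hanti (Fin.zero_le j)) (sq_nonneg _)
  · rw [mul_mulE, spectralSum_mulE _ _ x, spectralSum_mulE _ _ x, mulE_sum]
    refine Finset.sum_congr rfl fun j _ => ?_
    rw [mulE_smul, spectralSum_mulE_self ht, smul_smul, mul_right_comm,
      Real.mul_self_sqrt (hl j).le]

lemma inv_smul_of_posDef {A : Matrix (Fin p) (Fin p) ℝ} (hA : A.PosDef) {c : ℝ} (hc : c ≠ 0) :
    (c • A)⁻¹ = c⁻¹ • A⁻¹ := by
  refine Matrix.inv_eq_left_inv ?_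
  rw [smul_mul_smul_comm, inv_mul_cancel₀ hc,
    Matrix.nonsing_inv_mul _ ((Matrix.isUnit_iff_isUnit_det _).1 hA.isUnit), one_smul]

lemma SolvesTyler.smul {A : Matrix (Fin p) (Fin p) ℝ} (h : SolvesTyler W A) {c : ℝ} (hc : c ≠ 0)
    (hA : A.PosDef) : SolvesTyler W (c • A) := by
  unfold SolvesTyler at h ⊢
  simp only [smul_mulE, inner_smul_right, mul_inv]
  rw [outerAvg_smul, h, inv_smul_of_posDef hA hc, smul_comm]

lemma posDef_trace_pos [NeZero p] {A : Matrix (Fin p) (Fin p) ℝ} (hA : A.PosDef) : 0 < A.trace := by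
  have : Nonempty (Fin p) := ⟨0⟩
  exact hA.trace_pos

lemma mul_inv_conj (hL0 : IsUnit L) {B : Matrix (Fin p) (Fin p) ℝ} (hB : IsUnit B) :
    L * (L * B⁻¹ * L)⁻¹ * L = B := by
  have hd := (Matrix.isUnit_iff_isUnit_det _).1 hL0
  have hBd := (Matrix.isUnit_iff_isUnit_det _).1 hB
  rw [Matrix.mul_inv_rev, Matrix.mul_inv_rev, Matrix.nonsing_inv_nonsing_inv _ hBd,
    ← Matrix.mul_assoc, Matrix.mul_nonsing_inv _ hd, one_mul, Matrix.mul_assoc,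
    Matrix.nonsing_inv_mul _ hd, mul_one]

/-- The fallback value in the definition of `tyler` does not occur for balanced samples: the
solution for `W` transfers to `U` by equivariance and is rescaled to trace `p`. -/
lemma isTyler_tyler [NeZero p] (hn : 0 < n) (hL : IsRoot L θ₀ σ) (hU : IsImageSample L W U)
    (h : IsBalanced δ W) (hδ : δ ≤ (1152 * (p : ℝ) ^ 4)⁻¹) : IsTyler U (tyler U) := by
  have hp : 0 < (p : ℝ) := by exact_mod_cast Nat.pos_of_ne_zero (NeZero.ne p)
  obtain ⟨A, hA, -, hs⟩ := exists_solvesTyler hn h hδ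
  have hY := posDef_mul_mul hL.symm hL.isUnit hA.inv
  set Y := L * A⁻¹ * L with hYdef
  have htr := posDef_trace_pos hY
  have hc : 0 < (p : ℝ) / Y.trace := by positivity
  have hex : ∃ V, IsTyler U V := by
    refine ⟨((p : ℝ) / Y.trace) • Y, ⟨hY.smul hc, ?_⟩, ?_⟩
    · rw [trace_smul, smul_eq_mul, div_mul_cancel₀ _ htr.ne']
    · rw [signCov_eq_iff_solvesTyler hL.symm hL.isUnit hU (hY.smul hc), inv_smul_of_posDef hY hc.ne',
        Matrix.mul_smul, Matrix.smul_mul, hYdef, mul_inv_conj hL.isUnit hA.isUnit]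
      exact hs.smul (inv_ne_zero hc.ne') hA
  unfold tyler
  rw [dif_pos hex]
  exact hex.choose_spec

lemma exists_isPerturbation_tyler [NeZero p] (hn : 0 < n) (hL : IsRoot L θ₀ σ)
    (hU : IsImageSample L W U) (h : IsBalanced δ W) (hδ : δ ≤ (1152 * (p : ℝ) ^ 4)⁻¹)
    {l : Fin p → ℝ} {t : Fin p → EuclideanSpace ℝ (Fin p)}
    (hdecomp : IsSpectralDecomp (tyler U) l t) {g : ℝ} (hg : g = 2 * p * (p + 2)) :
    ∃ a H, 0 < a ∧ IsPerturbation L H (2 * p * g * δ) (fun j => a * l j) t ∧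
      ‖H - linearised W‖ ≤ ((p + 2) * (2 * g ^ 2 + g) + 4 * g ^ 2) * δ ^ 2 := by
  have hp1 : (1 : ℝ) ≤ p := by exact_mod_cast Nat.one_le_iff_ne_zero.2 (NeZero.ne p)
  have hδ0 := h.nonneg
  have hδ1 : 1152 * (p : ℝ) ^ 4 * δ ≤ 1 := by
    have := mul_le_mul_of_nonneg_left hδ (by positivity : 0 ≤ 1152 * (p : ℝ) ^ 4)
    rwa [mul_inv_cancel₀ (by positivity)] at this
  have hpow : ∀ k, k ≤ 4 → (p : ℝ) ^ k ≤ p ^ 4 := fun k hk => pow_le_pow_right₀ hp1 hk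
  have hp4 : ∀ k, k ≤ 4 → 1152 * ((p : ℝ) ^ k * δ) ≤ 1 := fun k hk => by
    have := mul_le_mul_of_nonneg_right (hpow k hk) hδ0
    linarith
  have h4 := hp4 4 le_rfl
  have h3 := hp4 3 (by norm_num)
  have h2 := hp4 2 (by norm_num)
  have h1 := hp4 1 (by norm_num)
  have h0 := hp4 0 (by norm_num)
  have hT := isTyler_tyler hn hL hU h hδ
  have hV := hT.1.posDef
  set V := tyler U with hVdef
  have hB := posDef_mul_mul hL.symm hL.isUnit hV.inv
  have hBs := (signCov_eq_iff_solvesTyler hL.symm hL.isUnit hU hV).1 hT.2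
  set B := L * V⁻¹ * L with hBdef
  have htr := posDef_trace_pos hB
  -- The trace normalisation of `tyler U` is not that of the solution for `W`. Rescaling `B` to
  -- trace `p` makes the rate applicable, and the scale reappears as `a = c⁻¹`.
  have hc : 0 < (p : ℝ) / B.trace := by positivity
  set c := (p : ℝ) / B.trace with hcdef
  have hA : (c • B).PosDef := hB.smul hc
  have hAtr : (c • B).trace = p := by
    rw [trace_smul, smul_eq_mul, hcdef, div_mul_cancel₀ _ htr.ne']
  have hAs : SolvesTyler W (c • B) := hBs.smul hc.ne' hB
  have hC := norm_sub_one_le_of_solvesTyler hn h (by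
    rw [← one_div, le_div_iff₀ (by positivity)]; nlinarith) hA hAtr hAs
  rw [← hg] at hC
  set C := c • B - 1 with hCdef
  have hAC : 1 + C = c • B := by rw [hCdef]; abel
  have hgδ : g * δ ≤ 1 / 2 := by rw [hg]; nlinarith
  have hC2 : ‖C‖ ≤ 1 / 2 := hC.trans hgδ
  have hBt : Bᵀ = B := (posDef_iff_inner.1 hB).1
  have hCt : Cᵀ = C := by rw [hCdef, transpose_sub, transpose_smul, hBt, transpose_one]
  have hC0 : C.trace = 0 := by rw [hCdef, trace_sub, hAtr, trace_one, Fintype.card_fin, sub_self]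
  refine ⟨c⁻¹, (1 + C)⁻¹, inv_pos.2 hc, ⟨?_, ?_, ?_, hdecomp.orthonormal, fun j => ?_, ?_⟩, ?_⟩
  · rw [transpose_nonsing_inv, transpose_add, transpose_one, hCt]
  · refine (norm_inv_one_add_sub_one_le hC2).trans ?_
    rw [mul_assoc (2 * (p : ℝ))]
    exact mul_le_mul_of_nonneg_left hC (by positivity)
  · rw [hg]; nlinarith
  · exact mul_le_mul_of_nonneg_left (hdecomp.antitone (Fin.zero_le j)) (inv_nonneg.2 hc.le)
  · have hLd := (Matrix.isUnit_iff_isUnit_det _).1 hL.isUnit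
    rw [hAC, inv_smul_of_posDef hB hc.ne', Matrix.mul_smul, Matrix.smul_mul, hBdef,
      mul_inv_conj hL.isUnit hV.isUnit, hdecomp.eq_sum]
    simp only [spectralSum, Finset.smul_sum, smul_smul]
  · refine (norm_linearisation_sub_le h hCt hC0 hC2 (hAC ▸ hAs)).trans ?_
    have h5 : ‖C‖ ^ 2 ≤ g ^ 2 * δ ^ 2 := by
      rw [← mul_pow]; exact pow_le_pow_left₀ (norm_nonneg _) hC 2
    have h6 : δ * ‖C‖ ≤ g * δ ^ 2 := by nlinarith
    calc _ ≤ ((p : ℝ) + 2) * (2 * (g ^ 2 * δ ^ 2) + g * δ ^ 2) + 4 * (g ^ 2 * δ ^ 2) := by gcongr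
      _ = _ := by ring

/-- The test statistic at the corrected estimator is close to the test statistic at the null shape
matrix, provided that the leading eigenvectors are not nearly orthogonal. -/
lemma abs_testStat_sub_le [NeZero p] (hL : IsRoot L θ₀ σ) (hU : IsImageSample L W U)
    (h : IsBalanced δ W) (hδ : δ ≤ 1) {a : ℝ} (ha : 0 < a) {H : Matrix (Fin p) (Fin p) ℝ} {ρ : ℝ}
    {l : Fin p → ℝ} {t : Fin p → EuclideanSpace ℝ (Fin p)}
    (hH : IsPerturbation L H ρ (fun j => a * l j) t) {η K κ : ℝ} (hη : 0 < η)
    (hη0 : η ≤ |⟪θ₀, t 0⟫|) (hK : K = 224 * p ^ 3 / η ^ 6 + 1)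
    (hρ : (3 * p ^ 2 * K + p) * ρ ≤ 1 / 2) (hκ : (3 * p ^ 2 * K + p) * ρ ≤ κ * δ) :
    |testStat θ₀ U (correctedShape θ₀ l t) - testStat θ₀ U (L * L)| ≤
      p * (p + 2) * ((κ + 2 * κ ^ 2) * (2 * p + (κ + 2 * κ ^ 2)) +
        κ * (p + (κ + 2 * κ ^ 2)) ^ 2) * (n * δ ^ 3) := by
  have hp1 : (1 : ℝ) ≤ p := by exact_mod_cast Nat.one_le_iff_ne_zero.2 (NeZero.ne p)
  have hσ := hL.pos
  have hρ0 : 0 ≤ ρ := (norm_nonneg _).trans hH.norm_sub_le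
  have hK0 : 0 ≤ K := by rw [hK]; positivity
  obtain ⟨hY, hYθ, hF⟩ := hH.correctedShape hL hη hη0 hK (by
    have : 0 ≤ K * ρ := by positivity
    nlinarith [mul_nonneg (by positivity : (0 : ℝ) ≤ p) hρ0])
  have hl := hH.pos hL 0
  have hl0 : 0 < l 0 := pos_of_mul_pos_right (by simpa using hl) ha.le
  have hYa : correctedShape θ₀ (fun j => a * l j) t = a • correctedShape θ₀ l t := by
    simp only [correctedShape, smul_add, Finset.smul_sum, smul_smul]
  have hY' : (correctedShape θ₀ l t).PosDef := by
    have := hY.smul (inv_pos.2 ha)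
    rwa [hYa, smul_smul, inv_mul_cancel₀ ha.ne', one_smul] at this
  rw [hYa] at hYθ hF
  rw [inv_smul_of_posDef hY' ha.ne'] at hF
  set Y := correctedShape θ₀ l t with hYdef
  have hYθ' : mulE Y θ₀ = l 0 • θ₀ := by
    rw [smul_mulE, mul_smul] at hYθ
    exact smul_right_injective _ ha.ne' hYθ
  have hF1 : (a * l 0 / σ ^ 2) • (L * a⁻¹ • Y⁻¹ * L) = (l 0 / σ ^ 2) • (L * Y⁻¹ * L) := by
    rw [Matrix.mul_smul, Matrix.smul_mul, smul_smul]
    congr 1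
    field_simp
  rw [hF1] at hF
  set F := (l 0 / σ ^ 2) • (L * Y⁻¹ * L) - 1 with hFdef
  have hF2 : 1 + F = (l 0 / σ ^ 2) • (L * Y⁻¹ * L) := by rw [hFdef]; abel
  have hFs : Fᵀ = F := by
    rw [hFdef, transpose_sub, transpose_smul, transpose_mul, transpose_mul, hL.symm,
      transpose_nonsing_inv, (posDef_iff_inner.1 hY').1, transpose_one, Matrix.mul_assoc]
  have hFθ : mulE F θ₀ = 0 := by
    rw [hFdef, sub_mulE, one_mulE, smul_mulE, mul_mulE, mul_mulE, hL.mulE_eq, mulE_smul,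
      mulE_inv_of_mulE_eq hY' hl0.ne' hYθ', mulE_smul, mulE_smul, hL.mulE_eq, smul_smul, smul_smul,
      smul_smul]
    have : l 0 / σ ^ 2 * (σ * ((l 0)⁻¹ * σ)) = 1 := by field_simp
    rw [← mul_assoc] at this
    rw [sub_eq_zero]
    convert one_smul ℝ θ₀ using 2
    field_simp
  have hVpd : (L * L).PosDef := by
    have := posDef_mul_transpose hL.isUnit
    rwa [hL.symm] at this
  have hVθ : mulE (L * L) θ₀ = σ ^ 2 • θ₀ := by
    rw [mul_mulE, hL.mulE_eq, mulE_smul, hL.mulE_eq, smul_smul, sq]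
  have hLd := (Matrix.isUnit_iff_isUnit_det _).1 hL.isUnit
  -- The null shape `L * L` is the case `F = 0` of `testStat_eq`, with eigenvalue `σ ^ 2`.
  have h0 : (1 : Matrix (Fin p) (Fin p) ℝ) + 0 = (σ ^ 2 / σ ^ 2) • (L * (L * L)⁻¹ * L) := by
    rw [div_self (by positivity), one_smul, add_zero, Matrix.mul_inv_rev, ← Matrix.mul_assoc,
      Matrix.mul_nonsing_inv _ hLd, one_mul, Matrix.nonsing_inv_mul _ hLd]
  have hw : (fun i => ⟪W i, mulE (1 + 0) (W i)⟫⁻¹) = fun _ : Fin n => (1 : ℝ) := by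
    funext i
    rw [add_zero, one_mulE, real_inner_self_eq_norm_sq, h.norm_eq, one_pow, inv_one]
  have e1 := testStat_eq hL.symm hU hσ hl0 hL.mulE_eq hY' hYθ' hF2 rfl
  have e2 := testStat_eq hL.symm hU hσ (by positivity) hL.mulE_eq hVpd hVθ h0 rfl
  have e3 := abs_inner_expansion_sub_le h hL.norm_eq hFs hFθ hF hρ hκ hδ rfl rfl
  rw [e1, e2, hw, add_zero, one_mulE, real_inner_self_eq_norm_sq, ← mul_sub, abs_mul,
    abs_of_nonneg (by positivity)]
  refine (mul_le_mul_of_nonneg_left e3 (by positivity)).trans (le_of_eq ?_)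
  ring

end TylerPerturbation

end SignPCA

namespace SignPCA

/-! ### The quantitative bound and the limit -/

section ProbabilityBound

open Matrix RealInnerProductSpace

attribute [local instance] Matrix.frobeniusNormedRing Matrix.frobeniusNormedSpace

variable {p n : ℕ} {L V : Matrix (Fin p) (Fin p) ℝ} {θ₀ : EuclideanSpace ℝ (Fin p)} {σ δ : ℝ}

lemma isImageSample_sphMap (hL : IsUnit L) (U : Fin n → Sph p) :
    IsImageSample L (fun i => (sphMap L hL (U i)).1) U := fun i =>
  have h0 := norm_ne_zero_iff.2 (mulE_inv_ne_zero hL (sph_ne_zero (U i)))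
  ⟨‖mulE L⁻¹ (U i).1‖, h0, by
    simp only [sphMap]
    rw [mulE_smul, mulE_inv_cancel hL, smul_smul, mul_inv_cancel₀ h0, one_smul]⟩

lemma sampleLaw_le_uniformSample [NeZero p] (hL : IsUnit L) (hV : V = L * Lᵀ)
    {S T : Set (Fin n → Sph p)} (hST : ∀ U, U ∈ S → (fun i => sphMap L hL (U i)) ∈ T) :
    sampleLaw n V S ≤ uniformSample p n T := by
  have h : MeasurePreserving (fun (U : Fin n → Sph p) i => sphMap L hL (U i)) (sampleLaw n V)
      (uniformSample p n) :=
    measurePreserving_pi _ _ fun _ => measurePreserving_sphMap hL hV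
  calc sampleLaw n V S ≤ sampleLaw n V ((fun U i => sphMap L hL (U i)) ⁻¹' T) := measure_mono hST
    _ ≤ _ := Measure.le_map_apply h.measurable.aemeasurable T
    _ = _ := by rw [h.map_eq]

/-- A quantitative version of the asymptotic equivalence. Here `M / √n` is the precision of the
empirical fourth moments, and `s ^ 2` is a lower bound for the cosine of the angle between `θ₀` and
the estimated leading eigenvector. -/
lemma sampleLaw_deviation_le [NeZero p] (hn : 0 < n) (hV : IsNullShape θ₀ V) {M s : ℝ} (hM : 0 < M)
    (hs : 0 < s) (hs2 : s ≤ 1 / 2) {g K₂ K κ ε : ℝ} (hδ : δ = p ^ 2 * (M / √n))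
    (hg : g = 2 * p * (p + 2)) (hK₂ : K₂ = (p + 2) * (2 * g ^ 2 + g) + 4 * g ^ 2)
    (hK : K = 224 * p ^ 3 / (s ^ 2) ^ 6 + 1) (hκ : κ = (3 * p ^ 2 * K + p) * (2 * p * g))
    (hδ1 : δ ≤ (1152 * (p : ℝ) ^ 4)⁻¹) (hδ2 : κ * δ ≤ 1 / 2)
    (hδ3 : 4 * (K₂ * δ ^ 2 + s ^ 2 * (p * (p + 2) * δ)) ≤ 1 / 4) (hδ4 : p * (p + 2) * δ ≤ 1 / 4)
    (hε : p * (p + 2) * ((κ + 2 * κ ^ 2) * (2 * p + (κ + 2 * κ ^ 2)) +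
        κ * (p + (κ + 2 * κ ^ 2)) ^ 2) * (n * δ ^ 3) < ε)
    {l : (Fin n → Sph p) → Fin p → ℝ} {t : (Fin n → Sph p) → Fin p → EuclideanSpace ℝ (Fin p)}
    (hdecomp : ∀ U, IsSpectralDecomp (tyler U) (l U) (t U)) :
    sampleLaw n V {U | ε ≤ |testStat θ₀ U (correctedShape θ₀ (l U) (t U)) - testStat θ₀ U V|} ≤
      ENNReal.ofReal (p ^ 4 / M ^ 2) + ENNReal.ofReal (64 * p * (p + 2) *
        ((√n)⁻¹ + 4 * K₂ * p ^ 2 * M * δ / s + 5 * p ^ 3 * (p + 2) * M * s)) := by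
  have hp1 : (1 : ℝ) ≤ p := by exact_mod_cast Nat.one_le_iff_ne_zero.2 (NeZero.ne p)
  have hn' : (0 : ℝ) < n := by exact_mod_cast hn
  have hsn : 0 < √(n : ℝ) := Real.sqrt_pos.2 hn'
  have hδ0 : 0 ≤ δ := by rw [hδ]; positivity
  have hδle : δ ≤ 1 := by
    have : 1 * δ ≤ p * (p + 2) * δ := by gcongr; nlinarith
    linarith
  have hg0 : 0 ≤ g := by rw [hg]; positivity
  have hK₂0 : 0 ≤ K₂ := by rw [hK₂]; positivity
  obtain ⟨L, σ, hL, hVL⟩ := exists_isRoot hV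
  set κ' : ℝ := 4 * (K₂ * δ ^ 2 + s ^ 2 * (p * (p + 2) * δ)) with hκ'
  have hκ'0 : 0 ≤ κ' := by positivity
  -- The threshold for the Rademacher sum; the summand `1` ensures `1 ≤ r`. With `η = s ^ 2` the
  -- part of `κ' / s` that is linear in `δ` is `4 p (p + 2) δ s`, which together with the last term
  -- gives the factor `5` in the bound.
  set r : ℝ := 1 + n * (κ' / s + p * (p + 2) * δ * s) with hr
  have hr1 : 1 ≤ r := by rw [hr]; linarith [(by positivity : 0 ≤ n * (κ' / s + p * (p + 2) * δ * s))]
  have hrn : 64 * p * (p + 2) * r / √n = 64 * p * (p + 2) *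
        ((√n)⁻¹ + 4 * K₂ * p ^ 2 * M * δ / s + 5 * p ^ 3 * (p + 2) * M * s) := by
    have h1 : √(n : ℝ) * δ = p ^ 2 * M := by rw [hδ]; field_simp
    have h2 : (n : ℝ) = √n * √n := (Real.mul_self_sqrt hn'.le).symm
    have h3 : r / √n = (√n)⁻¹ + √n * (κ' / s + p * (p + 2) * δ * s) := by
      rw [hr, add_div, one_div]
      congr 1
      nth_rewrite 1 [h2]
      field_simp
    have h4 : √(n : ℝ) * (κ' / s + p * (p + 2) * δ * s) =
        (√n * δ) * (4 * K₂ * δ / s + 5 * p * (p + 2) * s) := by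
      rw [hκ']; field_simp; ring
    rw [mul_div_assoc, h3, h4, h1]
    ring
  rw [← hrn]
  calc _ ≤ uniformSample p n ({U | ¬ IsBalanced (p ^ 2 * (M / √n)) fun i => (U i).1} ∪
        {U | IsBalanced δ (fun i => (U i).1) ∧ IsNearMax L θ₀ (κ' * σ ^ 2) fun i => (U i).1}) := by
        refine sampleLaw_le_uniformSample hL.isUnit (by rw [hVL, hL.symm]) fun U hUS => ?_
        have hU := isImageSample_sphMap hL.isUnit U
        set W : Fin n → EuclideanSpace ℝ (Fin p) := fun i => (sphMap L hL.isUnit (U i)).1 with hW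
        by_contra hcon
        simp only [Set.mem_union, Set.mem_ofPred_eq, not_or, not_not, not_and] at hcon
        obtain ⟨hb, hnear⟩ := hcon
        rw [← hδ] at hb
        have hnear := hnear hb
        obtain ⟨a, H, ha, hH, hH2⟩ :=
          exists_isPerturbation_tyler hn hL hU hb hδ1 (hdecomp U) hg
        rw [← hK₂] at hH2
        rcases le_total (s ^ 2) |⟪θ₀, t U 0⟫| with hη | hη
        · have hκδ : (3 * p ^ 2 * K + p) * (2 * p * g * δ) = κ * δ := by rw [hκ]; ring
          have h1 := abs_testStat_sub_le hL hU hb hδle ha hH (by positivity) hη hK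
            (hκδ.le.trans hδ2) hκδ.le
          rw [← hVL] at h1
          exact absurd (hUS.trans h1) (not_le.2 hε)
        · exact hnear (hH.isNearMax hL (norm_linearised_sub_one_le hb) hH2 hη (by nlinarith))
    _ ≤ _ := (measure_union_le _ _).trans (add_le_add (uniformSample_not_isBalanced_le hn hM)
        (uniformSample_isNearMax_le hn hL hκ'0 hδ3 hs (by linarith) hδ4 hr1 (by linarith)))

end ProbabilityBound

end SignPCA

theorem mainTheorem2 {p : ℕ} [NeZero p]
    (θ₀ : EuclideanSpace ℝ (Fin p)) (hθ₀ : ‖θ₀‖ = 1)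
    (V₀ : ℕ → Matrix (Fin p) (Fin p) ℝ) (hV₀ : ∀ n, SignPCA.IsNullShape θ₀ (V₀ n))
    (lhat : ∀ n : ℕ, (Fin n → SignPCA.Sph p) → Fin p → ℝ)
    (that : ∀ n : ℕ, (Fin n → SignPCA.Sph p) → Fin p → EuclideanSpace ℝ (Fin p))
    (hdecomp : ∀ (n : ℕ) (U : Fin n → SignPCA.Sph p),
      SignPCA.IsSpectralDecomp (SignPCA.tyler U) (lhat n U) (that n U)) :
    ∀ ε : ℝ, 0 < ε →
      Tendsto (fun n : ℕ => SignPCA.sampleLaw n (V₀ n)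
        {U | ε ≤ |SignPCA.testStat θ₀ U
                    (SignPCA.correctedShape θ₀ (lhat n U) (that n U)) -
                  SignPCA.testStat θ₀ U (V₀ n)|})
        atTop (𝓝 0) := by
  intro ε hε
  have hp0 : (0 : ℝ) < p := by exact_mod_cast Nat.pos_of_ne_zero (NeZero.ne p)
  refine ENNReal.tendsto_nhds_zero.2 fun τ' hτ' => ?_
  obtain ⟨τ, hτ, hττ⟩ := ENNReal.lt_iff_exists_nnreal_btwn.1 hτ'
  have hτ0 : (0 : ℝ) < τ := by exact_mod_cast hτ
  -- `M` is fixed first, to make imbalance unlikely; then `s`, depending on `M`, to make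
  -- near-orthogonality unlikely; all other terms vanish as `n` grows. None of these choices
  -- involves `V₀`.
  obtain ⟨M, hM, hMτ⟩ : ∃ M : ℝ, 0 < M ∧ p ^ 4 / M ^ 2 ≤ (τ : ℝ) / 2 := by
    refine ⟨√(2 * p ^ 4 / τ), by positivity, le_of_eq ?_⟩
    rw [Real.sq_sqrt (by positivity)]
    field_simp
  obtain ⟨s, hs, hs2, hsτ⟩ : ∃ s : ℝ, 0 < s ∧ s ≤ 1 / 2 ∧
      64 * p * (p + 2) * (5 * p ^ 3 * (p + 2) * M * s) ≤ (τ : ℝ) / 4 := by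
    set c : ℝ := 64 * p * (p + 2) * (5 * p ^ 3 * (p + 2) * M) with hc
    have hc0 : 0 < c := by positivity
    refine ⟨min (1 / 2) (τ / 4 / c), by positivity, min_le_left _ _, ?_⟩
    calc _ = c * min (1 / 2) (τ / 4 / c) := by rw [hc]; ring
      _ ≤ c * (τ / 4 / c) := by gcongr; exact min_le_right _ _
      _ = τ / 4 := by field_simp
  obtain ⟨g, hg⟩ : ∃ g : ℝ, g = 2 * p * (p + 2) := ⟨_, rfl⟩
  obtain ⟨K₂, hK₂⟩ : ∃ K₂ : ℝ, K₂ = (p + 2) * (2 * g ^ 2 + g) + 4 * g ^ 2 := ⟨_, rfl⟩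
  obtain ⟨K, hK⟩ : ∃ K : ℝ, K = 224 * p ^ 3 / (s ^ 2) ^ 6 + 1 := ⟨_, rfl⟩
  obtain ⟨κ, hκ⟩ : ∃ κ : ℝ, κ = (3 * p ^ 2 * K + p) * (2 * p * g) := ⟨_, rfl⟩
  obtain ⟨B, hB⟩ : ∃ B : ℝ, B = p * (p + 2) * ((κ + 2 * κ ^ 2) * (2 * p + (κ + 2 * κ ^ 2)) +
    κ * (p + (κ + 2 * κ ^ 2)) ^ 2) := ⟨_, rfl⟩
  -- Each remaining smallness condition is a strict inequality for a continuous function of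
  -- `n^{-1/2}` that holds at `0`.
  have hroot : Tendsto (fun n : ℕ => (√(n : ℝ))⁻¹) atTop (𝓝 0) :=
    tendsto_inv_atTop_zero.comp (Real.tendsto_sqrt_atTop.comp tendsto_natCast_atTop_atTop)
  have hlim : ∀ {f : ℝ → ℝ} {b : ℝ}, Continuous f → f 0 < b →
      ∀ᶠ n : ℕ in atTop, f (√(n : ℝ))⁻¹ < b := fun hf hb =>
    ((hf.tendsto 0).comp hroot).eventually_lt_const hb
  have e1 := hlim (f := fun x => p ^ 2 * (M * x)) (b := (1152 * (p : ℝ) ^ 4)⁻¹) (by fun_prop)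
    (by simp only [mul_zero]; positivity)
  have e2 := hlim (f := fun x => κ * (p ^ 2 * (M * x))) (b := 1 / 2) (by fun_prop) (by simp)
  have e3 := hlim (f := fun x => 4 * (K₂ * (p ^ 2 * (M * x)) ^ 2 +
    s ^ 2 * (p * (p + 2) * (p ^ 2 * (M * x))))) (b := 1 / 4) (by fun_prop) (by simp)
  have e4 := hlim (f := fun x => p * (p + 2) * (p ^ 2 * (M * x))) (b := 1 / 4) (by fun_prop)
    (by simp)
  have e5 := hlim (f := fun x => B * (p ^ 6 * M ^ 3 * x)) (b := ε) (by fun_prop) (by simpa using hε)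
  have e6 := hlim (f := fun x => 64 * p * (p + 2) * (x + 4 * K₂ * p ^ 2 * M * (p ^ 2 * (M * x)) / s))
    (b := (τ : ℝ) / 4) (by fun_prop) (by simpa using hτ0)
  filter_upwards [e1, e2, e3, e4, e5, e6, eventually_gt_atTop 0] with n h1 h2 h3 h4 h5 h6 hn
  have hn' : (0 : ℝ) < n := by exact_mod_cast hn
  have hsn : 0 < √(n : ℝ) := Real.sqrt_pos.2 hn'
  have hnn : (n : ℝ) * (p ^ 2 * (M / √n)) ^ 3 = p ^ 6 * M ^ 3 * (√(n : ℝ))⁻¹ := by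
    have h : (n : ℝ) = √n ^ 2 := (Real.sq_sqrt hn'.le).symm
    nth_rewrite 1 [h]
    field_simp
  simp only [← div_eq_mul_inv M] at h1 h2 h3 h4 h6
  refine (SignPCA.sampleLaw_deviation_le hn (hV₀ n) hM hs hs2 rfl hg hK₂ hK hκ h1.le h2.le h3.le h4.le
    (by rw [← hB, hnn]; exact h5) (hdecomp n)).trans (le_trans ?_ hττ.le)
  rw [← ENNReal.ofReal_add (by positivity) (by
    have : 0 ≤ K₂ := by rw [hK₂, hg]; positivity
    positivity), ← ENNReal.ofReal_coe_nnreal]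
  refine ENNReal.ofReal_le_ofReal ?_
  have e : 64 * (p : ℝ) * (p + 2) * ((√(n : ℝ))⁻¹ + 4 * K₂ * p ^ 2 * M * (p ^ 2 * (M / √n)) / s +
      5 * p ^ 3 * (p + 2) * M * s) = 64 * p * (p + 2) * ((√(n : ℝ))⁻¹ +
      4 * K₂ * p ^ 2 * M * (p ^ 2 * (M / √n)) / s) +
      64 * p * (p + 2) * (5 * p ^ 3 * (p + 2) * M * s) := by ring
  rw [e]
  linarith
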